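/- Let $\omega>0$ be irrational, $q=e^{2\pi i\omega}$, $Q=e^{2\pi i/\omega}$, and write $q^{u}=e^{2\pi i\omega u}$ for $u\in\mathbb C$. Let $S_2(x\,|\,1,\tfrac1\omega)$ be the double sine function, i.e. the meromorphic function with $$\log S_2(x|1,\tfrac1\omega)=\int_0^\infty\Big(\frac{\sinh((2x-1-\frac1\omega)t)}{2\sinh(t)\sinh(t/\omega)}-\frac{2x-1-\frac1\omega}{2t/\omega}\Big)\frac{dt}{t}\quad(0<\mathrm{Re}\,x<1+\tfrac1\omega),\qquad \frac{S_2(x+1)}{S_2(x)}=\frac{1}{2\sin(\pi\omega x)},$$ and set $\langle x\rangle=\exp\big(\frac{\pi i}{2}((1+\omega)x-\omega x^2)\big)S_2(x|1,\tfrac1\omega)$; its zeros are $\mathbb Z_{\le0}+\frac1\omega\mathbb Z_{\le0}$ and its poles $\mathbb Z_{\ge1}+\frac1\omega\mathbb Z_{\ge1}$. For $\alpha,\beta,\gamma,x\in\mathbb C$ put $$\Psi(\alpha,\beta,\gamma;x)=\frac{\langle\alpha\rangle\langle\beta\rangle}{\langle1\rangle\langle\gamma\rangle}\Big(-\frac1{2\pi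 i}\Big)\int_{C_0}\frac{\langle z+1\rangle\langle z+\gamma\rangle}{\langle z+\alpha\rangle\langle z+\beta\rangle}\,\frac{\pi(-q^x)^z}{\sin\pi z}\,dz,\qquad(-q^x)^z=e^{(2\pi i\omega x-\pi i)z},$$ where $C_0$ runs from $-i\infty$ to $i\infty$, coincides with the imaginary axis outside a bounded part, and has the points $-\alpha+\mathbb Z_{\le0}+\frac1\omega\mathbb Z_{\le0}$ and $-\beta+\mathbb Z_{\le0}+\frac1\omega\mathbb Z_{\le0}$ on its left and the points $\mathbb Z_{\ge0}+\frac1\omega\mathbb Z_{\ge0}$ and $-\gamma+\mathbb Z_{\ge1}+\frac1\omega\mathbb Z_{\ge1}$ on its right. We say that $\Psi(\alpha,\beta,\gamma;x)$ is defined (by the contour $C_0$) if $C_0$ is such a contour, $\alpha,\beta$ are not poles and $\gamma$ is not a zero of $\langle\cdot\rangle$, and $0<\mathrm{Re}\,x<1+\frac1\omega+\mathrm{Re}\,\gamma-\mathrm{Re}\,\alpha-\mathrm{Re}\,\beta$. More generally, put $T=e^{2\pi iz}$, $A=e^{2\pi i\alpha}$, $B=e^{2\pi i\beta}$, $C=e^{2\pi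 i\gamma}$, $(y;Q)_n=\prod_{j=0}^{n-1}(1-yQ^j)$, and let $$\widetilde\varphi(T)=\frac{\sum_m f_mT^m}{(AQ^{-\ell_1}T;Q)_{\ell_1}(BQ^{-\ell_2}T;Q)_{\ell_2}(QT;Q)_{\ell_1'}(CT;Q)_{\ell_2'}}$$ with a Laurent polynomial as numerator and $\ell_1,\ell_2,\ell_1',\ell_2'\in\mathbb Z_{\ge0}$. Put $$\Psi(\alpha,\beta,\gamma;x|\widetilde\varphi)=\frac{\langle\alpha\rangle\langle\beta\rangle}{\langle1\rangle\langle\gamma\rangle}\int_{C_0}q^{xz}\frac{\langle z+1+\frac1\omega\rangle\langle z+\gamma\rangle}{\langle z+\alpha\rangle\langle z+\beta\rangle}\,\widetilde\varphi(T)\,dz,$$ where now $C_0$ has $-\alpha+\frac{\ell_1}\omega+\mathbb Z_{\le0}+\frac1\omega\mathbb Z_{\le0}$ and $-\beta+\frac{\ell_2}\omega+\mathbb Z_{\le0}+\frac1\omega\mathbb Z_{\le0}$ on its left and $-\frac{\ell_1'}\omega+\mathbb Z_{\ge0}+\frac1\omega\mathbb Z_{\ge0}$ and $-\gamma-\frac{\ell_2'}\omega+\mathbb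 Z_{\ge1}+\frac1\omega\mathbb Z_{\ge1}$ on its right. It is called defined under the same conditions on the prefactor, if moreover $0<\mathrm{Re}\,x+\frac m\omega<1+\frac1\omega+\mathrm{Re}\,\gamma-\mathrm{Re}\,\alpha-\mathrm{Re}\,\beta+\frac{\ell_1+\ell_2+\ell_1'+\ell_2'}{\omega}$ for every $m$ with $f_m\ne0$. (Integer shifts of $\alpha,\beta,\gamma$ do not change $A,B,C$, so the same $\widetilde\varphi$ may be used for all of them.) Then all these integrals converge absolutely. Write $a=q^\alpha$, $b=q^\beta$, $c=q^\gamma$ and $\Psi(\alpha,\beta,\gamma)=\Psi(\alpha,\beta,\gamma;x)$. Each of the following relations holds whenever the three values of $\Psi$ in it are defined, each by some contour of its own, and the denominators in it do not vanish: $$\Psi(\alpha,\beta,\gamma-1)-\Psi(\alpha,\beta,\gamma)=q^{x}c\,\frac{(1-a)(1-b)}{(q-c)(1-c)}\,\Psi(\alpha+1,\beta+1,\gamma+1),$$ $$\Psi(\alpha+1,\beta,\gamma)-\Psi(\alpha,\beta,\gamma)=q^{x}a\,\frac{1-b}{1-c}\,\Psi(\alpha+1,\beta+1,\gamma+1),$$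 $$\Psi(\alpha+1,\beta-1,\gamma)-\Psi(\alpha,\beta,\gamma)=q^{x-1}\,\frac{aq-b}{1-c}\,\Psi(\alpha+1,\beta,\gamma+1).$$ The same three relations hold with every $\Psi(\cdot,\cdot,\cdot\,;x)$ replaced by $\Psi(\cdot,\cdot,\cdot\,;x|\widetilde\varphi)$. -/

import Mathlib

namespace QUnit

open Complex MeasureTheory Filter

noncomputable section

/-! ### The double sine function and the function `⟨x⟩` -/

/-- The double sine function on the strip `0 < Re x < ω₁ + ω₂` (where the integral converges
absolutely), through its classical integral representation. -/
def doubleSineStrip (ω₁ ω₂ : ℝ) (x : ℂ) : ℂ :=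
  exp (∫ t in Set.Ioi (0 : ℝ),
    (sinh ((2 * x - ω₁ - ω₂) * t) / (2 * sinh (ω₁ * t) * sinh (ω₂ * t))
      - (2 * x - ω₁ - ω₂) / (2 * ω₁ * ω₂ * t)) / t)

/-- The double sine function `S₂(x | ω₁, ω₂)`, a meromorphic function on `ℂ`. It has simple zeros
at `ω₁ ℤ_{≤ 0} + ω₂ ℤ_{≤ 0}` and simple poles at `ω₁ ℤ_{≥ 1} + ω₂ ℤ_{≥ 1}` when `ω₁ / ω₂` is
irrational. Outside the strip `0 < Re x ≤ ω₁` it is continued by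
`S₂(x + ω₁) = S₂(x) / (2 sin (π x / ω₂))`; at a pole the value is `0` by convention. Here
`x = y + N ω₁` with `0 < Re y ≤ ω₁`; one of the two products is always empty. -/
def doubleSine (ω₁ ω₂ : ℝ) (x : ℂ) : ℂ :=
  let N : ℤ := ⌈x.re / ω₁⌉ - 1
  let y : ℂ := x - N * ω₁
  doubleSineStrip ω₁ ω₂ y
    * (∏ j ∈ Finset.range (-N).toNat, 2 * sin (Real.pi * (y - (j + 1) * ω₁) / ω₂))
    / (∏ j ∈ Finset.range N.toNat, 2 * sin (Real.pi * (y + j * ω₁) / ω₂))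

/-- `⟨x⟩ = exp (π i ((1 + ω) x - ω x²) / 2) S₂(x | 1, 1/ω)`. -/
def bra (ω : ℝ) (x : ℂ) : ℂ :=
  exp (Real.pi * I / 2 * ((1 + ω) * x - ω * x ^ 2)) * doubleSine 1 (1 / ω) x

/-- The zeros of `⟨x⟩`: the set `ℤ_{≤ 0} + (1/ω) ℤ_{≤ 0}`. -/
def braZeros (ω : ℝ) : Set ℂ := {u | ∃ m n : ℕ, u = -(m : ℂ) - n / ω}

/-- The poles of `⟨x⟩`: the set `ℤ_{≥ 1} + (1/ω) ℤ_{≥ 1}`. -/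
def braPoles (ω : ℝ) : Set ℂ := {u | ∃ m n : ℕ, u = ((m : ℂ) + 1) + ((n : ℂ) + 1) / ω}

/-- `q ^ u = e^{2 π i ω u}`, where `q = e^{2 π i ω}`. -/
def qpow (ω : ℝ) (u : ℂ) : ℂ := exp (2 * Real.pi * I * ω * u)

/-- `(x; p)_n = ∏_{j = 0}^{n - 1} (1 - x p^j)`. -/
def poch (x p : ℂ) (n : ℕ) : ℂ := ∏ j ∈ Finset.range n, (1 - x * p ^ j)

/-! ### Contours -/

/-- A contour that runs from `-i∞` to `i∞` and coincides with the imaginary axis outside a bounded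
part. The derivative of the parametrization may vanish, so corners are allowed. -/
structure Contour where
  path : ℝ → ℂ
  contDiff : ContDiff ℝ 1 path
  eq_axis : ∃ R : ℝ, ∀ s : ℝ, R ≤ |s| → path s = s * I

/-- `p` lies on the left of the contour: in its complement, `p` can be joined to the far left. -/
def Contour.OnLeft (C : Contour) (p : ℂ) : Prop :=
  ∀ᶠ u : ℝ in atBot, JoinedIn (Set.range C.path)ᶜ p (u : ℂ)

/-- `p` lies on the right of the contour: in its complement, `p` can be joined to the far right. -/
def Contour.OnRight (C : Contour) (p : ℂ) : Prop :=
  ∀ᶠ u : ℝ in atTop, JoinedIn (Set.range C.path)ᶜ p (u : ℂ)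

/-- `∫_C f(z) dz`. -/
def Contour.integral (C : Contour) (f : ℂ → ℂ) : ℂ :=
  ∫ s : ℝ, f (C.path s) * deriv C.path s

/-- Absolute convergence of `∫_C f(z) dz`. -/
def Contour.Converges (C : Contour) (f : ℂ → ℂ) : Prop :=
  Integrable (fun s : ℝ => f (C.path s) * deriv C.path s)

/-! ### The space `Z̃` -/

/-- The data `f̃, ℓ̃₁, ℓ̃₂, ℓ̃₁', ℓ̃₂'` of an element
`f̃(T) / ((A Q^{-ℓ̃₁} T; Q)_{ℓ̃₁} (B Q^{-ℓ̃₂} T; Q)_{ℓ̃₂} (Q T; Q)_{ℓ̃₁'} (C T; Q)_{ℓ̃₂'})` of `Z̃`,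
with a Laurent polynomial `f̃(T) = ∑ num(m) T^m`. (Here `γ₁ = α`, `γ₂ = β`, `γ₁' = 1 + 1/ω`, `γ₂' = γ`, so that
`C₁' = e^{2 π i γ₁'} = Q`.) -/
structure Twist where
  num : ℤ →₀ ℂ
  l₁ : ℕ
  l₂ : ℕ
  l₁' : ℕ
  l₂' : ℕ

/-- The element of `Z̃` as a function of `T`, with `A = e^{2 π i α}`, `B = e^{2 π i β}`,
`C = e^{2 π i γ}` and `Q = e^{2 π i / ω}`. -/
def Twist.toFun (φ : Twist) (ω : ℝ) (α β γ : ℂ) (T : ℂ) : ℂ :=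
  let Q : ℂ := exp (2 * Real.pi * I / ω)
  let A : ℂ := exp (2 * Real.pi * I * α)
  let B : ℂ := exp (2 * Real.pi * I * β)
  let C : ℂ := exp (2 * Real.pi * I * γ)
  (∑ m ∈ φ.num.support, φ.num m * T ^ m) /
    (poch (A * Q ^ (-(φ.l₁ : ℤ)) * T) Q φ.l₁ * poch (B * Q ^ (-(φ.l₂ : ℤ)) * T) Q φ.l₂
      * poch (Q * T) Q φ.l₁' * poch (C * T) Q φ.l₂')

/-! ### The `q`-hypergeometric function of the Barnes type at `|q| = 1` -/

/-- `C` separates the poles: those at `-α + l₁/ω + ℤ_{≤ 0} + (1/ω) ℤ_{≤ 0}` and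
`-β + l₂/ω + ℤ_{≤ 0} + (1/ω) ℤ_{≤ 0}` are on its left, those at
`-l₁'/ω + ℤ_{≥ 0} + (1/ω) ℤ_{≥ 0}` and `-γ - l₂'/ω + ℤ_{≥ 1} + (1/ω) ℤ_{≥ 1}` on its right. -/
def Separates (ω : ℝ) (l₁ l₂ l₁' l₂' : ℕ) (α β γ : ℂ) (C : Contour) : Prop :=
  (∀ u ∈ braZeros ω, C.OnLeft (-α + l₁ / ω + u) ∧ C.OnLeft (-β + l₂ / ω + u)) ∧
  (∀ u ∈ braPoles ω, C.OnRight (-(1 + 1 / ω) - l₁' / ω + u) ∧ C.OnRight (-γ - l₂' / ω + u))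

/-- The factor `⟨α⟩⟨β⟩ / (⟨1⟩⟨γ⟩)` in front of the integral is finite. -/
def Regular (ω : ℝ) (α β γ : ℂ) : Prop :=
  α ∉ braPoles ω ∧ β ∉ braPoles ω ∧ γ ∉ braZeros ω

/-- The integrand of the Barnes type integral,
`-(1 / (2πi)) · ⟨z+1⟩⟨z+γ⟩ / (⟨z+α⟩⟨z+β⟩) · π (-q^x)^z / sin (π z)`, where `(-q^x)^z` is
`e^{(2 π i ω x - π i) z}`. -/
def barnesIntegrand (ω : ℝ) (α β γ x z : ℂ) : ℂ :=
  -(1 / (2 * Real.pi * I)) *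
    (bra ω (z + 1) * bra ω (z + γ) / (bra ω (z + α) * bra ω (z + β))) *
    (Real.pi * exp ((2 * Real.pi * I * ω * x - Real.pi * I) * z) / sin (Real.pi * z))

/-- `Ψ(α, β, γ; x)`, computed along the contour `C`. -/
def Psi (ω : ℝ) (C : Contour) (α β γ x : ℂ) : ℂ :=
  bra ω α * bra ω β / (bra ω 1 * bra ω γ) * C.integral (barnesIntegrand ω α β γ x)

/-- What is needed for `Ψ(α, β, γ; x)` to be defined by an integral along `C`. -/
def PsiAdmissible (ω : ℝ) (C : Contour) (α β γ x : ℂ) : Prop :=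
  Regular ω α β γ ∧ Separates ω 0 0 0 0 α β γ C ∧
    0 < x.re ∧ x.re < 1 + 1 / ω + γ.re - α.re - β.re

/-- `Φ(z) φ̃(T)` with `Φ(z) = q^{xz} ⟨z + 1 + 1/ω⟩⟨z+γ⟩ / (⟨z+α⟩⟨z+β⟩)` and `T = e^{2 π i z}`. -/
def twistedIntegrand (ω : ℝ) (α β γ x : ℂ) (φ : ℂ → ℂ) (z : ℂ) : ℂ :=
  qpow ω (x * z) *
    (bra ω (z + 1 + 1 / ω) * bra ω (z + γ) / (bra ω (z + α) * bra ω (z + β))) *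
    φ (exp (2 * Real.pi * I * z))

/-- `Ψ(α, β, γ; x | φ̃)`, computed along the contour `C`. -/
def PsiTwisted (ω : ℝ) (C : Contour) (α β γ x : ℂ) (φ : ℂ → ℂ) : ℂ :=
  bra ω α * bra ω β / (bra ω 1 * bra ω γ) * C.integral (twistedIntegrand ω α β γ x φ)

/-- What is needed for `Ψ(α, β, γ; x | φ̃)` to be defined by an integral along `C`. -/
def TwistedAdmissible (ω : ℝ) (φ : Twist) (C : Contour) (α β γ x : ℂ) : Prop :=
  Regular ω α β γ ∧ Separates ω φ.l₁ φ.l₂ φ.l₁' φ.l₂' α β γ C ∧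
    ∀ m ∈ φ.num.support, 0 < x.re + m / ω ∧
      x.re + m / ω < 1 + 1 / ω + γ.re - α.re - β.re + (φ.l₁ + φ.l₂ + φ.l₁' + φ.l₂') / ω

end

end QUnit

open QUnit

namespace QUnit
open Complex MeasureTheory Filter Set Topology

/-! ### Bounds for hyperbolic integrands -/

/-! In both families the integrand is, off a countable set, a linear combination of kernels q^{Xz}
⟨z+c⟩⟨z+d⟩ / (⟨z+a⟩⟨z+b⟩) (`braKernel`). Indeed ⟨x + 1/ω⟩ = ⟨x⟩ / (1 - e^{2πix}) turns ⟨z+1⟩ /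
sin(πz) into ⟨z+1+1/ω⟩ times an exponential, and turns the Q-shifted factorials in the denominator
of φ̃ into shifts of a, b, c, d by multiples of 1/ω, while T^m = q^{mz/ω} only moves X. So Ψ is the
case φ̃ = 1 of the twisted integral.

By ⟨x + 1⟩ = ⟨x⟩ / (1 - q^x), the three kernels of each relation, the third one taken at z - 1, are
rational functions of q^z times one common kernel, and the relation becomes an identity of
polynomials in q^z of degree one. Its coefficients see the parameters only through powers of q, and
q^{1/ω} = 1, so all summands of φ̃ obey the same relation. The factors in front of the integrals are
compared by the same shift equation.

It remains to integrate an identity whose third term is translated by 1, along three unrelated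
contours. In vertical strips log |⟨z⟩| = πω (2 Re z - 1 - 1/ω) min(Im z, 0) + O(1)
(`exists_log_norm_bra`), so the inequalities on x give exponential decay
(`verticalDecay_braKernel`). A contour may cross itself and its sides are defined through path
components, so nothing is deformed. Instead a truncated contour is treated as a linear functional
(`IsChain`). Two chains with equal endpoints agree on a meromorphic function as soon as they agree
on 1/(z - p) for its poles p (`IsChain.eq_zero`), and for a contour that integral depends only on
the side of p (`Contour.pathInt_inv_of_onLeft`, `Contour.pathInt_inv_of_onRight`). Hence, up to
horizontal segments that vanish in the limit, all three integrals are values of one chain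
(`exists_chain_of_residues`), to which the pointwise identity applies (`Contour.integral_relation`).

The facts on ⟨x⟩ come from the integral for log S₂: a shift by a period reduces to an integral for
-log(2 sin πx) (`exp_sineIntegral`), and the real part of the integral gives the growth
(`exists_log_norm_doubleSineStrip`). -/

theorem norm_ofReal_nonneg {r : ℝ} (h : 0 ≤ r) : ‖(r : ℂ)‖ = r := by
  rw [norm_real, Real.norm_of_nonneg h]

theorem norm_sinh_sub_self_le (z : ℂ) : ‖sinh z - z‖ ≤ ‖z‖ ^ 3 * Real.exp ‖z‖ := by
  have h1 := norm_exp_sub_sum_le_norm_mul_exp z 3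
  have h2 := norm_exp_sub_sum_le_norm_mul_exp (-z) 3
  rw [norm_neg] at h2
  have h3 : sinh z - z = ((exp z - ∑ m ∈ Finset.range 3, z ^ m / m.factorial)
      - (exp (-z) - ∑ m ∈ Finset.range 3, (-z) ^ m / m.factorial)) / 2 := by
    rw [sinh]
    simp [Finset.sum_range_succ, Nat.factorial]
    ring
  rw [h3, norm_div]
  have := norm_sub_le (exp z - ∑ m ∈ Finset.range 3, z ^ m / (m.factorial : ℂ))
    (exp (-z) - ∑ m ∈ Finset.range 3, (-z) ^ m / (m.factorial : ℂ))
  rw [RCLike.norm_ofNat, div_le_iff₀ (by norm_num)]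
  linarith

theorem norm_sinh_le (z : ℂ) : ‖sinh z‖ ≤ Real.exp |z.re| := by
  rw [sinh, norm_div, RCLike.norm_ofNat, div_le_iff₀ (by norm_num)]
  have := norm_sub_le (exp z) (exp (-z))
  rw [norm_exp, norm_exp, neg_re] at this
  have h1 := Real.exp_le_exp.2 (le_abs_self z.re)
  have h2 := Real.exp_le_exp.2 (neg_le_abs z.re)
  linarith

theorem le_sinh_of_nonneg {t : ℝ} (ht : 0 ≤ t) : t ≤ Real.sinh t := Real.self_le_sinh_iff.2 ht

theorem sinh_lower {a t : ℝ} (ha : 0 < a) (ht : 1 ≤ t) :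
    (1 - Real.exp (-2 * a)) / 2 * Real.exp (a * t) ≤ Real.sinh (a * t) := by
  rw [Real.sinh_eq]
  have : Real.exp (-(a * t)) ≤ Real.exp (-2 * a) * Real.exp (a * t) := by
    rw [← Real.exp_add]
    exact Real.exp_le_exp.2 (by nlinarith)
  linarith

/-- The integrand of `log S₂`, with `w = 2 x - ω₁ - ω₂`. -/
noncomputable def dsKernel (ω₁ ω₂ : ℝ) (w : ℂ) (t : ℝ) : ℂ :=
  (sinh (w * t) / (2 * sinh (ω₁ * t) * sinh (ω₂ * t)) - w / (2 * ω₁ * ω₂ * t)) / t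

theorem doubleSineStrip_eq (ω₁ ω₂ : ℝ) (x : ℂ) :
    doubleSineStrip ω₁ ω₂ x = exp (∫ t in Ioi (0 : ℝ), dsKernel ω₁ ω₂ (2 * x - ω₁ - ω₂) t) := rfl

theorem sinh_ofReal_mul (a t : ℝ) : sinh ((a : ℂ) * t) = (Real.sinh (a * t) : ℂ) := by
  push_cast; rfl

/-- Both terms of the kernel are of order 1/t² at 0. Over a common denominator, which is at least a
constant times t⁴, the numerator contains only third order Taylor remainders of sinh times one
further power of t, so it is O(t⁴) as well; `A` collects their constants. -/
theorem exists_dsKernel_bound_small {ω₁ ω₂ : ℝ} (h₁ : 0 < ω₁) (h₂ : 0 < ω₂) (M : ℝ) :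
    ∃ K : ℝ, 0 ≤ K ∧ ∀ w : ℂ, ‖w‖ ≤ M → ∀ t : ℝ, 0 < t → t ≤ 1 → ‖dsKernel ω₁ ω₂ w t‖ ≤ K := by
  by_cases hM : 0 ≤ M
  swap
  · exact ⟨0, le_rfl, fun w hw => absurd ((norm_nonneg w).trans hw) hM⟩
  set A := M ^ 3 * Real.exp M * (ω₁ * ω₂) + M * (ω₁ ^ 3 * Real.exp ω₁ * (Real.exp ω₂ * ω₂ ^ 3 + ω₂)
    + ω₁ * (ω₂ ^ 3 * Real.exp ω₂)) with hA
  have hA0 : 0 ≤ A := by positivity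
  refine ⟨A / (2 * ω₁ ^ 2 * ω₂ ^ 2), by positivity, fun w hw t ht ht1 => ?_⟩
  have key : ∀ {a : ℝ}, 0 < a → ‖sinh ((a : ℂ) * t) - a * t‖ ≤ a ^ 3 * Real.exp a * t ^ 3 := by
    intro a ha
    refine (norm_sinh_sub_self_le _).trans ?_
    have hn : ‖(a : ℂ) * t‖ = a * t := by
      rw [norm_mul, norm_ofReal_nonneg ha.le, norm_ofReal_nonneg ht.le]
    rw [hn, mul_pow]
    have : Real.exp (a * t) ≤ Real.exp a := Real.exp_le_exp.2 (by nlinarith)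
    calc a ^ 3 * t ^ 3 * Real.exp (a * t) ≤ a ^ 3 * t ^ 3 * Real.exp a := by gcongr
      _ = _ := by ring
  have keyw : ‖sinh (w * t) - w * t‖ ≤ M ^ 3 * Real.exp M * t ^ 3 := by
    refine (norm_sinh_sub_self_le _).trans ?_
    have hn : ‖w * t‖ = ‖w‖ * t := by rw [norm_mul, norm_ofReal_nonneg ht.le]
    rw [hn, mul_pow]
    have : Real.exp (‖w‖ * t) ≤ Real.exp M := Real.exp_le_exp.2 (by nlinarith [norm_nonneg w])
    calc ‖w‖ ^ 3 * t ^ 3 * Real.exp (‖w‖ * t) ≤ M ^ 3 * t ^ 3 * Real.exp M := by gcongr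
      _ = _ := by ring
  have key2 : ‖sinh ((ω₂ : ℂ) * t)‖ ≤ (Real.exp ω₂ * ω₂ ^ 3 + ω₂) * t := by
    have h := norm_add_le (sinh ((ω₂ : ℂ) * t) - ω₂ * t) (ω₂ * t)
    rw [sub_add_cancel] at h
    have hn : ‖(ω₂ : ℂ) * t‖ = ω₂ * t := by
      rw [norm_mul, norm_ofReal_nonneg h₂.le, norm_ofReal_nonneg ht.le]
    have ht3 : t ^ 3 ≤ t := by nlinarith [mul_pos ht ht]
    have := mul_le_mul_of_nonneg_left ht3 (by positivity : 0 ≤ ω₂ ^ 3 * Real.exp ω₂)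
    have := key h₂
    nlinarith
  have hs₁ := le_sinh_of_nonneg (mul_nonneg h₁.le ht.le)
  have hs₂ := le_sinh_of_nonneg (mul_nonneg h₂.le ht.le)
  have hp₁ : 0 < Real.sinh (ω₁ * t) := (mul_pos h₁ ht).trans_le hs₁
  have hp₂ : 0 < Real.sinh (ω₂ * t) := (mul_pos h₂ ht).trans_le hs₂
  have e : dsKernel ω₁ ω₂ w t = ((sinh (w * t) - w * t) * (ω₁ * ω₂ * t) -
      w * ((sinh (ω₁ * t) - ω₁ * t) * sinh (ω₂ * t) + ω₁ * t * (sinh (ω₂ * t) - ω₂ * t))) /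
      (2 * ω₁ * ω₂ * t ^ 2 * (sinh (ω₁ * t) * sinh (ω₂ * t))) := by
    have n₁ : sinh ((ω₁ : ℂ) * t) ≠ 0 := by rw [sinh_ofReal_mul]; exact_mod_cast hp₁.ne'
    have n₂ : sinh ((ω₂ : ℂ) * t) ≠ 0 := by rw [sinh_ofReal_mul]; exact_mod_cast hp₂.ne'
    have n₃ : (ω₁ : ℂ) ≠ 0 := by exact_mod_cast h₁.ne'
    have n₄ : (ω₂ : ℂ) ≠ 0 := by exact_mod_cast h₂.ne'
    have n₅ : (t : ℂ) ≠ 0 := by exact_mod_cast ht.ne'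
    rw [dsKernel]
    generalize sinh ((ω₁ : ℂ) * t) = s₁ at n₁ ⊢
    generalize sinh ((ω₂ : ℂ) * t) = s₂ at n₂ ⊢
    field_simp
    ring
  have hden : 2 * ω₁ ^ 2 * ω₂ ^ 2 * t ^ 4 ≤
      ‖2 * (ω₁ : ℂ) * ω₂ * t ^ 2 * (sinh (ω₁ * t) * sinh (ω₂ * t))‖ := by
    rw [sinh_ofReal_mul, sinh_ofReal_mul]
    simp only [norm_mul, norm_pow, RCLike.norm_ofNat]
    rw [norm_ofReal_nonneg h₁.le, norm_ofReal_nonneg h₂.le, norm_ofReal_nonneg ht.le,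
      norm_ofReal_nonneg hp₁.le, norm_ofReal_nonneg hp₂.le]
    calc 2 * ω₁ ^ 2 * ω₂ ^ 2 * t ^ 4 = 2 * ω₁ * ω₂ * t ^ 2 * ((ω₁ * t) * (ω₂ * t)) := by ring
      _ ≤ _ := by gcongr
  have hnum : ‖(sinh (w * t) - w * t) * (ω₁ * ω₂ * t) -
      w * ((sinh (ω₁ * t) - ω₁ * t) * sinh (ω₂ * t) + ω₁ * t * (sinh (ω₂ * t) - ω₂ * t))‖
      ≤ A * t ^ 4 := by
    refine (norm_sub_le _ _).trans ?_
    rw [norm_mul, norm_mul w]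
    have i1 : ‖(ω₁ : ℂ) * ω₂ * t‖ = ω₁ * ω₂ * t := by
      rw [norm_mul, norm_mul, norm_ofReal_nonneg h₁.le, norm_ofReal_nonneg h₂.le, norm_ofReal_nonneg ht.le]
    have i2 : ‖(ω₁ : ℂ) * t‖ = ω₁ * t := by
      rw [norm_mul, norm_ofReal_nonneg h₁.le, norm_ofReal_nonneg ht.le]
    have i3 : ‖(sinh ((ω₁ : ℂ) * t) - ω₁ * t) * sinh (ω₂ * t)
        + ω₁ * t * (sinh (ω₂ * t) - ω₂ * t)‖ ≤ (ω₁ ^ 3 * Real.exp ω₁ * t ^ 3) *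
          ((Real.exp ω₂ * ω₂ ^ 3 + ω₂) * t) + ω₁ * t * (ω₂ ^ 3 * Real.exp ω₂ * t ^ 3) := by
      refine (norm_add_le _ _).trans ?_
      rw [norm_mul, norm_mul ((ω₁ : ℂ) * t), i2]
      gcongr
      exacts [key h₁, key h₂]
    rw [i1]
    calc _ ≤ M ^ 3 * Real.exp M * t ^ 3 * (ω₁ * ω₂ * t) + M * ((ω₁ ^ 3 * Real.exp ω₁ * t ^ 3) *
          ((Real.exp ω₂ * ω₂ ^ 3 + ω₂) * t) + ω₁ * t * (ω₂ ^ 3 * Real.exp ω₂ * t ^ 3)) := by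
          gcongr
      _ = A * t ^ 4 := by rw [hA]; ring
  rw [e, norm_div]
  calc _ ≤ A * t ^ 4 / (2 * ω₁ ^ 2 * ω₂ ^ 2 * t ^ 4) := by gcongr
    _ = _ := by field_simp

/-- The sinh quotient decays like e^{-εt}, which is at most 2/(εt)²; the subtracted term is O(1/t)
and gains another 1/t from the outer division. -/
theorem exists_dsKernel_bound_large {ω₁ ω₂ : ℝ} (h₁ : 0 < ω₁) (h₂ : 0 < ω₂) {ε : ℝ} (hε : 0 < ε)
    (M : ℝ) : ∃ K : ℝ, 0 ≤ K ∧ ∀ w : ℂ, |w.re| ≤ ω₁ + ω₂ - ε → ‖w‖ ≤ M → ∀ t : ℝ, 1 ≤ t →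
      ‖dsKernel ω₁ ω₂ w t‖ ≤ K / t ^ 2 := by
  by_cases hM : 0 ≤ M
  swap
  · exact ⟨0, le_rfl, fun w _ hw => absurd ((norm_nonneg w).trans hw) hM⟩
  set c₁ := (1 - Real.exp (-2 * ω₁)) / 2
  set c₂ := (1 - Real.exp (-2 * ω₂)) / 2
  have hc : ∀ {a : ℝ}, 0 < a → 0 < (1 - Real.exp (-2 * a)) / 2 := fun {a} ha => by
    have : Real.exp (-2 * a) < 1 := Real.exp_lt_one_iff.2 (by linarith)
    linarith
  have hc₁ : 0 < c₁ := hc h₁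
  have hc₂ : 0 < c₂ := hc h₂
  refine ⟨1 / (2 * c₁ * c₂) * (2 / ε ^ 2) + M / (2 * ω₁ * ω₂), by positivity,
    fun w hw hwM t ht => ?_⟩
  have ht0 : 0 < t := by linarith
  have hs₁ := sinh_lower h₁ ht
  have hs₂ := sinh_lower h₂ ht
  have hp₁ : 0 < Real.sinh (ω₁ * t) := lt_of_lt_of_le (by positivity) hs₁
  have hp₂ : 0 < Real.sinh (ω₂ * t) := lt_of_lt_of_le (by positivity) hs₂
  have hexp : Real.exp (-(ε * t)) ≤ 2 / ε ^ 2 / t ^ 2 := by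
    rw [Real.exp_neg, div_div, ← inv_div]
    refine inv_anti₀ (by positivity) ?_
    have := Real.quadratic_le_exp_of_nonneg (mul_pos hε ht0).le
    nlinarith [mul_pos hε ht0]
  have f1 : ‖sinh (w * t) / (2 * sinh (ω₁ * t) * sinh (ω₂ * t))‖ ≤
      1 / (2 * c₁ * c₂) * Real.exp (-(ε * t)) := by
    rw [norm_div, sinh_ofReal_mul, sinh_ofReal_mul, norm_mul, norm_mul, RCLike.norm_ofNat,
      norm_ofReal_nonneg hp₁.le, norm_ofReal_nonneg hp₂.le]
    have n1 : ‖sinh (w * t)‖ ≤ Real.exp ((ω₁ + ω₂ - ε) * t) := by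
      refine (norm_sinh_le _).trans (Real.exp_le_exp.2 ?_)
      rw [re_mul_ofReal, abs_mul, abs_of_pos ht0]
      gcongr
    calc _ ≤ Real.exp ((ω₁ + ω₂ - ε) * t) /
          (2 * (c₁ * Real.exp (ω₁ * t)) * (c₂ * Real.exp (ω₂ * t))) := by gcongr
      _ = _ := by
        rw [show (ω₁ + ω₂ - ε) * t = ω₁ * t + ω₂ * t + -(ε * t) by ring, Real.exp_add, Real.exp_add]
        field_simp
  have f2 : ‖w / (2 * ω₁ * ω₂ * t)‖ ≤ M / (2 * ω₁ * ω₂) / t := by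
    rw [norm_div, norm_mul, norm_mul, norm_mul, RCLike.norm_ofNat, norm_ofReal_nonneg h₁.le,
      norm_ofReal_nonneg h₂.le, norm_ofReal_nonneg ht0.le, div_div]
    gcongr
  rw [dsKernel, norm_div, norm_ofReal_nonneg ht0.le]
  have f3 : 1 / (2 * c₁ * c₂) * Real.exp (-(ε * t)) / t ≤
      1 / (2 * c₁ * c₂) * (2 / ε ^ 2 / t ^ 2) := by
    refine (div_le_self (by positivity) ht).trans ?_
    gcongr
  calc _ ≤ (1 / (2 * c₁ * c₂) * Real.exp (-(ε * t)) + M / (2 * ω₁ * ω₂) / t) / t := by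
        gcongr
        exact (norm_sub_le _ _).trans (add_le_add f1 f2)
    _ = 1 / (2 * c₁ * c₂) * Real.exp (-(ε * t)) / t + M / (2 * ω₁ * ω₂) / t ^ 2 := by
        field_simp
    _ ≤ 1 / (2 * c₁ * c₂) * (2 / ε ^ 2 / t ^ 2) + M / (2 * ω₁ * ω₂) / t ^ 2 := by gcongr
    _ = _ := by ring

theorem exists_dsKernel_bound {ω₁ ω₂ : ℝ} (h₁ : 0 < ω₁) (h₂ : 0 < ω₂) {ε : ℝ} (hε : 0 < ε)
    (M : ℝ) : ∃ K : ℝ, 0 ≤ K ∧ ∀ w : ℂ, |w.re| ≤ ω₁ + ω₂ - ε → ‖w‖ ≤ M → ∀ t : ℝ, 0 < t →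
      ‖dsKernel ω₁ ω₂ w t‖ ≤ K * (1 + t ^ 2)⁻¹ := by
  obtain ⟨K₁, hK₁, H₁⟩ := exists_dsKernel_bound_small h₁ h₂ M
  obtain ⟨K₂, hK₂, H₂⟩ := exists_dsKernel_bound_large h₁ h₂ hε M
  refine ⟨2 * K₁ + 2 * K₂, by positivity, fun w hw hwM t ht => ?_⟩
  rw [← div_eq_mul_inv, le_div_iff₀ (by positivity)]
  rcases le_total t 1 with h | h
  · have := H₁ w hwM t ht h
    have h2 : t ^ 2 ≤ 1 := by nlinarith
    nlinarith [norm_nonneg (dsKernel ω₁ ω₂ w t)]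
  · have := H₂ w hw hwM t h
    rw [le_div_iff₀ (by positivity)] at this
    have h2 : 1 ≤ t ^ 2 := by nlinarith
    nlinarith [norm_nonneg (dsKernel ω₁ ω₂ w t)]

theorem continuousOn_dsKernel {ω₁ ω₂ : ℝ} (h₁ : 0 < ω₁) (h₂ : 0 < ω₂) (w : ℂ) :
    ContinuousOn (dsKernel ω₁ ω₂ w) (Ioi 0) := by
  have hne : ∀ {a : ℝ}, 0 < a → ∀ t ∈ Ioi (0 : ℝ), sinh ((a : ℂ) * t) ≠ 0 := fun {a} ha t ht => by
    rw [sinh_ofReal_mul]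
    exact_mod_cast (Real.sinh_pos_iff.2 (mul_pos ha ht)).ne'
  have n₃ : (ω₁ : ℂ) ≠ 0 := by exact_mod_cast h₁.ne'
  have n₄ : (ω₂ : ℂ) ≠ 0 := by exact_mod_cast h₂.ne'
  have n₅ : ∀ t ∈ Ioi (0 : ℝ), (t : ℂ) ≠ 0 := fun t ht => by exact_mod_cast (ne_of_gt ht)
  unfold dsKernel
  refine ContinuousOn.div (ContinuousOn.sub (ContinuousOn.div ?_ ?_ ?_)
    (ContinuousOn.div ?_ ?_ ?_)) ?_ n₅
  · fun_prop
  · fun_prop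
  · exact fun t ht => mul_ne_zero (mul_ne_zero two_ne_zero (hne h₁ t ht)) (hne h₂ t ht)
  · fun_prop
  · fun_prop
  · exact fun t ht => mul_ne_zero (mul_ne_zero (mul_ne_zero two_ne_zero n₃) n₄) (n₅ t ht)
  · fun_prop

theorem aestronglyMeasurable_dsKernel {ω₁ ω₂ : ℝ} (h₁ : 0 < ω₁) (h₂ : 0 < ω₂) (w : ℂ) :
    AEStronglyMeasurable (dsKernel ω₁ ω₂ w) (volume.restrict (Ioi 0)) :=
  (continuousOn_dsKernel h₁ h₂ w).aestronglyMeasurable measurableSet_Ioi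

theorem integrable_inv_one_add_sq_Ioi (K : ℝ) :
    Integrable (fun t : ℝ => K * (1 + t ^ 2)⁻¹) (volume.restrict (Ioi 0)) :=
  (integrable_inv_one_add_sq.const_mul K).restrict

theorem integrableOn_dsKernel {ω₁ ω₂ : ℝ} (h₁ : 0 < ω₁) (h₂ : 0 < ω₂) {w : ℂ}
    (hw : |w.re| < ω₁ + ω₂) : IntegrableOn (dsKernel ω₁ ω₂ w) (Ioi 0) := by
  obtain ⟨K, -, H⟩ := exists_dsKernel_bound h₁ h₂ (sub_pos.2 hw) ‖w‖
  refine (integrable_inv_one_add_sq_Ioi K).mono' (aestronglyMeasurable_dsKernel h₁ h₂ w) ?_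
  filter_upwards [ae_restrict_mem measurableSet_Ioi] with t ht
  exact H w (by linarith) le_rfl t ht

/-- Differentiation under the integral sign for a family of holomorphic functions that is
dominated locally. -/
theorem hasDerivAt_integral_of_dominated_holomorphic {X : Type*} [MeasurableSpace X]
    {μ : Measure X} {F F' : ℂ → X → ℂ} {z₀ : ℂ} {r : ℝ} (hr : 0 < r) {bound : X → ℝ}
    (hb : Integrable bound μ) (hF : ∀ z ∈ Metric.ball z₀ r, AEStronglyMeasurable (F z) μ)
    (hF' : AEStronglyMeasurable (F' z₀) μ)
    (hd : ∀ᵐ t ∂μ, ∀ z ∈ Metric.ball z₀ r, HasDerivAt (F · t) (F' z t) z)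
    (hle : ∀ᵐ t ∂μ, ∀ z ∈ Metric.ball z₀ r, ‖F z t‖ ≤ bound t) :
    Integrable (F' z₀) μ ∧ HasDerivAt (fun z => ∫ t, F z t ∂μ) (∫ t, F' z₀ t ∂μ) z₀ := by
  refine hasDerivAt_integral_of_dominated_loc_of_deriv_le (bound := fun t => bound t / (r / 3))
    (Metric.ball_mem_nhds z₀ (by positivity : 0 < r / 3)) ?_ ?_ hF' ?_ (hb.div_const _) ?_
  · filter_upwards [Metric.ball_mem_nhds z₀ hr] with z hz using hF z hz
  · refine hb.mono' (hF z₀ (Metric.mem_ball_self hr)) ?_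
    filter_upwards [hle] with t ht using ht z₀ (Metric.mem_ball_self hr)
  -- Cauchy's estimate on a disc of radius r/3: for z within r/3 of z₀ this disc stays inside the
  -- ball where the family is dominated.
  · filter_upwards [hd, hle] with t h1 h2 z hz
    have hsub : Metric.closedBall z (r / 3) ⊆ Metric.ball z₀ r := by
      intro y hy
      rw [Metric.mem_closedBall] at hy
      rw [Metric.mem_ball] at hz ⊢
      linarith [dist_triangle y z z₀]
    rw [← (h1 z (hsub (Metric.mem_closedBall_self (by positivity)))).deriv]
    refine norm_deriv_le_of_forall_mem_sphere_norm_le (by positivity) ?_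
      fun y hy => h2 y (hsub (Metric.sphere_subset_closedBall hy))
    refine DifferentiableOn.diffContOnCl_ball (U := Metric.ball z₀ r) ?_ hsub
    exact fun y hy => (h1 y hy).differentiableAt.differentiableWithinAt
  · filter_upwards [hd] with t h1 z hz
    exact h1 z (Metric.ball_subset_ball (by linarith) hz)

theorem hasDerivAt_dsKernel (ω₁ ω₂ : ℝ) (w : ℂ) (t : ℝ) :
    HasDerivAt (fun w => dsKernel ω₁ ω₂ w t)
      ((cosh (w * t) * t / (2 * sinh (ω₁ * t) * sinh (ω₂ * t)) - 1 / (2 * ω₁ * ω₂ * t)) / t) w := by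
  unfold dsKernel
  have h1 : HasDerivAt (fun w : ℂ => w * (t : ℂ)) t w := by
    simpa using (hasDerivAt_id w).mul_const (t : ℂ)
  exact (((h1.csinh).div_const _).sub ((hasDerivAt_id w).div_const _)).div_const _

/-! ### The double sine integral and its shift equation -/

/-- The integrand of `-log (2 sin (π x))` on `0 < Re x < 1`. -/
noncomputable def sineKernel (x : ℂ) (t : ℝ) : ℂ :=
  (cosh ((2 * x - 1) * t) / sinh t - 1 / t) / t

/-- By sinh(u + v) - sinh(u - v) = 2 cosh u sinh v the factor sinh(ω₁t) of the denominator cancels,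
so only the other period ω₂ survives, as a scaling. -/
theorem dsKernel_add_sub {ω₁ ω₂ : ℝ} (h₁ : 0 < ω₁) (h₂ : 0 < ω₂) (x : ℂ) {t : ℝ} (ht : 0 < t) :
    dsKernel ω₁ ω₂ (2 * (x + ω₁) - ω₁ - ω₂) t - dsKernel ω₁ ω₂ (2 * x - ω₁ - ω₂) t =
      ω₂ * sineKernel (x / ω₂) (ω₂ * t) := by
  have n₁ : sinh ((ω₁ : ℂ) * t) ≠ 0 := by
    rw [sinh_ofReal_mul]; exact_mod_cast (Real.sinh_pos_iff.2 (mul_pos h₁ ht)).ne'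
  have n₂ : sinh ((ω₂ : ℂ) * t) ≠ 0 := by
    rw [sinh_ofReal_mul]; exact_mod_cast (Real.sinh_pos_iff.2 (mul_pos h₂ ht)).ne'
  have n₃ : (ω₁ : ℂ) ≠ 0 := by exact_mod_cast h₁.ne'
  have n₄ : (ω₂ : ℂ) ≠ 0 := by exact_mod_cast h₂.ne'
  have n₅ : (t : ℂ) ≠ 0 := by exact_mod_cast ht.ne'
  have e1 : sinh ((2 * (x + ω₁) - ω₁ - ω₂) * t) - sinh ((2 * x - ω₁ - ω₂) * t) =
      2 * cosh ((2 * x - ω₂) * t) * sinh (ω₁ * t) := by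
    rw [show (2 * (x + ω₁) - ω₁ - ω₂) * t = (2 * x - ω₂) * t + ω₁ * t by ring,
      show (2 * x - ω₁ - ω₂) * t = (2 * x - ω₂) * t - ω₁ * t by ring, sinh_add, sinh_sub]
    ring
  have e2 : (2 * (x / ω₂) - 1) * ((ω₂ * t : ℝ) : ℂ) = (2 * x - ω₂) * t := by
    push_cast
    field_simp
  rw [dsKernel, dsKernel, sineKernel, e2, ofReal_mul, ← sub_div, sub_sub_sub_comm, ← sub_div, e1,
    ← sub_div]
  generalize sinh ((ω₁ : ℂ) * t) = s₁ at n₁ ⊢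
  generalize sinh ((ω₂ : ℂ) * t) = s₂ at n₂ ⊢
  generalize cosh ((2 * x - ω₂) * t) = c
  field_simp
  ring

/-- The special case ω₁ = ω₂ = 1, through which `sineKernel` inherits its bounds from `dsKernel`:
for 0 < Re x < 1 both 2x and 2x - 2 have real part of modulus below 2. -/
theorem sineKernel_eq {t : ℝ} (ht : 0 < t) (x : ℂ) :
    sineKernel x t = dsKernel 1 1 (2 * x) t - dsKernel 1 1 (2 * x - 2) t := by
  have := dsKernel_add_sub one_pos one_pos x ht
  simp only [ofReal_one, div_one, one_mul] at this
  rw [← this]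
  congr 2 <;> ring

theorem exists_sineKernel_bound {x₀ : ℂ} (h0 : 0 < x₀.re) (h1 : x₀.re < 1) :
    ∃ r K : ℝ, 0 < r ∧ (∀ z ∈ Metric.ball x₀ r, 0 < z.re ∧ z.re < 1) ∧
      ∀ z ∈ Metric.ball x₀ r, ∀ t : ℝ, 0 < t → ‖sineKernel z t‖ ≤ K * (1 + t ^ 2)⁻¹ := by
  set r := min x₀.re (1 - x₀.re) / 2 with hr
  have hr0 : 0 < r := by
    have : 0 < min x₀.re (1 - x₀.re) := lt_min h0 (by linarith)
    positivity
  have hr1 : 2 * r ≤ x₀.re := by rw [hr]; linarith [min_le_left x₀.re (1 - x₀.re)]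
  have hr2 : 2 * r ≤ 1 - x₀.re := by rw [hr]; linarith [min_le_right x₀.re (1 - x₀.re)]
  obtain ⟨K, -, H⟩ := exists_dsKernel_bound one_pos one_pos (by positivity : 0 < 2 * r)
    (2 * (‖x₀‖ + r) + 2)
  have hre : ∀ z ∈ Metric.ball x₀ r, |z.re - x₀.re| < r ∧ ‖z‖ ≤ ‖x₀‖ + r := by
    intro z hz
    rw [mem_ball_iff_norm] at hz
    refine ⟨lt_of_le_of_lt (by simpa using abs_re_le_norm (z - x₀)) hz, ?_⟩
    have := norm_add_le (z - x₀) x₀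
    rw [sub_add_cancel] at this
    linarith
  refine ⟨r, K + K, hr0, fun z hz => ?_, fun z hz t ht => ?_⟩
  · have := abs_lt.1 (hre z hz).1
    constructor <;> linarith
  · obtain ⟨ha, hb⟩ := hre z hz
    rw [abs_lt] at ha
    rw [sineKernel_eq ht, add_mul]
    refine (norm_sub_le _ _).trans (add_le_add (H _ ?_ ?_ t ht) (H _ ?_ ?_ t ht))
    · simp only [mul_re, re_ofNat, im_ofNat, zero_mul, sub_zero, abs_le]
      constructor <;> linarith
    · rw [norm_mul, RCLike.norm_ofNat]; linarith
    · simp only [sub_re, mul_re, re_ofNat, im_ofNat, zero_mul, sub_zero, abs_le]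
      constructor <;> linarith
    · refine (norm_sub_le _ _).trans ?_
      rw [norm_mul, RCLike.norm_ofNat]; linarith

theorem continuousOn_sineKernel (x : ℂ) : ContinuousOn (sineKernel x) (Ioi 0) := by
  refine ((continuousOn_dsKernel one_pos one_pos (2 * x)).sub
    (continuousOn_dsKernel one_pos one_pos (2 * x - 2))).congr fun t ht => ?_
  rw [sineKernel_eq ht]
  rfl

theorem aestronglyMeasurable_sineKernel (x : ℂ) :
    AEStronglyMeasurable (sineKernel x) (volume.restrict (Ioi 0)) :=
  (continuousOn_sineKernel x).aestronglyMeasurable measurableSet_Ioi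

theorem integrableOn_sineKernel {x : ℂ} (h0 : 0 < x.re) (h1 : x.re < 1) :
    IntegrableOn (sineKernel x) (Ioi 0) := by
  obtain ⟨r, K, hr, -, H⟩ := exists_sineKernel_bound h0 h1
  refine (integrable_inv_one_add_sq_Ioi K).mono' (aestronglyMeasurable_sineKernel x) ?_
  filter_upwards [ae_restrict_mem measurableSet_Ioi] with t ht
  exact H x (Metric.mem_ball_self hr) t ht

/-- `∫₀^∞ (cosh ((2x - 1) t) / sinh t - 1 / t) dt / t`, which is `-log (2 sin (π x))`. -/
noncomputable def sineIntegral (x : ℂ) : ℂ := ∫ t in Ioi (0 : ℝ), sineKernel x t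

theorem ofReal_sinh_ne_zero {t : ℝ} (ht : 0 < t) : sinh (t : ℂ) ≠ 0 := by
  rw [← ofReal_sinh]; exact_mod_cast (Real.sinh_pos_iff.2 ht).ne'

theorem hasDerivAt_sineIntegral_aux {x : ℂ} (h0 : 0 < x.re) (h1 : x.re < 1) :
    IntegrableOn (fun t : ℝ => 2 * sinh ((2 * x - 1) * t) / sinh t) (Ioi 0) ∧
    HasDerivAt sineIntegral (∫ t in Ioi (0 : ℝ), 2 * sinh ((2 * x - 1) * t) / sinh t) x := by
  obtain ⟨r, K, hr, -, H⟩ := exists_sineKernel_bound h0 h1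
  refine hasDerivAt_integral_of_dominated_holomorphic (F := sineKernel)
    (F' := fun x (t : ℝ) => 2 * sinh ((2 * x - 1) * t) / sinh t) hr
    (integrable_inv_one_add_sq_Ioi K) (fun z _ => aestronglyMeasurable_sineKernel z) ?_ ?_ ?_
  · refine ContinuousOn.aestronglyMeasurable ?_ measurableSet_Ioi
    exact ContinuousOn.div (by fun_prop) (by fun_prop) fun t ht => ofReal_sinh_ne_zero ht
  · filter_upwards [ae_restrict_mem measurableSet_Ioi] with t ht z _
    have hl : HasDerivAt (fun z : ℂ => (2 * z - 1) * (t : ℂ)) (2 * t) z := by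
      simpa using (((hasDerivAt_id z).const_mul 2).sub_const 1).mul_const (t : ℂ)
    have := (((hl.ccosh).div_const (sinh t)).sub_const (1 / (t : ℂ))).div_const (t : ℂ)
    refine this.congr_deriv ?_
    have n₅ : (t : ℂ) ≠ 0 := by exact_mod_cast (ne_of_gt ht)
    field_simp
  · filter_upwards [ae_restrict_mem measurableSet_Ioi] with t ht z hz
    exact H z hz t ht

/-- The geometric series of 1/sinh t in powers of e^{-2t}, with exact remainder, so that term by
term integration needs only dominated convergence for the remainder. -/
theorem sinh_div_sinh_eq_sum (w : ℂ) {t : ℝ} (ht : 0 < t) (N : ℕ) :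
    2 * sinh (w * t) / sinh t =
      (∑ n ∈ Finset.range N, (2 * exp ((w - (2 * n + 1)) * t) - 2 * exp (-(w + (2 * n + 1)) * t)))
        + 2 * sinh (w * t) / sinh t * Real.exp (-(2 * N * t)) := by
  have hs := ofReal_sinh_ne_zero ht
  induction N with
  | zero => simp
  | succ N ih =>
    have key : 2 * sinh (w * t) / sinh t * Real.exp (-(2 * N * t)) =
        2 * exp ((w - (2 * N + 1)) * t) - 2 * exp (-(w + (2 * N + 1)) * t) +
          2 * sinh (w * t) / sinh t * Real.exp (-(2 * (N + 1 : ℕ) * t)) := by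
      rw [← mul_right_inj' hs, mul_add]
      have e1 : ∀ y : ℂ, sinh t * (2 * sinh (w * t) / sinh t * y) = 2 * sinh (w * t) * y := by
        intro y; field_simp
      rw [e1, e1, sinh, sinh]
      push_cast
      have a1 : exp ((w - (2 * N + 1)) * t) = exp (w * t) * exp (-(2 * N * t)) * exp (-t) := by
        rw [← exp_add, ← exp_add]; ring_nf
      have a2 : exp (-(w + (2 * N + 1)) * t) = exp (-(w * t)) * exp (-(2 * N * t)) * exp (-t) := by
        rw [← exp_add, ← exp_add]; ring_nf
      have a3 : exp (-(2 * ((N : ℂ) + 1) * t)) = exp (-(2 * N * t)) * exp (-t) * exp (-t) := by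
        rw [← exp_add, ← exp_add]; ring_nf
      have a4 : exp (t : ℂ) * exp (-t) = 1 := by rw [← exp_add]; simp
      rw [a1, a2, a3]
      linear_combination (-(exp (w * t) - exp (-(w * t))) * exp (-(2 * N * t))) * a4
    refine ih.trans ?_
    rw [Finset.sum_range_succ]
    linear_combination key

theorem mem_integerComplement_of_re {x : ℂ} (h0 : 0 < x.re) (h1 : x.re < 1) :
    x ∈ integerComplement := by
  rintro ⟨n, rfl⟩
  simp only [intCast_re] at h0 h1
  have a : (0 : ℤ) < n := by exact_mod_cast h0
  have b : n < (1 : ℤ) := by exact_mod_cast h1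
  omega

theorem tendsto_inv_add_natCast (x : ℂ) :
    Tendsto (fun N : ℕ => 1 / (x + N)) atTop (𝓝 0) := by
  simp_rw [one_div]
  refine tendsto_inv₀_cobounded.comp ?_
  have : Tendsto (fun N : ℕ => ‖x + N‖) atTop atTop := by
    refine tendsto_atTop_mono (fun N => ?_) (tendsto_atTop_add_const_right _ (-‖x‖)
      (tendsto_natCast_atTop_atTop (R := ℝ)))
    have := norm_sub_le (x + N) x
    rw [add_sub_cancel_left, norm_natCast] at this
    linarith
  exact tendsto_norm_atTop_iff_cobounded.1 this

/-- Integrating the geometric expansion produces the partial fractions of the cotangent; the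
remainder is dominated by the integrand itself. -/
theorem integral_sinh_div_sinh {x : ℂ} (h0 : 0 < x.re) (h1 : x.re < 1) :
    ∫ t in Ioi (0 : ℝ), 2 * sinh ((2 * x - 1) * t) / sinh t = -(Real.pi * cot (Real.pi * x)) := by
  have hx := mem_integerComplement_of_re h0 h1
  set G : ℝ → ℂ := fun t => 2 * sinh ((2 * x - 1) * t) / sinh t with hG
  have hint : IntegrableOn G (Ioi 0) := (hasDerivAt_sineIntegral_aux h0 h1).1
  have hR : Tendsto (fun N : ℕ => ∫ t in Ioi (0 : ℝ), G t * Real.exp (-(2 * N * t))) atTop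
      (𝓝 (∫ t in Ioi (0 : ℝ), (0 : ℂ))) := by
    refine tendsto_integral_of_dominated_convergence (fun t => ‖G t‖) (fun N => ?_) hint.norm
      (fun N => ?_) ?_
    · exact hint.aestronglyMeasurable.mul (Continuous.aestronglyMeasurable (by fun_prop))
    · filter_upwards [ae_restrict_mem measurableSet_Ioi] with t ht
      rw [norm_mul, norm_ofReal_nonneg (Real.exp_pos _).le]
      refine mul_le_of_le_one_right (norm_nonneg _) (Real.exp_le_one_iff.2 ?_)
      have : 0 ≤ (2 * N : ℝ) * t := mul_nonneg (by positivity) (le_of_lt ht)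
      linarith
    · filter_upwards [ae_restrict_mem measurableSet_Ioi] with t ht
      have : Tendsto (fun N : ℕ => Real.exp (-(2 * N * t))) atTop (𝓝 0) := by
        refine Real.tendsto_exp_neg_atTop_nhds_zero.comp ?_
        exact (tendsto_natCast_atTop_atTop.const_mul_atTop two_pos).atTop_mul_const ht
      have := ((continuous_ofReal.tendsto 0).comp this).const_mul (G t)
      simpa using this
  rw [integral_zero] at hR
  have hterm : ∀ n : ℕ, IntegrableOn (fun t : ℝ => 2 * exp ((2 * x - 1 - (2 * n + 1)) * t)
      - 2 * exp (-(2 * x - 1 + (2 * n + 1)) * t)) (Ioi 0) ∧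
      ∫ t in Ioi (0 : ℝ), (2 * exp ((2 * x - 1 - (2 * n + 1)) * t)
      - 2 * exp (-(2 * x - 1 + (2 * n + 1)) * t)) = -(1 / (x - (n + 1))) - 1 / (x + n) := by
    intro n
    have r1 : (2 * x - 1 - (2 * n + 1)).re < 0 := by
      simp
      have : (0 : ℝ) ≤ n := n.cast_nonneg
      linarith
    have r2 : (-(2 * x - 1 + (2 * n + 1))).re < 0 := by
      simp
      have : (0 : ℝ) ≤ n := n.cast_nonneg
      linarith
    have i1 := (integrableOn_exp_mul_complex_Ioi r1 0).const_mul 2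
    have i2 := (integrableOn_exp_mul_complex_Ioi r2 0).const_mul 2
    refine ⟨i1.sub i2, ?_⟩
    rw [integral_sub i1 i2, integral_const_mul, integral_const_mul,
      integral_exp_mul_complex_Ioi r1, integral_exp_mul_complex_Ioi r2]
    have d1 : x - (n + 1) ≠ 0 := by
      intro h
      rw [show 2 * x - 1 - (2 * (n : ℂ) + 1) = 2 * (x - (n + 1)) by ring, h] at r1
      simp at r1
    have d2 : x + n ≠ 0 := by
      intro h
      rw [show -(2 * x - 1 + (2 * (n : ℂ) + 1)) = -2 * (x + n) by ring, h] at r2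
      simp at r2
    rw [show 2 * x - 1 - (2 * (n : ℂ) + 1) = 2 * (x - (n + 1)) by ring,
      show -(2 * x - 1 + (2 * (n : ℂ) + 1)) = -2 * (x + n) by ring]
    simp only [ofReal_zero, mul_zero, exp_zero]
    field_simp
  have hsum : ∀ N : ℕ, ∫ t in Ioi (0 : ℝ), G t =
      (∑ n ∈ Finset.range N, (-(1 / (x - (n + 1))) - 1 / (x + n))) +
        ∫ t in Ioi (0 : ℝ), G t * Real.exp (-(2 * N * t)) := by
    intro N
    have i2 : IntegrableOn (fun t : ℝ => G t * Real.exp (-(2 * N * t))) (Ioi 0) := by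
      refine Integrable.mono' hint.norm
        (hint.aestronglyMeasurable.mul (Continuous.aestronglyMeasurable (by fun_prop))) ?_
      filter_upwards [ae_restrict_mem measurableSet_Ioi] with t ht
      rw [norm_mul, norm_ofReal_nonneg (Real.exp_pos _).le]
      refine mul_le_of_le_one_right (norm_nonneg _) (Real.exp_le_one_iff.2 ?_)
      have : 0 ≤ (2 * N : ℝ) * t := mul_nonneg (by positivity) (le_of_lt ht)
      linarith
    rw [setIntegral_congr_fun measurableSet_Ioi
      (fun t ht => sinh_div_sinh_eq_sum (2 * x - 1) ht N), integral_add _ i2,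
      integral_finsetSum _ fun n _ => (hterm n).1]
    · congr 1
      exact Finset.sum_congr rfl fun n _ => (hterm n).2
    · exact integrable_finsetSum _ fun n _ => (hterm n).1
  have hcot : Tendsto (fun N : ℕ => ∑ n ∈ Finset.range N, (-(1 / (x - (n + 1))) - 1 / (x + n)))
      atTop (𝓝 (-(Real.pi * cot (Real.pi * x)))) := by
    have h := (summable_cotTerm hx).hasSum.tendsto_sum_nat
    have e : (∑' n, cotTerm x n) = Real.pi * cot (Real.pi * x) - 1 / x := by
      rw [cot_series_rep' hx]
    rw [e] at h
    -- `cotTerm` pairs 1/(x - (n+1)) with 1/(x + (n+1)), whereas the integrals pair it with 1/(x +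
    -- n). The partial sums differ by 1/x - 1/(x + N).
    have := ((h.add (tendsto_const_nhds (x := 1 / x))).sub (tendsto_inv_add_natCast x)).neg
    simp only [sub_add_cancel, sub_zero] at this
    refine this.congr fun N => ?_
    induction N with
    | zero => simp
    | succ N ih =>
      rw [Finset.sum_range_succ, Finset.sum_range_succ, ← ih, cotTerm]
      push_cast
      ring
  have hlim := hcot.add hR
  rw [add_zero] at hlim
  exact tendsto_nhds_unique (tendsto_const_nhds.congr hsum) hlim

theorem sin_pi_mul_ne_zero_of_re {x : ℂ} (h0 : 0 < x.re) (h1 : x.re < 1) :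
    sin (Real.pi * x) ≠ 0 :=
  sin_pi_mul_ne_zero (mem_integerComplement_of_re h0 h1)

/-- The logarithmic form of 2 sin(πx) · 2 sin(π(x + 1/2)) = 2 sin(2πx). The sum of the two kernels
is the kernel of 2x at t/2, by the addition formula for cosh and sinh t = 2 sinh(t/2) cosh(t/2). It
serves to fix a constant of integration. -/
theorem sineIntegral_add_half {x : ℂ} (h0 : 0 < x.re) (h1 : x.re < 1 / 2) :
    sineIntegral x + sineIntegral (x + 1 / 2) = sineIntegral (2 * x) := by
  have r1 : 0 < (x + 1 / 2).re := by simp; linarith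
  have r2 : (x + 1 / 2).re < 1 := by
    have : (x + 1 / 2).re = x.re + 1 / 2 := by simp
    linarith
  rw [sineIntegral, sineIntegral, sineIntegral,
    ← integral_add (integrableOn_sineKernel h0 (by linarith)) (integrableOn_sineKernel r1 r2)]
  have h := integral_comp_mul_left_Ioi (sineKernel (2 * x)) 0 (show (0 : ℝ) < 1 / 2 by norm_num)
  rw [mul_zero] at h
  have h' : ∫ t in Ioi (0 : ℝ), sineKernel (2 * x) t =
      ∫ t in Ioi (0 : ℝ), (1 / 2 : ℂ) * sineKernel (2 * x) (1 / 2 * t) := by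
    rw [integral_const_mul, h, real_smul]
    push_cast
    ring
  rw [h']
  refine setIntegral_congr_fun measurableSet_Ioi fun t ht => ?_
  have n₅ : (t : ℂ) ≠ 0 := by exact_mod_cast (ne_of_gt ht)
  have hs := ofReal_sinh_ne_zero (show (0 : ℝ) < 1 / 2 * t from mul_pos (by norm_num) ht)
  have hc : cosh ((1 / 2 * t : ℝ) : ℂ) ≠ 0 := by
    rw [← ofReal_cosh]; exact_mod_cast (Real.cosh_pos _).ne'
  have hd : sinh (t : ℂ) = 2 * sinh ((1 / 2 * t : ℝ) : ℂ) * cosh ((1 / 2 * t : ℝ) : ℂ) := by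
    rw [← sinh_two_mul]; push_cast; ring_nf
  have hsum : cosh ((2 * x - 1) * t) + cosh ((2 * (x + 1 / 2) - 1) * t) =
      2 * cosh ((2 * (2 * x) - 1) * (1 / 2 * t : ℝ)) * cosh ((1 / 2 * t : ℝ) : ℂ) := by
    rw [show (2 * x - 1) * t = (2 * (2 * x) - 1) * (1 / 2 * t : ℝ) - ((1 / 2 * t : ℝ) : ℂ) by
        push_cast; ring,
      show (2 * (x + 1 / 2) - 1) * t = (2 * (2 * x) - 1) * (1 / 2 * t : ℝ) + ((1 / 2 * t : ℝ) : ℂ) by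
        push_cast; ring, cosh_add, cosh_sub]
    ring
  have e : sineKernel x t + sineKernel (x + 1 / 2) t =
      ((cosh ((2 * x - 1) * t) + cosh ((2 * (x + 1 / 2) - 1) * t)) / sinh t - 2 / t) / t := by
    rw [sineKernel, sineKernel]; ring
  change sineKernel x t + sineKernel (x + 1 / 2) t = _
  rw [e, hsum, hd, sineKernel]
  generalize cosh ((2 * (2 * x) - 1) * (1 / 2 * t : ℝ)) = C
  generalize cosh ((1 / 2 * t : ℝ) : ℂ) = c at hc ⊢
  generalize sinh ((1 / 2 * t : ℝ) : ℂ) = s at hs ⊢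
  push_cast
  field_simp

theorem isOpen_reStrip (a b : ℝ) : IsOpen {x : ℂ | a < x.re ∧ x.re < b} :=
  (isOpen_lt continuous_const continuous_re).inter (isOpen_lt continuous_re continuous_const)

theorem convex_reStrip (a b : ℝ) : Convex ℝ {x : ℂ | a < x.re ∧ x.re < b} :=
  (convex_halfSpace_re_gt a).inter (convex_halfSpace_re_lt b)

/-- The logarithmic derivatives -π cot(πz) and π cot(πz) cancel, and the strip is connected. -/
theorem exp_sineIntegral_mul_const {x y : ℂ} (h0 : 0 < x.re) (h1 : x.re < 1) (h2 : 0 < y.re)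
    (h3 : y.re < 1) : exp (sineIntegral x) * (2 * sin (Real.pi * x)) =
      exp (sineIntegral y) * (2 * sin (Real.pi * y)) := by
  have hd : ∀ z : ℂ, 0 < z.re ∧ z.re < 1 →
      HasDerivAt (fun z => exp (sineIntegral z) * (2 * sin (Real.pi * z))) 0 z := by
    rintro z ⟨hz0, hz1⟩
    have a := (hasDerivAt_sineIntegral_aux hz0 hz1).2
    rw [integral_sinh_div_sinh hz0 hz1] at a
    have hl : HasDerivAt (fun z : ℂ => Real.pi * z) Real.pi z := by
      simpa using (hasDerivAt_id z).const_mul (Real.pi : ℂ)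
    refine (a.cexp.mul (hl.csin.const_mul 2)).congr_deriv ?_
    have := sin_pi_mul_ne_zero_of_re hz0 hz1
    rw [cot]
    field_simp
    ring
  exact (isOpen_reStrip 0 1).is_const_of_deriv_eq_zero (convex_reStrip 0 1).isPreconnected
    (f := fun z => exp (sineIntegral z) * (2 * sin (Real.pi * z)))
    (fun z hz => (hd z hz).differentiableAt.differentiableWithinAt) (fun z hz => (hd z hz).deriv)
    ⟨h0, h1⟩ ⟨h2, h3⟩

/-- The constant K left by the previous lemma satisfies K² = K, by the duplication formula at x =
1/4 with the points 1/4, 3/4 and 1/2. As K ≠ 0, it is 1. -/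
theorem exp_sineIntegral {x : ℂ} (h0 : 0 < x.re) (h1 : x.re < 1) :
    exp (sineIntegral x) = 1 / (2 * sin (Real.pi * x)) := by
  rw [eq_div_iff (mul_ne_zero two_ne_zero (sin_pi_mul_ne_zero_of_re h0 h1))]
  set a : ℂ := 1 / 4 with ha
  have ar : a.re = 1 / 4 := by rw [ha]; norm_num
  have br : (a + 1 / 2).re = 3 / 4 := by rw [ha]; norm_num
  have cr : (2 * a).re = 1 / 2 := by rw [ha]; norm_num
  have e1 := exp_sineIntegral_mul_const (x := a) (y := x) (by rw [ar]; norm_num)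
    (by rw [ar]; norm_num) h0 h1
  have e2 := exp_sineIntegral_mul_const (x := a + 1 / 2) (y := x) (by rw [br]; norm_num)
    (by rw [br]; norm_num) h0 h1
  have e3 := exp_sineIntegral_mul_const (x := 2 * a) (y := x) (by rw [cr]; norm_num)
    (by rw [cr]; norm_num) h0 h1
  have hdup := sineIntegral_add_half (x := a) (by rw [ar]; norm_num) (by rw [ar]; norm_num)
  have hne : exp (sineIntegral x) * (2 * sin (Real.pi * x)) ≠ 0 :=
    mul_ne_zero (exp_ne_zero _) (mul_ne_zero two_ne_zero (sin_pi_mul_ne_zero_of_re h0 h1))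
  have hs : 2 * sin (Real.pi * a) * (2 * sin (Real.pi * (a + 1 / 2))) =
      2 * sin (Real.pi * (2 * a)) := by
    rw [show (Real.pi : ℂ) * (a + 1 / 2) = Real.pi * a + Real.pi / 2 by ring, sin_add_pi_div_two,
      show (Real.pi : ℂ) * (2 * a) = 2 * (Real.pi * a) by ring, sin_two_mul]
    ring
  set K := exp (sineIntegral x) * (2 * sin (Real.pi * x))
  have : K * K = K := by
    calc K * K = exp (sineIntegral a) * (2 * sin (Real.pi * a)) *
          (exp (sineIntegral (a + 1 / 2)) * (2 * sin (Real.pi * (a + 1 / 2)))) := by rw [e1, e2]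
      _ = exp (sineIntegral (2 * a)) * (2 * sin (Real.pi * (2 * a))) := by
        rw [← hdup, ← hs, exp_add]; ring
      _ = K := e3
  exact mul_left_cancel₀ hne (by rw [this, mul_one])

theorem doubleSineStrip_add {ω₁ ω₂ : ℝ} (h₁ : 0 < ω₁) (h₂ : 0 < ω₂) {x : ℂ} (h0 : 0 < x.re)
    (h1 : x.re < ω₂) : doubleSineStrip ω₁ ω₂ (x + ω₁) =
      doubleSineStrip ω₁ ω₂ x / (2 * sin (Real.pi * x / ω₂)) := by
  have n₄ : (ω₂ : ℂ) ≠ 0 := by exact_mod_cast h₂.ne'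
  have i1 : IntegrableOn (dsKernel ω₁ ω₂ (2 * (x + ω₁) - ω₁ - ω₂)) (Ioi 0) := by
    refine integrableOn_dsKernel h₁ h₂ ?_
    simp only [sub_re, mul_re, add_re, re_ofNat, im_ofNat, zero_mul, sub_zero, ofReal_re, abs_lt]
    constructor <;> linarith
  have i2 : IntegrableOn (dsKernel ω₁ ω₂ (2 * x - ω₁ - ω₂)) (Ioi 0) := by
    refine integrableOn_dsKernel h₁ h₂ ?_
    simp only [sub_re, mul_re, re_ofNat, im_ofNat, zero_mul, sub_zero, ofReal_re, abs_lt]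
    constructor <;> linarith
  have hr : (x / ω₂).re = x.re / ω₂ := div_ofReal_re x ω₂
  have key : (∫ t in Ioi (0 : ℝ), dsKernel ω₁ ω₂ (2 * (x + ω₁) - ω₁ - ω₂) t) =
      (∫ t in Ioi (0 : ℝ), dsKernel ω₁ ω₂ (2 * x - ω₁ - ω₂) t) + sineIntegral (x / ω₂) := by
    rw [← sub_eq_iff_eq_add', ← integral_sub i1 i2,
      setIntegral_congr_fun measurableSet_Ioi (fun t ht => dsKernel_add_sub h₁ h₂ x ht),
      integral_const_mul, integral_comp_mul_left_Ioi (sineKernel (x / ω₂)) 0 h₂, mul_zero,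
      real_smul, ← mul_assoc, ofReal_inv, mul_inv_cancel₀ n₄, one_mul, sineIntegral]
  rw [doubleSineStrip_eq, key, exp_add, exp_sineIntegral, doubleSineStrip_eq, ← mul_div_assoc,
    mul_one, ← mul_div_assoc]
  · rw [hr]; positivity
  · rwa [hr, div_lt_one h₂]

theorem doubleSineStrip_comm (ω₁ ω₂ : ℝ) (x : ℂ) :
    doubleSineStrip ω₁ ω₂ x = doubleSineStrip ω₂ ω₁ x := by
  rw [doubleSineStrip_eq, doubleSineStrip_eq]
  congr 2
  funext t
  rw [dsKernel, dsKernel]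
  ring_nf

theorem doubleSineStrip_add' {ω₁ ω₂ : ℝ} (h₁ : 0 < ω₁) (h₂ : 0 < ω₂) {x : ℂ} (h0 : 0 < x.re)
    (h1 : x.re < ω₁) : doubleSineStrip ω₁ ω₂ (x + ω₂) =
      doubleSineStrip ω₁ ω₂ x / (2 * sin (Real.pi * x / ω₁)) := by
  rw [doubleSineStrip_comm, doubleSineStrip_comm ω₁, doubleSineStrip_add h₂ h₁ h0 h1]

theorem differentiableAt_doubleSineStrip {ω₁ ω₂ : ℝ} (h₁ : 0 < ω₁) (h₂ : 0 < ω₂) {x : ℂ}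
    (h0 : 0 < x.re) (h1 : x.re < ω₁ + ω₂) : DifferentiableAt ℂ (doubleSineStrip ω₁ ω₂) x := by
  have hw : ∀ w : ℂ, |w.re| < ω₁ + ω₂ → DifferentiableAt ℂ
      (fun w => ∫ t in Ioi (0 : ℝ), dsKernel ω₁ ω₂ w t) w := by
    intro w hw
    set r := (ω₁ + ω₂ - |w.re|) / 2 with hr
    have hr0 : 0 < r := by rw [hr]; linarith
    obtain ⟨K, -, H⟩ := exists_dsKernel_bound h₁ h₂ hr0 (‖w‖ + r)
    refine (hasDerivAt_integral_of_dominated_holomorphic (F := dsKernel ω₁ ω₂) (F' := fun w (t : ℝ) =>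
      (cosh (w * t) * t / (2 * sinh (ω₁ * t) * sinh (ω₂ * t)) - 1 / (2 * ω₁ * ω₂ * t)) / t) hr0
      (integrable_inv_one_add_sq_Ioi K) (fun z _ => aestronglyMeasurable_dsKernel h₁ h₂ z)
      ?_ ?_ ?_).2.differentiableAt
    · exact Measurable.aestronglyMeasurable (by fun_prop)
    · exact Eventually.of_forall fun t z _ => hasDerivAt_dsKernel ω₁ ω₂ z t
    · filter_upwards [ae_restrict_mem measurableSet_Ioi] with t ht z hz
      rw [mem_ball_iff_norm] at hz
      refine H z ?_ ?_ t ht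
      · have a := abs_re_le_norm (z - w)
        have b := abs_sub_abs_le_abs_sub z.re w.re
        rw [sub_re] at a
        linarith
      · have := norm_add_le (z - w) w
        rw [sub_add_cancel] at this
        linarith
  have : DifferentiableAt ℂ (fun x : ℂ => ∫ t in Ioi (0 : ℝ), dsKernel ω₁ ω₂ (2 * x - ω₁ - ω₂) t) x := by
    refine (hw (2 * x - ω₁ - ω₂) ?_).comp x (f := fun x : ℂ => 2 * x - ω₁ - ω₂) (by fun_prop)
    simp only [sub_re, mul_re, re_ofNat, im_ofNat, zero_mul, sub_zero, ofReal_re, abs_lt]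
    constructor <;> linarith
  exact this.cexp

/-! ### Growth of the double sine function -/

/-- Separates the dependence on Im w. The first summand is bounded by the kernel at the real point
Re w, uniformly in Im w; the second one integrates exactly to a multiple of |Im w|. -/
theorem re_dsKernel (ω₁ ω₂ : ℝ) (w : ℂ) {t : ℝ} (ht : 0 < t) :
    (dsKernel ω₁ ω₂ w t).re = (dsKernel ω₁ ω₂ w.re t).re * Real.cos (w.im * t) +
      w.re / (2 * ω₁ * ω₂) * ((Real.cos (w.im * t) - 1) / t ^ 2) := by
  have e1 : (sinh (w * t)).re = Real.sinh (w.re * t) * Real.cos (w.im * t) := by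
    have h1 : w * t = ((w.re * t : ℝ) : ℂ) + ((w.im * t : ℝ) : ℂ) * I := by
      apply Complex.ext <;> simp
    rw [h1, sinh_add, sinh_mul_I, cosh_mul_I, ← ofReal_sinh, ← ofReal_cos, ← ofReal_cosh,
      ← ofReal_sin, add_re, ← ofReal_mul, ofReal_re, ← mul_assoc, ← ofReal_mul, re_ofReal_mul, I_re,
      mul_zero, add_zero]
  have e2 : ∀ w : ℂ, (dsKernel ω₁ ω₂ w t).re =
      ((sinh (w * t)).re / (2 * Real.sinh (ω₁ * t) * Real.sinh (ω₂ * t))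
        - w.re / (2 * ω₁ * ω₂ * t)) / t := by
    intro w
    rw [dsKernel, sinh_ofReal_mul, sinh_ofReal_mul, div_ofReal_re, sub_re]
    congr 2
    · rw [show (2 : ℂ) * (Real.sinh (ω₁ * t)) * (Real.sinh (ω₂ * t)) =
        ((2 * Real.sinh (ω₁ * t) * Real.sinh (ω₂ * t) : ℝ) : ℂ) by push_cast; rfl, div_ofReal_re]
    · rw [show (2 : ℂ) * ω₁ * ω₂ * t = ((2 * ω₁ * ω₂ * t : ℝ) : ℂ) by push_cast; rfl,
        div_ofReal_re]
  rw [e2, e2, e1, sinh_ofReal_mul, ofReal_re, ofReal_re]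
  field_simp
  ring

/-- `∫₀^∞ (1 - cos t) / t² dt`, which is `π / 2`. -/
noncomputable def cosIntegral : ℝ := ∫ t in Ioi (0 : ℝ), (1 - Real.cos t) / t ^ 2

theorem integral_cos_sub_one (v : ℝ) :
    ∫ t in Ioi (0 : ℝ), (Real.cos (v * t) - 1) / t ^ 2 = -(|v| * cosIntegral) := by
  have h0 : ∀ v : ℝ, 0 < v →
      ∫ t in Ioi (0 : ℝ), (Real.cos (v * t) - 1) / t ^ 2 = -(v * cosIntegral) := by
    intro v hv
    have h := integral_comp_mul_left_Ioi (fun t : ℝ => (1 - Real.cos t) / t ^ 2) 0 hv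
    rw [mul_zero, smul_eq_mul] at h
    rw [cosIntegral, ← mul_inv_cancel_left₀ hv.ne' (∫ t in Ioi (0 : ℝ), (1 - Real.cos t) / t ^ 2),
      ← h, ← mul_assoc, ← integral_const_mul, ← integral_neg]
    refine setIntegral_congr_fun measurableSet_Ioi fun t ht => ?_
    have : t ≠ 0 := ne_of_gt ht
    field_simp
    ring
  rcases lt_trichotomy v 0 with h | rfl | h
  · rw [abs_of_neg h, ← h0 (-v) (neg_pos.2 h)]
    simp_rw [neg_mul, Real.cos_neg]
  · simp
  · rw [abs_of_pos h, h0 v h]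

theorem exists_log_norm_doubleSineStrip_aux {ω₁ ω₂ : ℝ} (h₁ : 0 < ω₁) (h₂ : 0 < ω₂) {ε : ℝ}
    (hε : 0 < ε) : ∃ K : ℝ, ∀ z : ℂ, |2 * z.re - ω₁ - ω₂| ≤ ω₁ + ω₂ - ε →
      |Real.log ‖doubleSineStrip ω₁ ω₂ z‖ +
        (2 * z.re - ω₁ - ω₂) * |2 * z.im| * cosIntegral / (2 * ω₁ * ω₂)| ≤ K := by
  -- The bound is applied only at the real point Re w, so a bound ω₁ + ω₂ on the norm is enough and
  -- `K` does not depend on Im z.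
  obtain ⟨K, hK, H⟩ := exists_dsKernel_bound h₁ h₂ hε (ω₁ + ω₂)
  refine ⟨∫ t in Ioi (0 : ℝ), K * (1 + t ^ 2)⁻¹, fun z hz => ?_⟩
  set w := 2 * z - ω₁ - ω₂ with hw
  have wre : w.re = 2 * z.re - ω₁ - ω₂ := by simp [hw]
  have wim : w.im = 2 * z.im := by simp [hw]
  rw [← wre] at hz
  rw [← wre, ← wim, doubleSineStrip_eq, ← hw, norm_exp, Real.log_exp]
  have iw : IntegrableOn (dsKernel ω₁ ω₂ w) (Ioi 0) := integrableOn_dsKernel h₁ h₂ (by linarith)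
  have iu : IntegrableOn (dsKernel ω₁ ω₂ w.re) (Ioi 0) :=
    integrableOn_dsKernel h₁ h₂ (by rw [ofReal_re]; linarith)
  have i2 : IntegrableOn (fun t : ℝ => (dsKernel ω₁ ω₂ w.re t).re * Real.cos (w.im * t))
      (Ioi 0) := by
    refine Integrable.mono' iu.norm (iu.re.aestronglyMeasurable.mul
      (Continuous.aestronglyMeasurable (by fun_prop))) (Eventually.of_forall fun t => ?_)
    rw [norm_mul, Real.norm_eq_abs, Real.norm_eq_abs]
    exact (mul_le_of_le_one_right (abs_nonneg _) (Real.abs_cos_le_one _)).trans (abs_re_le_norm _)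
  have key : (∫ t in Ioi (0 : ℝ), dsKernel ω₁ ω₂ w t).re +
      w.re * |w.im| * cosIntegral / (2 * ω₁ * ω₂) =
      ∫ t in Ioi (0 : ℝ), (dsKernel ω₁ ω₂ w.re t).re * Real.cos (w.im * t) := by
    have a1 : (∫ t in Ioi (0 : ℝ), dsKernel ω₁ ω₂ w t).re =
        ∫ t in Ioi (0 : ℝ), (dsKernel ω₁ ω₂ w t).re := (integral_re iw).symm
    have a2 := integral_sub iw.re i2
    have a3 : ∫ t in Ioi (0 : ℝ), (RCLike.re (dsKernel ω₁ ω₂ w t) -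
        (dsKernel ω₁ ω₂ w.re t).re * Real.cos (w.im * t)) =
        ∫ t in Ioi (0 : ℝ), w.re / (2 * ω₁ * ω₂) * ((Real.cos (w.im * t) - 1) / t ^ 2) := by
      refine setIntegral_congr_fun measurableSet_Ioi fun t ht => ?_
      change (dsKernel ω₁ ω₂ w t).re - _ = _
      rw [re_dsKernel ω₁ ω₂ w ht]
      ring
    rw [a3, integral_const_mul, integral_cos_sub_one] at a2
    change _ = (∫ t in Ioi (0 : ℝ), (dsKernel ω₁ ω₂ w t).re) - _ at a2
    rw [a1]
    linear_combination -a2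
  rw [key, ← Real.norm_eq_abs]
  refine norm_integral_le_of_norm_le (integrable_inv_one_add_sq_Ioi K) ?_
  filter_upwards [ae_restrict_mem measurableSet_Ioi] with t ht
  rw [norm_mul, Real.norm_eq_abs, Real.norm_eq_abs]
  refine (mul_le_of_le_one_right (abs_nonneg _) (Real.abs_cos_le_one _)).trans
    ((abs_re_le_norm _).trans (H _ ?_ ?_ t ht))
  · rwa [ofReal_re]
  · rw [norm_real, Real.norm_eq_abs]; linarith

/-- Evaluated through the shift equation instead of directly. For ω₁ = ω₂ = 1, compare the growth at
z = 1/2 + iy and at z + 1: their quotient is 1/(2 cosh πy), whose logarithm is -πy up to a bounded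
error, while the growth estimates give -2y · `cosIntegral`. So y (2 `cosIntegral` - π) is bounded
for all y > 0. -/
theorem cosIntegral_eq : cosIntegral = Real.pi / 2 := by
  obtain ⟨K, H⟩ := exists_log_norm_doubleSineStrip_aux one_pos one_pos one_pos
  have key : ∀ y : ℝ, 0 < y → |y * (2 * cosIntegral - Real.pi)| ≤ 2 * K + Real.log 2 := by
    intro y hy
    set z : ℂ := ⟨1 / 2, y⟩ with hz
    have e := doubleSineStrip_add one_pos one_pos (x := z) (by norm_num [hz]) (by norm_num [hz])
    have hs : ‖2 * sin (Real.pi * z / (1 : ℝ))‖ = 2 * Real.cosh (Real.pi * y) := by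
      have : (Real.pi : ℂ) * z / (1 : ℝ) = Real.pi / 2 + ((Real.pi * y : ℝ) : ℂ) * I := by
        have hz' : z = 1 / 2 + y * I := by apply Complex.ext <;> simp [hz]
        rw [hz']
        push_cast
        ring
      rw [this, add_comm, sin_add_pi_div_two, cos_mul_I, ← ofReal_cosh, norm_mul, RCLike.norm_ofNat,
        norm_ofReal_nonneg (Real.cosh_pos _).le]
    have hne : ‖doubleSineStrip 1 1 z‖ ≠ 0 := norm_ne_zero_iff.2 (exp_ne_zero _)
    have e' : Real.log ‖doubleSineStrip 1 1 (z + (1 : ℝ))‖ =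
        Real.log ‖doubleSineStrip 1 1 z‖ - Real.log (2 * Real.cosh (Real.pi * y)) := by
      rw [e, norm_div, hs, Real.log_div hne (by have := Real.cosh_pos (Real.pi * y); positivity)]
    have a1 := H z (by norm_num [hz])
    have a2 := H (z + (1 : ℝ)) (by norm_num [hz])
    rw [e'] at a2
    have hre : (z + (1 : ℝ)).re = 3 / 2 := by norm_num [hz]
    have him : (z + (1 : ℝ)).im = y := by simp [hz]
    rw [hre, him] at a2
    have hre' : z.re = 1 / 2 := rfl
    have him' : z.im = y := rfl
    rw [hre', him'] at a1
    rw [abs_of_pos (by linarith : 0 < 2 * y)] at a1 a2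
    have c1 : Real.pi * y ≤ Real.log (2 * Real.cosh (Real.pi * y)) := by
      rw [Real.le_log_iff_exp_le (by have := Real.cosh_pos (Real.pi * y); positivity), Real.cosh_eq]
      have := Real.exp_pos (-(Real.pi * y))
      linarith
    have c2 : Real.log (2 * Real.cosh (Real.pi * y)) ≤ Real.pi * y + Real.log 2 := by
      rw [Real.log_le_iff_le_exp (by have := Real.cosh_pos (Real.pi * y); positivity), Real.exp_add,
        Real.exp_log two_pos, Real.cosh_eq]
      have : Real.exp (-(Real.pi * y)) ≤ Real.exp (Real.pi * y) :=
        Real.exp_le_exp.2 (by have := mul_pos Real.pi_pos hy; linarith)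
      linarith
    have c3 : 0 ≤ Real.log 2 := Real.log_nonneg (by norm_num)
    rw [abs_le] at a1 a2 ⊢
    constructor <;> nlinarith [a1.1, a1.2, a2.1, a2.2]
  by_contra hne
  have hd : 0 < |2 * cosIntegral - Real.pi| := abs_pos.2 fun h => hne (by linarith)
  have := key ((|2 * K + Real.log 2| + 1) / |2 * cosIntegral - Real.pi|) (by positivity)
  rw [abs_mul, abs_of_pos (by positivity : 0 < (|2 * K + Real.log 2| + 1) /
    |2 * cosIntegral - Real.pi|), div_mul_cancel₀ _ hd.ne'] at this
  linarith [le_abs_self (2 * K + Real.log 2)]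

/-- The growth of the double sine function on vertical lines inside the strip. -/
theorem exists_log_norm_doubleSineStrip {ω₁ ω₂ : ℝ} (h₁ : 0 < ω₁) (h₂ : 0 < ω₂) {ε : ℝ}
    (hε : 0 < ε) : ∃ K : ℝ, ∀ z : ℂ, |2 * z.re - ω₁ - ω₂| ≤ ω₁ + ω₂ - ε →
      |Real.log ‖doubleSineStrip ω₁ ω₂ z‖ +
        (Real.pi / (2 * ω₁ * ω₂) * (2 * z.re - ω₁ - ω₂) * |z.im|)| ≤ K := by
  obtain ⟨K, H⟩ := exists_log_norm_doubleSineStrip_aux h₁ h₂ hε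
  refine ⟨K, fun z hz => ?_⟩
  have := H z hz
  rw [cosIntegral_eq, abs_mul 2, abs_two] at this
  rw [show Real.pi / (2 * ω₁ * ω₂) * (2 * z.re - ω₁ - ω₂) * |z.im| =
    (2 * z.re - ω₁ - ω₂) * (2 * |z.im|) * (Real.pi / 2) / (2 * ω₁ * ω₂) by ring]
  exact this

/-! ### The double sine function as a meromorphic function -/

/-- The formula for the double sine function on `n ω₁ < Re x ≤ (n + 1) ω₁`, as a function on `ℂ`. -/
noncomputable def doubleSineAt (ω₁ ω₂ : ℝ) (n : ℤ) (x : ℂ) : ℂ :=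
  doubleSineStrip ω₁ ω₂ (x - n * ω₁)
    * (∏ j ∈ Finset.range (-n).toNat, 2 * sin (Real.pi * (x - n * ω₁ - (j + 1) * ω₁) / ω₂))
    / (∏ j ∈ Finset.range n.toNat, 2 * sin (Real.pi * (x - n * ω₁ + j * ω₁) / ω₂))

/-- The index of the vertical strip that contains `x`. -/
noncomputable def stripIndex (ω₁ : ℝ) (x : ℂ) : ℤ := ⌈x.re / ω₁⌉ - 1

theorem doubleSine_eq (ω₁ ω₂ : ℝ) (x : ℂ) :
    doubleSine ω₁ ω₂ x = doubleSineAt ω₁ ω₂ (stripIndex ω₁ x) x := rfl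

theorem stripIndex_eq_iff {ω₁ : ℝ} (h₁ : 0 < ω₁) {x : ℂ} {n : ℤ} :
    stripIndex ω₁ x = n ↔ n * ω₁ < x.re ∧ x.re ≤ (n + 1) * ω₁ := by
  rw [stripIndex, sub_eq_iff_eq_add, Int.ceil_eq_iff, lt_div_iff₀ h₁, div_le_iff₀ h₁]
  push_cast
  rw [add_sub_cancel_right]

theorem sin_pi_mul_div_ne_zero {ω₂ : ℝ} (h₂ : 0 < ω₂) {y : ℂ} (h0 : 0 < y.re) (h1 : y.re < ω₂) :
    sin (Real.pi * y / ω₂) ≠ 0 := by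
  rw [mul_div_assoc]
  have hr : (y / ω₂).re = y.re / ω₂ := div_ofReal_re y ω₂
  refine sin_pi_mul_ne_zero_of_re ?_ ?_
  · rw [hr]; positivity
  · rwa [hr, div_lt_one h₂]

/-- Neighbouring formulas agree on an overlap to the right of the line Re x = (n+1)ω₁ where they
meet. One use of the shift equation accounts for the single factor by which the products differ: for
n ≥ 0 the denominator gains it, for n < 0 the numerator loses it. -/
theorem doubleSineAt_succ {ω₁ ω₂ : ℝ} (h₁ : 0 < ω₁) (h₂ : 0 < ω₂) {x : ℂ} {n : ℤ}
    (h0 : (n + 1) * ω₁ < x.re) (h1 : x.re < (n + 1) * ω₁ + ω₂) :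
    doubleSineAt ω₁ ω₂ (n + 1) x = doubleSineAt ω₁ ω₂ n x := by
  set y : ℂ := x - (n + 1 : ℤ) * ω₁ with hy
  have hre : y.re = x.re - (n + 1) * ω₁ := by simp [hy]
  have hy0 : 0 < y.re := by rw [hre]; linarith
  have hy1 : y.re < ω₂ := by rw [hre]; linarith
  have hs := sin_pi_mul_div_ne_zero h₂ hy0 hy1
  have e := doubleSineStrip_add h₁ h₂ hy0 hy1
  have hyn : x - (n : ℂ) * ω₁ = y + ω₁ := by rw [hy]; push_cast; ring
  rw [doubleSineAt, doubleSineAt, hyn, ← hy, e]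
  obtain ⟨k, rfl | rfl⟩ : ∃ k : ℕ, n = k ∨ n = -(k + 1 : ℕ) := by
    rcases lt_or_ge n 0 with h | h
    · exact ⟨(-n - 1).toNat, Or.inr (by omega)⟩
    · exact ⟨n.toNat, Or.inl (by omega)⟩
  · have a1 : (-((k : ℤ) + 1)).toNat = 0 := by omega
    have a2 : (-(k : ℤ)).toNat = 0 := by omega
    have a3 : ((k : ℤ) + 1).toNat = k + 1 := by omega
    rw [a1, a2, a3, Int.toNat_natCast, Finset.prod_range_zero, Finset.prod_range_succ']
    simp only [Nat.cast_zero, zero_mul, add_zero, mul_one, Finset.prod_range_zero]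
    rw [div_div, mul_comm (2 * sin _)]
    congr 2
    refine Finset.prod_congr rfl fun j _ => ?_
    push_cast
    ring_nf
  · have a1 : (-(-((k + 1 : ℕ) : ℤ) + 1)).toNat = k := by omega
    have a2 : (-(-((k + 1 : ℕ) : ℤ))).toNat = k + 1 := by omega
    have a3 : (-((k + 1 : ℕ) : ℤ)).toNat = 0 := by omega
    have a4 : (-((k + 1 : ℕ) : ℤ) + 1).toNat = 0 := by omega
    rw [a1, a2, a3, a4, Finset.prod_range_zero, Finset.prod_range_succ']
    simp only [Nat.cast_zero, zero_add, one_mul, add_sub_cancel_right, div_one,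
      Finset.prod_range_zero]
    rw [div_mul_eq_mul_div, eq_div_iff (mul_ne_zero two_ne_zero hs), mul_assoc]
    congr 2
    refine Finset.prod_congr rfl fun j _ => ?_
    push_cast
    ring_nf

/-- The strips are closed on the right, so a neighbourhood of x₀ meets at most its own strip and the
next one, where the formula of x₀ is still valid for a distance below min(ω₁, ω₂). -/
theorem doubleSine_eventuallyEq {ω₁ ω₂ : ℝ} (h₁ : 0 < ω₁) (h₂ : 0 < ω₂) (x₀ : ℂ) :
    doubleSine ω₁ ω₂ =ᶠ[𝓝 x₀] doubleSineAt ω₁ ω₂ (stripIndex ω₁ x₀) := by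
  set n := stripIndex ω₁ x₀ with hn
  obtain ⟨ha, hb⟩ := (stripIndex_eq_iff h₁).1 hn.symm
  have hm : 0 < min ω₁ ω₂ := lt_min h₁ h₂
  filter_upwards [(isOpen_reStrip (n * ω₁) ((n + 1) * ω₁ + min ω₁ ω₂)).mem_nhds
    (⟨ha, by linarith⟩ : x₀ ∈ {x : ℂ | _ ∧ _})] with x hx
  have m1 := min_le_left ω₁ ω₂
  have m2 := min_le_right ω₁ ω₂
  rw [doubleSine_eq]
  rcases le_or_gt x.re ((n + 1) * ω₁) with h | h
  · rw [(stripIndex_eq_iff h₁).2 ⟨hx.1, h⟩]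
  · rw [(stripIndex_eq_iff h₁ (n := n + 1)).2 ⟨by push_cast; exact h, by push_cast; linarith [hx.2]⟩]
    exact doubleSineAt_succ h₁ h₂ h (by linarith [hx.2])

theorem doubleSine_eq_strip {ω₁ ω₂ : ℝ} (h₁ : 0 < ω₁) (h₂ : 0 < ω₂) {x : ℂ} (h0 : 0 < x.re)
    (h1 : x.re < ω₁ + ω₂) : doubleSine ω₁ ω₂ x = doubleSineStrip ω₁ ω₂ x := by
  have key : ∀ k : ℕ, k * ω₁ < x.re → doubleSineAt ω₁ ω₂ k x = doubleSineAt ω₁ ω₂ 0 x := by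
    intro k
    induction k with
    | zero => simp
    | succ k ih =>
      intro hk
      push_cast at hk ⊢
      rw [← ih (by linarith)]
      have : (0 : ℝ) ≤ k * ω₁ := by positivity
      exact doubleSineAt_succ h₁ h₂ (by push_cast; linarith) (by push_cast; linarith)
  have h2 : 0 ≤ stripIndex ω₁ x := by
    have : 0 < ⌈x.re / ω₁⌉ := Int.ceil_pos.2 (by positivity)
    rw [stripIndex]; omega
  obtain ⟨k, hk⟩ := Int.eq_ofNat_of_zero_le h2
  rw [doubleSine_eq, hk, key k, doubleSineAt]
  · simp
  · exact_mod_cast ((stripIndex_eq_iff h₁).1 hk).1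

theorem stripIndex_add {ω₁ : ℝ} (h₁ : 0 < ω₁) (x : ℂ) :
    stripIndex ω₁ (x + ω₁) = stripIndex ω₁ x + 1 := by
  obtain ⟨ha, hb⟩ := (stripIndex_eq_iff h₁).1 (rfl : stripIndex ω₁ x = _)
  refine (stripIndex_eq_iff h₁).2 ?_
  rw [add_re, ofReal_re]
  push_cast
  constructor <;> linarith

/-- On this side the definition divides by sines, so the equation holds literally, also where a sine
vanishes and both sides are 0 by division by zero. -/
theorem doubleSine_add_of_pos {ω₁ : ℝ} (ω₂ : ℝ) (h₁ : 0 < ω₁) {x : ℂ} (h0 : 0 < x.re) :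
    doubleSine ω₁ ω₂ (x + ω₁) = doubleSine ω₁ ω₂ x / (2 * sin (Real.pi * x / ω₂)) := by
  have h2 : 0 ≤ stripIndex ω₁ x := by
    have : 0 < ⌈x.re / ω₁⌉ := Int.ceil_pos.2 (by positivity)
    rw [stripIndex]; omega
  obtain ⟨k, hk⟩ := Int.eq_ofNat_of_zero_le h2
  rw [doubleSine_eq, doubleSine_eq, stripIndex_add h₁, hk, doubleSineAt, doubleSineAt]
  have a1 : (-((k : ℤ) + 1)).toNat = 0 := by omega
  have a2 : (-(k : ℤ)).toNat = 0 := by omega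
  have a3 : ((k : ℤ) + 1).toNat = k + 1 := by omega
  have a4 : x + ω₁ - ((k + 1 : ℤ) : ℂ) * ω₁ = x - (k : ℤ) * ω₁ := by push_cast; ring
  rw [a1, a2, a3, a4, Int.toNat_natCast, Finset.prod_range_succ, div_div]
  congr 6
  push_cast
  ring

/-- On this side the definition multiplies by sines, so the product form holds also at the zeros of
the sine, where the quotient form is meaningless. -/
theorem doubleSine_add_of_nonpos {ω₁ : ℝ} (ω₂ : ℝ) (h₁ : 0 < ω₁) {x : ℂ} (h0 : x.re ≤ 0) :
    doubleSine ω₁ ω₂ x = doubleSine ω₁ ω₂ (x + ω₁) * (2 * sin (Real.pi * x / ω₂)) := by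
  have h2 : stripIndex ω₁ x < 0 := by
    have : ⌈x.re / ω₁⌉ ≤ 0 := by
      rw [Int.ceil_le]
      push_cast
      exact div_nonpos_of_nonpos_of_nonneg h0 h₁.le
    rw [stripIndex]; omega
  obtain ⟨k, hk⟩ : ∃ k : ℕ, stripIndex ω₁ x = -(k + 1 : ℕ) :=
    ⟨(-stripIndex ω₁ x - 1).toNat, by omega⟩
  rw [doubleSine_eq, doubleSine_eq, stripIndex_add h₁, hk, doubleSineAt, doubleSineAt]
  have a1 : (-(-((k + 1 : ℕ) : ℤ) + 1)).toNat = k := by omega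
  have a2 : (-(-((k + 1 : ℕ) : ℤ))).toNat = k + 1 := by omega
  have a3 : (-((k + 1 : ℕ) : ℤ)).toNat = 0 := by omega
  have a5 : (-((k + 1 : ℕ) : ℤ) + 1).toNat = 0 := by omega
  have a4 : x + ω₁ - ((-((k + 1 : ℕ) : ℤ) + 1 : ℤ) : ℂ) * ω₁ =
    x - (-((k + 1 : ℕ) : ℤ) : ℤ) * ω₁ := by push_cast; ring
  rw [a1, a2, a3, a4, a5, Finset.prod_range_succ, Finset.prod_range_zero, div_one, div_one,
    ← mul_assoc]
  congr 5
  push_cast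
  ring

theorem analyticAt_doubleSineStrip {ω₁ ω₂ : ℝ} (h₁ : 0 < ω₁) (h₂ : 0 < ω₂) {x : ℂ}
    (h0 : 0 < x.re) (h1 : x.re < ω₁ + ω₂) : AnalyticAt ℂ (doubleSineStrip ω₁ ω₂) x := by
  refine DifferentiableOn.analyticAt (s := {x : ℂ | 0 < x.re ∧ x.re < ω₁ + ω₂}) ?_
    ((isOpen_reStrip _ _).mem_nhds ⟨h0, h1⟩)
  exact fun z hz => (differentiableAt_doubleSineStrip h₁ h₂ hz.1 hz.2).differentiableWithinAt

theorem analyticAt_sinProd (ω₁ ω₂ : ℝ) (n : ℤ) (k : ℕ) (c : ℕ → ℂ) (x : ℂ) :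
    AnalyticAt ℂ (fun x : ℂ => ∏ j ∈ Finset.range k,
      2 * sin (Real.pi * (x - n * ω₁ + c j) / ω₂)) x := by
  refine DifferentiableOn.analyticAt (s := univ) ?_ univ_mem
  exact Differentiable.differentiableOn (by fun_prop)

theorem analyticAt_doubleSineAt_parts {ω₁ ω₂ : ℝ} (h₁ : 0 < ω₁) (h₂ : 0 < ω₂) (x : ℂ) :
    AnalyticAt ℂ (fun z => doubleSineStrip ω₁ ω₂ (z - stripIndex ω₁ x * ω₁)) x := by
  obtain ⟨ha, hb⟩ := (stripIndex_eq_iff h₁).1 (rfl : stripIndex ω₁ x = _)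
  have hre : (x - stripIndex ω₁ x * ω₁).re = x.re - stripIndex ω₁ x * ω₁ := by simp
  refine AnalyticAt.fun_comp (g := doubleSineStrip ω₁ ω₂) (f := fun z => z - stripIndex ω₁ x * ω₁)
    (analyticAt_doubleSineStrip h₁ h₂ ?_ ?_) (by fun_prop)
  · rw [hre]; linarith
  · rw [hre]; linarith

theorem meromorphicAt_doubleSine {ω₁ ω₂ : ℝ} (h₁ : 0 < ω₁) (h₂ : 0 < ω₂) (x : ℂ) :
    MeromorphicAt (doubleSine ω₁ ω₂) x := by
  have h := doubleSine_eventuallyEq h₁ h₂ x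
  refine MeromorphicAt.congr ?_ (h.filter_mono nhdsWithin_le_nhds).symm
  have a := analyticAt_sinProd ω₁ ω₂ (stripIndex ω₁ x) (-stripIndex ω₁ x).toNat
    (fun j => -((j + 1) * ω₁)) x
  simp only [← sub_eq_add_neg] at a
  exact ((analyticAt_doubleSineAt_parts h₁ h₂ x).mul a).meromorphicAt.div
    (analyticAt_sinProd ω₁ ω₂ _ _ (fun j => j * ω₁) x).meromorphicAt

theorem sin_pi_mul_div_eq_zero_iff {ω₂ : ℝ} (h₂ : 0 < ω₂) {y : ℂ} :
    sin (Real.pi * y / ω₂) = 0 ↔ ∃ k : ℤ, y = k * ω₂ := by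
  have n₄ : (ω₂ : ℂ) ≠ 0 := by exact_mod_cast h₂.ne'
  rw [Complex.sin_eq_zero_iff]
  refine exists_congr fun k => ?_
  rw [div_eq_iff n₄]
  have : (Real.pi : ℂ) ≠ 0 := by exact_mod_cast Real.pi_ne_zero
  constructor
  · intro h
    exact mul_left_cancel₀ this (by rw [h]; ring)
  · rintro rfl; ring

/-- The double sine function is holomorphic outside its poles. -/
theorem differentiableAt_doubleSine {ω₁ ω₂ : ℝ} (h₁ : 0 < ω₁) (h₂ : 0 < ω₂) {x : ℂ}
    (hx : ∀ m n : ℕ, x ≠ (m + 1) * ω₁ + (n + 1) * ω₂) :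
    DifferentiableAt ℂ (doubleSine ω₁ ω₂) x := by
  rw [(doubleSine_eventuallyEq h₁ h₂ x).differentiableAt_iff]
  have a := analyticAt_sinProd ω₁ ω₂ (stripIndex ω₁ x) (-stripIndex ω₁ x).toNat
    (fun j => -((j + 1) * ω₁)) x
  simp only [← sub_eq_add_neg] at a
  refine (((analyticAt_doubleSineAt_parts h₁ h₂ x).mul a).div
    (analyticAt_sinProd ω₁ ω₂ _ _ (fun j => j * ω₁) x) ?_).differentiableAt
  rw [Finset.prod_ne_zero_iff]
  intro j hj h0
  obtain ⟨ha, hb⟩ := (stripIndex_eq_iff h₁).1 (rfl : stripIndex ω₁ x = _)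
  set n := stripIndex ω₁ x
  obtain ⟨k, hk⟩ := (sin_pi_mul_div_eq_zero_iff h₂).1
    ((mul_eq_zero.1 h0).resolve_left two_ne_zero)
  have hre := congrArg re hk
  simp at hre
  have hj' : (j : ℤ) < n := by have := Finset.mem_range.1 hj; omega
  have hj0 : (0 : ℝ) ≤ j * ω₁ := by positivity
  have hk0 : 0 < k := by
    by_contra hneg
    have : (k : ℝ) * ω₂ ≤ 0 :=
      mul_nonpos_of_nonpos_of_nonneg (by exact_mod_cast not_lt.1 hneg) h₂.le
    linarith
  -- A vanishing sine means x = (n - j)ω₁ + kω₂ with n - j ≥ 1, and k ≥ 1 because x lies strictly to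
  -- the right of the line Re = nω₁. Poles are indexed from 0, hence the two -1.
  refine hx (n - j - 1).toNat (k - 1).toNat ?_
  have e1 : (((n - j - 1).toNat : ℕ) : ℂ) = n - j - 1 := by
    have : (((n - j - 1).toNat : ℕ) : ℤ) = n - j - 1 := by omega
    exact_mod_cast congrArg (Int.cast : ℤ → ℂ) this
  have e2 : (((k - 1).toNat : ℕ) : ℂ) = k - 1 := by
    have : (((k - 1).toNat : ℕ) : ℤ) = k - 1 := by omega
    exact_mod_cast congrArg (Int.cast : ℤ → ℂ) this
  rw [e1, e2]
  linear_combination hk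

/-- The reciprocal of the double sine function is holomorphic outside the zeros. -/
theorem differentiableAt_inv_doubleSine {ω₁ ω₂ : ℝ} (h₁ : 0 < ω₁) (h₂ : 0 < ω₂) {x : ℂ}
    (hx : ∀ m n : ℕ, x ≠ -(m * ω₁) - n * ω₂) :
    DifferentiableAt ℂ (fun z => (doubleSine ω₁ ω₂ z)⁻¹) x := by
  have h := doubleSine_eventuallyEq h₁ h₂ x
  have h' : (fun z => (doubleSine ω₁ ω₂ z)⁻¹) =ᶠ[𝓝 x]
      fun z => (doubleSineAt ω₁ ω₂ (stripIndex ω₁ x) z)⁻¹ := h.inv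
  rw [h'.differentiableAt_iff]
  have a := analyticAt_sinProd ω₁ ω₂ (stripIndex ω₁ x) (-stripIndex ω₁ x).toNat
    (fun j => -((j + 1) * ω₁)) x
  simp only [← sub_eq_add_neg] at a
  have b := ((analyticAt_sinProd ω₁ ω₂ (stripIndex ω₁ x) (stripIndex ω₁ x).toNat (fun j => j * ω₁) x).div
    ((analyticAt_doubleSineAt_parts h₁ h₂ x).mul a) ?_).differentiableAt
  · refine b.congr_of_eventuallyEq (Eventually.of_forall fun z => ?_)
    exact inv_div _ _
  -- The function on the strip is an exponential, so zeros can come only from the product of sines.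
  refine mul_ne_zero (exp_ne_zero _) ?_
  rw [Finset.prod_ne_zero_iff]
  intro j hj h0
  obtain ⟨ha, hb⟩ := (stripIndex_eq_iff h₁).1 (rfl : stripIndex ω₁ x = _)
  set n := stripIndex ω₁ x
  obtain ⟨k, hk⟩ := (sin_pi_mul_div_eq_zero_iff h₂).1
    ((mul_eq_zero.1 h0).resolve_left two_ne_zero)
  have hre := congrArg re hk
  simp at hre
  have hj' : (j : ℤ) < -n := by have := Finset.mem_range.1 hj; omega
  have hj0 : (0 : ℝ) ≤ j * ω₁ := by positivity
  have hk0 : k ≤ 0 := by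
    by_contra hneg
    have : 0 < (k : ℝ) * ω₂ := mul_pos (by exact_mod_cast not_le.1 hneg) h₂
    linarith
  refine hx (-n - j - 1).toNat (-k).toNat ?_
  have e1 : (((-n - j - 1).toNat : ℕ) : ℂ) = -n - j - 1 := by
    have : (((-n - j - 1).toNat : ℕ) : ℤ) = -n - j - 1 := by omega
    exact_mod_cast congrArg (Int.cast : ℤ → ℂ) this
  have e2 : (((-k).toNat : ℕ) : ℂ) = -k := by
    have : (((-k).toNat : ℕ) : ℤ) = -k := by omega
    exact_mod_cast congrArg (Int.cast : ℤ → ℂ) this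
  rw [e1, e2]
  linear_combination hk

/-! ### The function `⟨x⟩` -/

theorem differentiableAt_bra {ω : ℝ} (hω : 0 < ω) {x : ℂ} (hx : x ∉ braPoles ω) :
    DifferentiableAt ℂ (bra ω) x := by
  unfold bra
  refine DifferentiableAt.mul (by fun_prop) (differentiableAt_doubleSine one_pos (by positivity) ?_)
  intro m n h
  refine hx ⟨m, n, ?_⟩
  rw [h]
  push_cast
  ring

theorem differentiableAt_inv_bra {ω : ℝ} (hω : 0 < ω) {x : ℂ} (hx : x ∉ braZeros ω) :
    DifferentiableAt ℂ (fun z => (bra ω z)⁻¹) x := by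
  have h : (fun z => (bra ω z)⁻¹) = fun z =>
      exp (-(Real.pi * I / 2 * ((1 + ω) * z - ω * z ^ 2))) * (doubleSine 1 (1 / ω) z)⁻¹ := by
    funext z
    rw [bra, mul_inv, exp_neg]
  rw [h]
  refine DifferentiableAt.mul (by fun_prop)
    (differentiableAt_inv_doubleSine one_pos (by positivity) ?_)
  intro m n h
  refine hx ⟨m, n, ?_⟩
  rw [h]
  push_cast
  ring

theorem meromorphicAt_bra {ω : ℝ} (hω : 0 < ω) (x : ℂ) : MeromorphicAt (bra ω) x := by
  refine MeromorphicAt.mul (AnalyticAt.meromorphicAt ?_)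
    (meromorphicAt_doubleSine one_pos (by positivity) x)
  exact DifferentiableOn.analyticAt (s := univ) (Differentiable.differentiableOn (by fun_prop))
    univ_mem

/-! ### Shift equations of ⟨x⟩ by 1 and by 1/ω -/

theorem qpow_add (ω : ℝ) (u v : ℂ) : qpow ω (u + v) = qpow ω u * qpow ω v := by
  rw [qpow, qpow, qpow, ← exp_add]; ring_nf

theorem qpow_ne_zero (ω : ℝ) (u : ℂ) : qpow ω u ≠ 0 := exp_ne_zero _

theorem qpow_zero (ω : ℝ) : qpow ω 0 = 1 := by simp [qpow]

theorem qpow_sub (ω : ℝ) (u v : ℂ) : qpow ω (u - v) = qpow ω u / qpow ω v := by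
  rw [eq_div_iff (qpow_ne_zero _ _), ← qpow_add, sub_add_cancel]

/-- Follows from 1 - e^{2iθ} = -i e^{iθ} · 2 sin θ. It explains the Gaussian factor in ⟨x⟩: this
factor turns the shift 1/(2 sin) of the double sine function into 1/(1 - q^x), or 1/(1 - e^{2πix})
for the other period. -/
theorem exp_div_two_sin (θ : ℂ) :
    exp (Real.pi * I / 2 - I * θ) / (2 * sin θ) = (1 - exp (2 * I * θ))⁻¹ := by
  have h : 1 - exp (2 * I * θ) = (-I * exp (I * θ)) * (2 * sin θ) := by
    rw [sin, show 2 * I * θ = I * θ + I * θ by ring, exp_add, mul_comm θ I,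
      show -θ * I = -(I * θ) by ring]
    have e : exp (-(I * θ)) * exp (I * θ) = 1 := by rw [← exp_add]; simp
    linear_combination -e + (exp (I * θ) * (exp (-(I * θ)) - exp (I * θ))) * I_sq
  have e2 : exp (Real.pi * I / 2 - I * θ) = (-I * exp (I * θ))⁻¹ := by
    rw [exp_sub, show (Real.pi : ℂ) * I / 2 = Real.pi / 2 * I by ring, exp_pi_div_two_mul_I,
      mul_inv, inv_neg, inv_I, neg_neg, div_eq_mul_inv]
  rw [h, e2, mul_inv (-I * _), div_eq_mul_inv]

theorem bra_add_one_factor (ω : ℝ) (x : ℂ) :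
    exp (Real.pi * I / 2 * ((1 + ω) * (x + 1) - ω * (x + 1) ^ 2)) =
      exp (Real.pi * I / 2 * ((1 + ω) * x - ω * x ^ 2)) *
        exp (Real.pi * I / 2 - I * (Real.pi * ω * x)) := by
  rw [← exp_add]; ring_nf

theorem qpow_eq_exp (ω : ℝ) (x : ℂ) : qpow ω x = exp (2 * I * (Real.pi * ω * x)) := by
  rw [qpow]; ring_nf

theorem pi_mul_div_one_div (ω : ℝ) (x : ℂ) :
    (Real.pi : ℂ) * x / ((1 / ω : ℝ) : ℂ) = Real.pi * ω * x := by
  push_cast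
  rw [div_div_eq_mul_div, div_one]
  ring

theorem qpow_eq_one_iff_sin (ω : ℝ) (x : ℂ) : qpow ω x = 1 ↔ sin (Real.pi * ω * x) = 0 := by
  rw [qpow_eq_exp, Complex.sin_eq_zero_iff, exp_eq_one_iff]
  refine exists_congr fun k => ?_
  have : (2 : ℂ) * I ≠ 0 := by simp
  rw [show (k : ℂ) * (2 * Real.pi * I) = 2 * I * (k * Real.pi) by ring, mul_right_inj' this]

theorem bra_add_one_of_pos (ω : ℝ) {x : ℂ} (h0 : 0 < x.re) :
    bra ω (x + 1) = bra ω x / (1 - qpow ω x) := by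
  have h := doubleSine_add_of_pos (1 / ω) one_pos h0
  rw [ofReal_one, pi_mul_div_one_div] at h
  rw [bra, bra, h, bra_add_one_factor, qpow_eq_exp, div_eq_mul_inv _ (1 - _), ← exp_div_two_sin]
  ring

theorem bra_of_nonpos (ω : ℝ) {x : ℂ} (h0 : x.re ≤ 0) :
    bra ω x = (1 - qpow ω x) * bra ω (x + 1) := by
  have h := doubleSine_add_of_nonpos (1 / ω) one_pos h0
  rw [ofReal_one, pi_mul_div_one_div] at h
  by_cases hs : sin (Real.pi * ω * x) = 0
  · rw [(qpow_eq_one_iff_sin ω x).2 hs, bra, h, hs]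
    simp
  · have hq : 1 - qpow ω x ≠ 0 :=
      sub_ne_zero.2 fun hc => hs ((qpow_eq_one_iff_sin ω x).1 hc.symm)
    rw [mul_comm, ← div_eq_iff hq, bra, bra, h, bra_add_one_factor, qpow_eq_exp,
      div_eq_mul_inv _ (1 - _), ← exp_div_two_sin]
    field_simp

theorem bra_add_one (ω : ℝ) {x : ℂ} (hq : qpow ω x ≠ 1) :
    bra ω (x + 1) = bra ω x / (1 - qpow ω x) := by
  rcases lt_or_ge 0 x.re with h | h
  · exact bra_add_one_of_pos ω h
  · rw [bra_of_nonpos ω h, mul_div_cancel_left₀ _ (sub_ne_zero.2 hq.symm)]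

theorem qpow_eq_one_iff {ω : ℝ} (hω : 0 < ω) {x : ℂ} : qpow ω x = 1 ↔ ∃ k : ℤ, x = k / ω := by
  have n₄ : (ω : ℂ) ≠ 0 := by exact_mod_cast hω.ne'
  rw [qpow, exp_eq_one_iff]
  refine exists_congr fun k => ?_
  have : (2 : ℂ) * Real.pi * I ≠ 0 := two_pi_I_ne_zero
  rw [show 2 * Real.pi * I * ω * x = (ω * x) * (2 * Real.pi * I) by ring, mul_left_inj' this,
    eq_div_iff n₄, mul_comm]

/-- The product form also covers q^x = 1, needed when a parameter is degenerate. In that case x =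
k/ω: for k ≥ 1 the point x + 1 would be a pole, and for k ≤ 0 the definition already has product
form. -/
theorem bra_eq_of_add_one_notMem {ω : ℝ} (hω : 0 < ω) {x : ℂ} (hx : x + 1 ∉ braPoles ω) :
    bra ω x = (1 - qpow ω x) * bra ω (x + 1) := by
  by_cases hq : qpow ω x = 1
  · rcases lt_or_ge 0 x.re with h | h
    · exfalso
      obtain ⟨k, rfl⟩ := (qpow_eq_one_iff hω).1 hq
      rw [div_ofReal_re, intCast_re] at h
      have hk : 0 < k := by
        have := (div_pos_iff_of_pos_right hω).1 h
        exact_mod_cast this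
      refine hx ⟨0, (k - 1).toNat, ?_⟩
      have e2 : (((k - 1).toNat : ℕ) : ℂ) = k - 1 := by
        have : (((k - 1).toNat : ℕ) : ℤ) = k - 1 := by omega
        exact_mod_cast congrArg (Int.cast : ℤ → ℂ) this
      rw [e2]
      push_cast
      ring
    · exact bra_of_nonpos ω h
  · rw [bra_add_one ω hq, mul_div_cancel₀ _ (sub_ne_zero.2 (Ne.symm hq))]

theorem bra_ne_zero_of_strip {ω : ℝ} (hω : 0 < ω) {x : ℂ} (h0 : 0 < x.re) (h1 : x.re < 1 + 1 / ω) :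
    bra ω x ≠ 0 := by
  rw [bra, doubleSine_eq_strip one_pos (by positivity) h0 h1]
  exact mul_ne_zero (exp_ne_zero _) (exp_ne_zero _)

theorem bra_add_inv_of_strip {ω : ℝ} (hω : 0 < ω) {x : ℂ} (h0 : 0 < x.re) (h1 : x.re < 1) :
    bra ω (x + 1 / ω) = bra ω x / (1 - exp (2 * Real.pi * I * x)) := by
  have hp : 0 < 1 / ω := by positivity
  have h := doubleSineStrip_add' one_pos hp h0 h1
  have hre : (x + 1 / ω).re = x.re + 1 / ω := by
    rw [add_re, ← ofReal_one, ← ofReal_div, ofReal_re]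
  have e1 : ((1 / ω : ℝ) : ℂ) = 1 / ω := by push_cast; ring
  rw [e1, ofReal_one, div_one] at h
  have n₄ : (ω : ℂ) ≠ 0 := by exact_mod_cast hω.ne'
  have hf : exp (Real.pi * I / 2 * ((1 + ω) * (x + 1 / ω) - ω * (x + 1 / ω) ^ 2)) =
      exp (Real.pi * I / 2 * ((1 + ω) * x - ω * x ^ 2)) *
        exp (Real.pi * I / 2 - I * (Real.pi * x)) := by
    rw [← exp_add]
    congr 1
    field_simp
    ring
  rw [bra, bra, doubleSine_eq_strip one_pos hp (by rw [hre]; linarith) (by rw [hre]; linarith),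
    doubleSine_eq_strip one_pos hp h0 (by linarith), h, hf, div_eq_mul_inv _ (1 - _),
    show 2 * Real.pi * I * x = 2 * I * (Real.pi * x) by ring, ← exp_div_two_sin]
  ring

/-- The lattice `ℤ + (1 / ω) ℤ`, which contains all zeros and poles of `⟨x⟩`. -/
def braLattice (ω : ℝ) : Set ℂ := {u | ∃ m n : ℤ, u = m + n / ω}

theorem countable_braLattice (ω : ℝ) : (braLattice ω).Countable := by
  have : braLattice ω = range fun p : ℤ × ℤ => (p.1 : ℂ) + p.2 / ω := by
    ext u
    simp [braLattice, eq_comm]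
  rw [this]
  exact countable_range _

theorem add_int_mem_braLattice {ω : ℝ} {x : ℂ} (k : ℤ) :
    x + k ∈ braLattice ω ↔ x ∈ braLattice ω := by
  constructor
  · rintro ⟨m, n, h⟩
    exact ⟨m - k, n, by push_cast; linear_combination h⟩
  · rintro ⟨m, n, h⟩
    exact ⟨m + k, n, by push_cast; linear_combination h⟩

theorem add_int_div_mem_braLattice {ω : ℝ} {x : ℂ} (k : ℤ) :
    x + k / ω ∈ braLattice ω ↔ x ∈ braLattice ω := by
  constructor
  · rintro ⟨m, n, h⟩
    exact ⟨m, n - k, by push_cast; linear_combination h⟩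
  · rintro ⟨m, n, h⟩
    exact ⟨m, n + k, by push_cast; linear_combination h⟩

theorem qpow_ne_one_of_notMem {ω : ℝ} (hω : 0 < ω) {x : ℂ} (hx : x ∉ braLattice ω) :
    qpow ω x ≠ 1 := by
  intro h
  obtain ⟨k, rfl⟩ := (qpow_eq_one_iff hω).1 h
  exact hx ⟨0, k, by push_cast; ring⟩

theorem exp_ne_one_of_notMem {ω : ℝ} {x : ℂ} (hx : x ∉ braLattice ω) :
    exp (2 * Real.pi * I * x) ≠ 1 := by
  intro h
  obtain ⟨k, hk⟩ := exp_eq_one_iff.1 h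
  have : (2 : ℂ) * Real.pi * I ≠ 0 := two_pi_I_ne_zero
  refine hx ⟨k, 0, ?_⟩
  have := mul_left_cancel₀ this (hk.trans (mul_comm _ _))
  rw [this]
  push_cast
  ring

theorem braZeros_subset (ω : ℝ) : braZeros ω ⊆ braLattice ω := by
  rintro _ ⟨m, n, rfl⟩
  exact ⟨-m, -n, by push_cast; ring⟩

theorem braPoles_subset (ω : ℝ) : braPoles ω ⊆ braLattice ω := by
  rintro _ ⟨m, n, rfl⟩
  exact ⟨m + 1, n + 1, by push_cast; ring⟩

theorem qpow_add_inv {ω : ℝ} (hω : 0 < ω) (x : ℂ) : qpow ω (x + 1 / ω) = qpow ω x := by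
  rw [qpow_add, (qpow_eq_one_iff hω (x := 1 / ω)).2 ⟨1, by push_cast; rfl⟩, mul_one]

/-- The continuation of S₂ uses the period 1 only, so the equation for the period 1/ω has to be
propagated. It holds on 0 < Re x < 1 by the symmetry of the integral in the two periods, on Re x = 0
by continuity from the right, and the equation at u is equivalent to the one at u + 1, because
q^{u+1/ω} = q^u and e^{2πi(u+1)} = e^{2πiu}. -/
theorem bra_add_inv {ω : ℝ} (hω : 0 < ω) {x : ℂ} (hx : x ∉ braLattice ω) :
    bra ω (x + 1 / ω) = bra ω x / (1 - exp (2 * Real.pi * I * x)) := by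
  set P : ℂ → Prop := fun x => bra ω (x + 1 / ω) = bra ω x / (1 - exp (2 * Real.pi * I * x)) with hP
  have hexp : ∀ x : ℂ, exp (2 * Real.pi * I * (x + 1)) = exp (2 * Real.pi * I * x) := by
    intro x
    rw [mul_add, mul_one, exp_add, exp_two_pi_mul_I, mul_one]
  have hcont : ∀ u : ℂ, u ∉ braLattice ω → (∀ᶠ w in 𝓝[{w : ℂ | u.re < w.re}] u, P w) → P u := by
    intro u hu hw
    have hu' : u + 1 / ω ∉ braLattice ω := by
      have := (add_int_div_mem_braLattice (ω := ω) (x := u) 1).not.2 hu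
      push_cast at this
      exact this
    have c1 : ContinuousAt (fun w => bra ω (w + 1 / ω)) u := by
      have := (differentiableAt_bra hω fun h => hu' (braPoles_subset ω h)).continuousAt
      exact ContinuousAt.comp (g := bra ω) this (by fun_prop)
    have c2 : ContinuousAt (fun w => bra ω w / (1 - exp (2 * Real.pi * I * w))) u := by
      refine (differentiableAt_bra hω fun h => hu (braPoles_subset ω h)).continuousAt.div
        (by fun_prop) (sub_ne_zero.2 (exp_ne_one_of_notMem hu).symm)
    have : (𝓝[{w : ℂ | u.re < w.re}] u).NeBot := by
      rw [← mem_closure_iff_nhdsWithin_neBot, closure_setOfPred_lt_re]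
      exact le_refl u.re
    exact tendsto_nhds_unique_of_eventuallyEq (c1.tendsto.mono_left nhdsWithin_le_nhds)
      (c2.tendsto.mono_left nhdsWithin_le_nhds) hw
  have hstep : ∀ u : ℂ, u ∉ braLattice ω → (P u ↔ P (u + 1)) := by
    intro u hu
    have hu' : u + 1 / ω ∉ braLattice ω := by
      have := (add_int_div_mem_braLattice (ω := ω) (x := u) 1).not.2 hu
      push_cast at this
      exact this
    have hq : 1 - qpow ω u ≠ 0 := sub_ne_zero.2 (qpow_ne_one_of_notMem hω hu).symm
    have ht : 1 - exp (2 * Real.pi * I * u) ≠ 0 := sub_ne_zero.2 (exp_ne_one_of_notMem hu).symm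
    simp only [hP]
    rw [hexp, add_right_comm, bra_add_one ω (qpow_ne_one_of_notMem hω hu'),
      bra_add_one ω (qpow_ne_one_of_notMem hω hu), qpow_add_inv hω, div_right_comm,
      div_left_inj' hq]
  have hbase : ∀ u : ℂ, u ∉ braLattice ω → 0 ≤ u.re → u.re < 1 → P u := by
    intro u hu h0 h1
    refine hcont u hu ?_
    filter_upwards [self_mem_nhdsWithin, mem_nhdsWithin_of_mem_nhds
      ((isOpen_lt continuous_re continuous_const).mem_nhds (h1 : u ∈ {w : ℂ | w.re < 1}))] with w a b
    exact bra_add_inv_of_strip hω (lt_of_le_of_lt h0 a) b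
  have hall : ∀ n : ℤ, ∀ u : ℂ, u ∉ braLattice ω → 0 ≤ u.re → u.re < 1 → P (u + n) := by
    intro n u hu h0 h1
    have hun : ∀ n : ℤ, u + n ∉ braLattice ω := fun n => (add_int_mem_braLattice n).not.2 hu
    induction n with
    | zero => simpa using hbase u hu h0 h1
    | succ k ih =>
      have := (hstep _ (hun _)).1 ih
      push_cast at this ⊢
      rwa [add_assoc] at this
    | pred k ih =>
      refine (hstep _ (hun _)).2 ?_
      push_cast at ih ⊢
      convert ih using 1
      ring
  have := hall ⌊x.re⌋ (x - ⌊x.re⌋) ?_ ?_ ?_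
  · rwa [sub_add_cancel] at this
  · rw [sub_eq_add_neg, ← Int.cast_neg]
    exact (add_int_mem_braLattice _).not.2 hx
  · simp
  · have := Int.lt_floor_add_one x.re
    simp only [sub_re, intCast_re]
    linarith

/-! ### Asymptotics of ⟨z⟩ for large |Im z| -/

theorem norm_qpow (ω : ℝ) (u : ℂ) : ‖qpow ω u‖ = Real.exp (-(2 * Real.pi * ω * u.im)) := by
  rw [qpow, norm_exp]
  congr 1
  rw [show 2 * Real.pi * I * ω * u = ((2 * Real.pi * ω : ℝ) : ℂ) * (u * I) by push_cast; ring,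
    re_ofReal_mul, mul_I_re]
  ring

theorem abs_log_norm_one_sub_le {ρ : ℝ} (hρ : ρ < 1) {w : ℂ} (hw : ‖w‖ ≤ ρ) :
    |Real.log ‖1 - w‖| ≤ -Real.log (1 - ρ) := by
  have h0 := norm_nonneg w
  have h1 : 1 - ρ ≤ ‖1 - w‖ := by
    have := norm_sub_norm_le (1 : ℂ) w
    rw [norm_one] at this
    linarith
  have h2 : ‖1 - w‖ ≤ 1 + ρ := by
    have := norm_sub_le (1 : ℂ) w
    rw [norm_one] at this
    linarith
  have hp : 0 < 1 - ρ := by linarith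
  rw [abs_le, neg_neg]
  refine ⟨Real.log_le_log hp h1, ?_⟩
  rw [← Real.log_inv]
  refine Real.log_le_log (by linarith) (h2.trans ?_)
  rw [← one_div, le_div_iff₀ hp]
  nlinarith

/-- The leading term of `log |⟨z⟩|` as `Im z → ±∞`. -/
noncomputable def braGrowth (ω : ℝ) (z : ℂ) : ℝ :=
  Real.pi * ω * (2 * z.re - (1 + 1 / ω)) * min z.im 0

/-- In the upper half plane q^z is small; in the lower one the large factor -q^z is taken out and
q^{-z} is small. -/
theorem exists_log_norm_one_sub_qpow {ω : ℝ} (hω : 0 < ω) : ∃ K : ℝ, ∀ z : ℂ, 1 ≤ |z.im| →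
    |Real.log ‖1 - qpow ω z‖ + 2 * Real.pi * ω * min z.im 0| ≤ K := by
  have hpo : 0 < 2 * Real.pi * ω := by positivity
  have hρ : Real.exp (-(2 * Real.pi * ω)) < 1 := Real.exp_lt_one_iff.2 (by linarith)
  refine ⟨-Real.log (1 - Real.exp (-(2 * Real.pi * ω))), fun z hz => ?_⟩
  rcases le_abs.1 hz with h | h
  · rw [min_eq_right (by linarith), mul_zero, add_zero]
    refine abs_log_norm_one_sub_le hρ ?_
    rw [norm_qpow, Real.exp_le_exp]
    nlinarith
  · have e : 1 - qpow ω z = -qpow ω z * (1 - qpow ω (-z)) := by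
      have : qpow ω z * qpow ω (-z) = 1 := by rw [← qpow_add, add_neg_cancel, qpow_zero]
      linear_combination -this
    have hn : ‖qpow ω (-z)‖ ≤ Real.exp (-(2 * Real.pi * ω)) := by
      rw [norm_qpow, Real.exp_le_exp, neg_im]
      nlinarith
    have hne : ‖1 - qpow ω (-z)‖ ≠ 0 := by
      rw [norm_ne_zero_iff, sub_ne_zero]
      intro h1
      rw [← h1, norm_one] at hn
      linarith
    rw [e, norm_mul, norm_neg, Real.log_mul (norm_ne_zero_iff.2 (qpow_ne_zero _ _)) hne, norm_qpow,
      Real.log_exp, min_eq_left (by linarith)]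
    rw [show -(2 * Real.pi * ω * z.im) + Real.log ‖1 - qpow ω (-z)‖ + 2 * Real.pi * ω * z.im =
      Real.log ‖1 - qpow ω (-z)‖ by ring]
    exact abs_log_norm_one_sub_le hρ hn

/-- On a vertical line the Gaussian factor contributes a term linear in Im z with the same slope as
the |Im z| term of S₂: they cancel for Im z > 0 and add up for Im z < 0, whence min(Im z, 0). The
band has width 1 and keeps the distance 1/(2ω) from the edges of the strip, so unit shifts reach
every real part. -/
theorem exists_log_norm_bra_strip {ω : ℝ} (hω : 0 < ω) : ∃ K : ℝ, ∀ z : ℂ,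
    1 / (2 * ω) ≤ z.re → z.re ≤ 1 / (2 * ω) + 1 → bra ω z ≠ 0 ∧
      |Real.log ‖bra ω z‖ - braGrowth ω z| ≤ K := by
  have hp : 0 < 1 / ω := by positivity
  have hd : 1 / (2 * ω) = 1 / ω / 2 := by field_simp
  obtain ⟨K, H⟩ := exists_log_norm_doubleSineStrip one_pos hp hp
  refine ⟨K, fun z h0 h1 => ?_⟩
  have hz0 : 0 < z.re := by rw [hd] at h0; linarith
  have hz1 : z.re < 1 + 1 / ω := by rw [hd] at h1; linarith
  refine ⟨bra_ne_zero_of_strip hω hz0 hz1, ?_⟩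
  have := H z (by rw [hd] at h0 h1; rw [abs_le]; constructor <;> linarith)
  have e : Real.log ‖bra ω z‖ - braGrowth ω z = Real.log ‖doubleSineStrip 1 (1 / ω) z‖ +
      Real.pi / (2 * 1 * (1 / ω)) * (2 * z.re - 1 - 1 / ω) * |z.im| := by
    have hs0 : doubleSineStrip 1 (1 / ω) z ≠ 0 := exp_ne_zero _
    rw [bra, doubleSine_eq_strip one_pos hp hz0 hz1, norm_mul, Real.log_mul
      (norm_ne_zero_iff.2 (exp_ne_zero _)) (norm_ne_zero_iff.2 hs0), norm_exp,
      Real.log_exp, braGrowth]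
    have hm : min z.im 0 = (z.im - |z.im|) / 2 := by
      rcases le_total z.im 0 with h | h
      · rw [min_eq_left h, abs_of_nonpos h]; ring
      · rw [min_eq_right h, abs_of_nonneg h]; ring
    have hr : (Real.pi * I / 2 * ((1 + ω) * z - ω * z ^ 2)).re =
        -(Real.pi / 2 * ((1 + ω) * z.im - 2 * ω * z.re * z.im)) := by
      rw [show Real.pi * I / 2 * ((1 + ω) * z - ω * z ^ 2) =
        ((Real.pi / 2 : ℝ) : ℂ) * ((((1 + ω : ℝ) : ℂ) * z - (ω : ℂ) * z ^ 2) * I) by push_cast; ring,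
        re_ofReal_mul, mul_I_re, sub_im, im_ofReal_mul, im_ofReal_mul, sq, mul_im]
      ring
    rw [hr, hm]
    field_simp
    ring
  rw [e]
  exact this

/-- The growth of `⟨z⟩` in vertical strips of arbitrary width. -/
theorem exists_log_norm_bra {ω : ℝ} (hω : 0 < ω) (M : ℝ) : ∃ K : ℝ, ∀ z : ℂ,
    |z.re| ≤ M → 1 ≤ |z.im| → bra ω z ≠ 0 ∧ |Real.log ‖bra ω z‖ - braGrowth ω z| ≤ K := by
  obtain ⟨K₁, H₁⟩ := exists_log_norm_one_sub_qpow hω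
  obtain ⟨K₀, H₀⟩ := exists_log_norm_bra_strip hω
  have hq : ∀ z : ℂ, 1 ≤ |z.im| → qpow ω z ≠ 1 := by
    intro z hz h
    obtain ⟨k, rfl⟩ := (qpow_eq_one_iff hω).1 h
    rw [← ofReal_intCast, ← ofReal_div, ofReal_im, abs_zero] at hz
    linarith
  have hgrow : ∀ z : ℂ, braGrowth ω (z + 1) = braGrowth ω z + 2 * Real.pi * ω * min z.im 0 := by
    intro z
    rw [braGrowth, braGrowth, add_re, add_im, one_re, one_im, add_zero]
    ring
  have hlog : ∀ z : ℂ, 1 ≤ |z.im| → bra ω z ≠ 0 → Real.log ‖bra ω (z + 1)‖ - braGrowth ω (z + 1) =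
      Real.log ‖bra ω z‖ - braGrowth ω z -
        (Real.log ‖1 - qpow ω z‖ + 2 * Real.pi * ω * min z.im 0) := by
    intro z hz hb
    rw [bra_add_one ω (hq z hz), norm_div, Real.log_div (norm_ne_zero_iff.2 hb)
      (norm_ne_zero_iff.2 (sub_ne_zero.2 (hq z hz).symm)), hgrow]
    ring
  have key : ∀ n : ℕ, ∃ K : ℝ, ∀ z : ℂ, 1 / (2 * ω) - n ≤ z.re → z.re ≤ 1 / (2 * ω) + 1 + n →
      1 ≤ |z.im| → bra ω z ≠ 0 ∧ |Real.log ‖bra ω z‖ - braGrowth ω z| ≤ K := by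
    intro n
    induction n with
    | zero => exact ⟨K₀, fun z h0 h1 _ => H₀ z (by simpa using h0) (by simpa using h1)⟩
    | succ n ih =>
      obtain ⟨K, H⟩ := ih
      -- Every step widens the band by 1 on both sides and costs one factor 1 - q^z, whose logarithm
      -- differs from its leading term by at most `K₁`.
      refine ⟨K + |K₁|, fun z h0 h1 h2 => ?_⟩
      push_cast at h0 h1
      have hn : (0 : ℝ) ≤ n := n.cast_nonneg
      rcases lt_or_ge (1 / (2 * ω) + 1 + n) z.re with h | h
      · have e : z - 1 + 1 = z := by ring
        have him : (z - 1).im = z.im := by simp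
        have hre : (z - 1).re = z.re - 1 := by simp
        obtain ⟨a, b⟩ := H (z - 1) (by rw [hre]; linarith) (by rw [hre]; linarith) (by rwa [him])
        have hl := hlog (z - 1) (by rwa [him]) a
        have h3 := H₁ (z - 1) (by rwa [him])
        rw [e] at hl
        refine ⟨?_, ?_⟩
        · rw [← e, bra_add_one ω (hq (z - 1) (by rwa [him]))]
          exact div_ne_zero a (sub_ne_zero.2 (hq (z - 1) (by rwa [him])).symm)
        · rw [hl]
          exact (abs_sub _ _).trans (add_le_add b (h3.trans (le_abs_self _)))
      rcases lt_or_ge z.re (1 / (2 * ω) - n) with h' | h'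
      · have him : (z + 1).im = z.im := by simp
        have hre : (z + 1).re = z.re + 1 := by simp
        obtain ⟨a, b⟩ := H (z + 1) (by rw [hre]; linarith) (by rw [hre]; linarith) (by rwa [him])
        have hz : bra ω z ≠ 0 := by
          intro hz
          rw [bra_add_one ω (hq z h2), hz, zero_div] at a
          exact a rfl
        have hl := hlog z h2 hz
        have h3 := H₁ z h2
        refine ⟨hz, ?_⟩
        rw [← sub_add_cancel (Real.log ‖bra ω z‖ - braGrowth ω z)
          (Real.log ‖1 - qpow ω z‖ + 2 * Real.pi * ω * min z.im 0), ← hl]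
        exact (abs_add_le _ _).trans (add_le_add b (h3.trans (le_abs_self _)))
      · obtain ⟨a, b⟩ := H z h' h h2
        exact ⟨a, b.trans (by linarith [abs_nonneg K₁])⟩
  obtain ⟨n, hn⟩ := exists_nat_ge (M + 1 / (2 * ω))
  have hd : 0 < 1 / (2 * ω) := by positivity
  obtain ⟨K, H⟩ := key n
  refine ⟨K, fun z hz => H z ?_ ?_⟩
  · linarith [(abs_le.1 hz).1]
  · linarith [(abs_le.1 hz).2]

/-! ### Chains and residues -/

section

/-- `∫ f(z) dz` along the path `c` on `[a, b]`. -/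
noncomputable def pathInt (c : ℝ → ℂ) (a b : ℝ) (f : ℂ → ℂ) : ℂ :=
  ∫ s in a..b, f (c s) * deriv c s

/-- A linear functional on functions that are continuous on `K`, which depends on the values on `K`
only and which integrates a derivative `F'` to `bd F`. -/
structure IsChain (Λ : (ℂ → ℂ) → ℂ) (K : Set ℂ) (bd : (ℂ → ℂ) → ℂ) : Prop where
  add : ∀ f g : ℂ → ℂ, ContinuousOn f K → ContinuousOn g K → Λ (fun z => f z + g z) = Λ f + Λ g
  smul : ∀ (k : ℂ) (f : ℂ → ℂ), Λ (fun z => k * f z) = k * Λ f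
  congr : ∀ f g : ℂ → ℂ, EqOn f g K → Λ f = Λ g
  prim : ∀ F f : ℂ → ℂ, ContinuousOn f K → (∀ z ∈ K, HasDerivAt F (f z) z) → Λ f = bd F

theorem continuousOn_comp_path {c : ℝ → ℂ} (hc : ContDiff ℝ 1 c) {a b : ℝ} {f : ℂ → ℂ}
    (hf : ContinuousOn f (c '' Icc a b)) :
    ContinuousOn (fun s => f (c s) * deriv c s) (Icc a b) :=
  (hf.comp hc.continuous.continuousOn (mapsTo_image c _)).mul
    (hc.continuous_deriv le_rfl).continuousOn

theorem IsChain.path {c : ℝ → ℂ} (hc : ContDiff ℝ 1 c) {a b : ℝ} (hab : a ≤ b) :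
    IsChain (pathInt c a b) (c '' Icc a b) (fun F => F (c b) - F (c a)) where
  add f g hf hg := by
    have h1 := (continuousOn_comp_path hc hf).intervalIntegrable_of_Icc (μ := volume) hab
    have h2 := (continuousOn_comp_path hc hg).intervalIntegrable_of_Icc (μ := volume) hab
    rw [pathInt, pathInt, pathInt, ← intervalIntegral.integral_add h1 h2]
    simp_rw [add_mul]
  smul k f := by
    rw [pathInt, pathInt, ← intervalIntegral.integral_const_mul]
    simp_rw [mul_assoc]
  congr f g h := by
    refine intervalIntegral.integral_congr fun s hs => ?_
    rw [uIcc_of_le hab] at hs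
    simp only [h (mem_image_of_mem c hs)]
  prim F f hf hF := by
    refine intervalIntegral.integral_eq_sub_of_hasDerivAt (f := fun s => F (c s)) (fun s hs => ?_)
      ((continuousOn_comp_path hc hf).intervalIntegrable_of_Icc hab)
    rw [uIcc_of_le hab] at hs
    have h1 := (hc.differentiable one_ne_zero s).hasDerivAt
    have := (hF _ (mem_image_of_mem c hs)).scomp s h1
    rwa [smul_eq_mul, mul_comm] at this

variable {Λ Λ' : (ℂ → ℂ) → ℂ} {K K' : Set ℂ} {bd bd' : (ℂ → ℂ) → ℂ}

theorem IsChain.add_chain (h : IsChain Λ K bd) (h' : IsChain Λ' K' bd') :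
    IsChain (fun f => Λ f + Λ' f) (K ∪ K') (fun F => bd F + bd' F) where
  add f g hf hg := by
    rw [h.add f g (hf.mono subset_union_left) (hg.mono subset_union_left),
      h'.add f g (hf.mono subset_union_right) (hg.mono subset_union_right)]
    ring
  smul k f := by rw [h.smul, h'.smul]; ring
  congr f g hfg := by
    rw [h.congr f g (hfg.mono subset_union_left), h'.congr f g (hfg.mono subset_union_right)]
  prim F f hf hF := by
    rw [h.prim F f (hf.mono subset_union_left) fun z hz => hF z (Or.inl hz),
      h'.prim F f (hf.mono subset_union_right) fun z hz => hF z (Or.inr hz)]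

theorem IsChain.smul_chain (h : IsChain Λ K bd) (w : ℂ) :
    IsChain (fun f => w * Λ f) K (fun F => w * bd F) where
  add f g hf hg := by rw [h.add f g hf hg]; ring
  smul k f := by rw [h.smul]; ring
  congr f g hfg := by rw [h.congr f g hfg]
  prim F f hf hF := by rw [h.prim F f hf hF]

theorem IsChain.sub_chain (h : IsChain Λ K bd) (h' : IsChain Λ' K' bd') :
    IsChain (fun f => Λ f - Λ' f) (K ∪ K') (fun F => bd F - bd' F) := by
  have := h.add_chain (h'.smul_chain (-1))
  simpa only [neg_one_mul, ← sub_eq_add_neg] using this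

theorem IsChain.sum_chain {ι : Type*} (S : Finset ι) {Λ : ι → (ℂ → ℂ) → ℂ} {K : ι → Set ℂ}
    {bd : ι → (ℂ → ℂ) → ℂ} (h : ∀ i ∈ S, IsChain (Λ i) (K i) (bd i)) :
    IsChain (fun f => ∑ i ∈ S, Λ i f) (⋃ i ∈ S, K i) (fun F => ∑ i ∈ S, bd i F) where
  add f g hf hg := by
    rw [← Finset.sum_add_distrib]
    exact Finset.sum_congr rfl fun i hi => (h i hi).add f g
      (hf.mono (subset_biUnion_of_mem (u := K) hi)) (hg.mono (subset_biUnion_of_mem (u := K) hi))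
  smul k f := by
    rw [Finset.mul_sum]
    exact Finset.sum_congr rfl fun i hi => (h i hi).smul k f
  congr f g hfg :=
    Finset.sum_congr rfl fun i hi => (h i hi).congr f g
      (hfg.mono (subset_biUnion_of_mem (u := K) hi))
  prim F f hf hF :=
    Finset.sum_congr rfl fun i hi => (h i hi).prim F f
      (hf.mono (subset_biUnion_of_mem (u := K) hi)) fun z hz =>
        hF z (mem_biUnion (s := (S : Set ι)) (t := K) hi hz)

theorem IsChain.map_zero (h : IsChain Λ K bd) : Λ (fun _ => 0) = 0 := by
  have := h.smul 0 fun _ => 0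
  simpa using this

theorem IsChain.map_sum (h : IsChain Λ K bd) {ι : Type*} (S : Finset ι) (f : ι → ℂ → ℂ)
    (hf : ∀ i ∈ S, ContinuousOn (f i) K) :
    Λ (fun z => ∑ i ∈ S, f i z) = ∑ i ∈ S, Λ (f i) := by
  classical
  induction S using Finset.induction_on with
  | empty => simpa using h.map_zero
  | insert i S hi ih =>
    simp_rw [Finset.sum_insert hi]
    rw [h.add _ _ (hf i (Finset.mem_insert_self _ _))
      (continuousOn_finsetSum _ fun j hj => hf j (Finset.mem_insert_of_mem hj)),
      ih fun j hj => hf j (Finset.mem_insert_of_mem hj)]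

/-- The principal part of a function that is meromorphic at `p`. -/
theorem exists_principal_part {f : ℂ → ℂ} {p : ℂ} (hf : MeromorphicAt f p) :
    ∃ (n : ℕ) (c : ℕ → ℂ) (g : ℂ → ℂ), AnalyticAt ℂ g p ∧
      ∀ z, z ≠ p → f z = (∑ k ∈ Finset.range n, c k * ((z - p) ^ (k + 1))⁻¹) + g z := by
  obtain ⟨n, hn⟩ := hf
  have key : ∀ (n : ℕ) (F : ℂ → ℂ), AnalyticAt ℂ F p → ∃ (c : ℕ → ℂ) (g : ℂ → ℂ),
      AnalyticAt ℂ g p ∧ ∀ z, z ≠ p → F z * ((z - p) ^ n)⁻¹ =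
        (∑ k ∈ Finset.range n, c k * ((z - p) ^ (k + 1))⁻¹) + g z := by
    intro n
    induction n with
    | zero => exact fun F hF => ⟨0, F, hF, fun z _ => by simp⟩
    | succ n ih =>
      intro F hF
      obtain ⟨q, hq⟩ := hF
      obtain ⟨c, g, hg, hc⟩ := ih (dslope F p) hq.has_fpower_series_dslope_fslope.analyticAt
      -- Since F(z) = F(p) + (z - p) · `dslope F p z`, the value F(p) is the coefficient of the
      -- highest power and the slope has a pole of one order less to deal with.
      refine ⟨fun k => if k = n then F p else c k, g, hg, fun z hz => ?_⟩
      have hz' : z - p ≠ 0 := sub_ne_zero.2 hz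
      have e : F z = F p + (z - p) * dslope F p z := by
        have := sub_smul_dslope F p z
        rw [smul_eq_mul] at this
        rw [this]; ring
      have e' : (∑ k ∈ Finset.range n, (if k = n then F p else c k) * ((z - p) ^ (k + 1))⁻¹) =
          ∑ k ∈ Finset.range n, c k * ((z - p) ^ (k + 1))⁻¹ :=
        Finset.sum_congr rfl fun k hk => by rw [if_neg (Finset.mem_range.1 hk).ne]
      rw [Finset.sum_range_succ]
      simp only [if_true]
      rw [e', add_right_comm, ← hc z hz, e, pow_succ, mul_inv]
      field_simp
      ring
  obtain ⟨c, g, hg, hc⟩ := key n _ hn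
  refine ⟨n, c, g, hg, fun z hz => ?_⟩
  rw [← hc z hz, smul_eq_mul, mul_comm _ (f z), mul_assoc,
    mul_inv_cancel₀ (pow_ne_zero _ (sub_ne_zero.2 hz)), mul_one]

/-- Powers beyond the first have a primitive off p, so on a cycle only the residue term can
contribute. -/
theorem IsChain.inv_pow_eq_zero (h : IsChain Λ K bd) (hbd : ∀ F, bd F = 0) {p : ℂ} (hp : p ∉ K)
    (hres : Λ (fun z => (z - p)⁻¹) = 0) (k : ℕ) : Λ (fun z => ((z - p) ^ (k + 1))⁻¹) = 0 := by
  have hne : ∀ z ∈ K, z - p ≠ 0 := fun z hz => sub_ne_zero.2 fun e => hp (e ▸ hz)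
  rcases k with _ | k
  · simpa using hres
  · rw [h.prim (fun z => -((k + 1 : ℂ)⁻¹ * ((z - p) ^ (k + 1))⁻¹)), hbd]
    · exact ContinuousOn.inv₀ (by fun_prop) fun z hz => pow_ne_zero _ (hne z hz)
    · intro z hz
      have h1 := (((hasDerivAt_id z).sub_const p).pow (k + 1)).inv (pow_ne_zero _ (hne z hz))
      refine (h1.const_mul ((k : ℂ) + 1)⁻¹).neg.congr_deriv ?_
      have h2 := hne z hz
      have h3 : (k : ℂ) + 1 ≠ 0 := by exact_mod_cast k.succ_ne_zero
      simp only [id, Nat.add_sub_cancel, Nat.cast_add, Nat.cast_one, mul_one, Pi.pow_apply]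
      field_simp
      ring

/-- Cauchy's theorem for a cycle of winding number `0` around the poles of `f`. -/
theorem IsChain.eq_zero (h : IsChain Λ K bd) (hbd : ∀ F, bd F = 0) {M : ℝ}
    (hK : K ⊆ Metric.ball 0 M) (S : Finset ℂ) (hKS : ∀ p ∈ S, p ∉ K)
    (hres : ∀ p ∈ S, Λ (fun z => (z - p)⁻¹) = 0) (f : ℂ → ℂ)
    (hd : DifferentiableOn ℂ f (Metric.ball 0 M \ S)) (hm : ∀ p ∈ S, MeromorphicAt f p) :
    Λ f = 0 := by
  classical
  induction S using Finset.induction_on generalizing f with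
  | empty =>
    rw [Finset.coe_empty, sdiff_empty] at hd
    -- Without poles the function has a primitive on the disc, and the boundary functional vanishes.
    obtain ⟨F, hF⟩ := hd.isExactOn_ball
    rw [h.prim F f (hd.continuousOn.mono hK) fun z hz => hF z (hK hz), hbd]
  | insert p S hp ih =>
    obtain ⟨n, c, g, hg, hc⟩ := exists_principal_part (hm p (Finset.mem_insert_self _ _))
    have hpK := hKS p (Finset.mem_insert_self _ _)
    have hne : ∀ z ∈ K, z ≠ p := fun z hz e => hpK (e ▸ hz)
    set P : ℂ → ℂ := fun z => ∑ k ∈ Finset.range n, c k * ((z - p) ^ (k + 1))⁻¹ with hP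
    -- Removing the principal part at p and filling in the value g(p) gives a function holomorphic
    -- at p, to which the induction hypothesis applies.
    set f₁ : ℂ → ℂ := Function.update (fun z => f z - P z) p (g p) with hf₁
    have hPd : ∀ z, z ≠ p → AnalyticAt ℂ P z := by
      intro z hz
      refine DifferentiableOn.analyticAt (s := {p}ᶜ) (fun w hw => ?_)
        (isOpen_compl_singleton.mem_nhds hz)
      have hw' : ∀ k : ℕ, (w - p) ^ (k + 1) ≠ 0 := fun k => pow_ne_zero _ (sub_ne_zero.2 hw)
      refine DifferentiableAt.differentiableWithinAt ?_
      refine DifferentiableAt.fun_sum fun k _ => ?_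
      exact ((((differentiableAt_id).sub_const p).pow (k + 1)).inv (hw' k)).const_mul (c k)
    have hev : ∀ z, z ≠ p → f₁ =ᶠ[𝓝 z] fun z => f z - P z := by
      intro z hz
      filter_upwards [isOpen_compl_singleton.mem_nhds hz] with w hw
      exact Function.update_of_ne hw _ _
    have hg₁ : f₁ = g := by
      funext z
      rcases eq_or_ne z p with rfl | hz
      · exact Function.update_self _ _ _
      · rw [hf₁, Function.update_of_ne hz, hc z hz]
        ring
    have e1 : Λ f₁ = 0 := by
      refine ih (fun q hq => hKS q (Finset.mem_insert_of_mem hq))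
        (fun q hq => hres q (Finset.mem_insert_of_mem hq)) f₁ (fun z hz => ?_) (fun q hq => ?_)
      · rcases eq_or_ne z p with rfl | hzp
        · rw [hg₁]
          exact hg.differentiableAt.differentiableWithinAt
        · have ho : IsOpen (Metric.ball (0 : ℂ) M \ (insert p S : Finset ℂ)) :=
            Metric.isOpen_ball.sdiff (Finset.finite_toSet _).isClosed
          have hz' : z ∈ Metric.ball (0 : ℂ) M \ (insert p S : Finset ℂ) := by
            refine ⟨hz.1, ?_⟩
            rw [Finset.coe_insert, mem_insert_iff, not_or]
            exact ⟨hzp, hz.2⟩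
          have := ((hd z hz').differentiableAt (ho.mem_nhds hz')).sub (hPd z hzp).differentiableAt
          exact (this.congr_of_eventuallyEq (hev z hzp)).differentiableWithinAt
      · have hqp : q ≠ p := fun e => hp (e ▸ hq)
        refine MeromorphicAt.congr ?_ ((hev q hqp).symm.filter_mono nhdsWithin_le_nhds)
        exact (hm q (Finset.mem_insert_of_mem hq)).sub (hPd q hqp).meromorphicAt
    have hcont : ∀ k : ℕ, ContinuousOn (fun z => ((z - p) ^ (k + 1))⁻¹) K := fun k =>
      ContinuousOn.inv₀ (by fun_prop) fun z hz => pow_ne_zero _ (sub_ne_zero.2 (hne z hz))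
    have hcontP : ∀ k : ℕ, ContinuousOn (fun z => c k * ((z - p) ^ (k + 1))⁻¹) K := fun k =>
      continuousOn_const.mul (hcont k)
    have e2 : Λ P = 0 := by
      rw [hP, h.map_sum _ _ fun k _ => hcontP k]
      refine Finset.sum_eq_zero fun k _ => ?_
      rw [h.smul, h.inv_pow_eq_zero hbd hpK (hres p (Finset.mem_insert_self _ _)), mul_zero]
    have hcPK : ContinuousOn P K := continuousOn_finsetSum _ fun k _ => hcontP k
    have hcf : ContinuousOn f₁ K := by
      have hfK : ContinuousOn f K := by
        refine hd.continuousOn.mono fun z hz => ⟨hK hz, fun hzS => ?_⟩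
        exact hKS z hzS hz
      refine (hfK.sub hcPK).congr fun z hz => ?_
      exact Function.update_of_ne (hne z hz) _ _
    have e3 := h.add P f₁ hcPK hcf
    rw [e1, e2, add_zero] at e3
    rw [← e3]
    refine h.congr _ _ fun z hz => ?_
    rw [hf₁, Function.update_of_ne (hne z hz)]
    ring

end

/-! ### Integrals of `1 / (z - p)` along a contour -/

/-- `∫ dz / (z - p)` over a contour from `-R i` to `R i`, up to a constant `± π i` that depends on
the side of `p`. -/
noncomputable def windLog (R : ℝ) (p : ℂ) : ℂ := log (R + I * p) - log (R - I * p)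

theorem hasDerivAt_windLog {R : ℝ} {p : ℂ} (h1 : (R + I * p : ℂ) ∈ slitPlane)
    (h2 : (R - I * p : ℂ) ∈ slitPlane) :
    HasDerivAt (windLog R) (I / (R + I * p) + I / (R - I * p)) p := by
  have a1 : HasDerivAt (fun p : ℂ => (R + I * p : ℂ)) I p := by
    simpa using ((hasDerivAt_id p).const_mul I).const_add (R : ℂ)
  have a2 : HasDerivAt (fun p : ℂ => (R - I * p : ℂ)) (-I) p := by
    simpa using ((hasDerivAt_id p).const_mul I).const_sub (R : ℂ)
  refine ((a1.clog h1).sub (a2.clog h2)).congr_deriv ?_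
  ring

theorem tendsto_log_ofReal_add_I_mul (R : ℝ) :
    Tendsto (fun u : ℝ => log (R + I * u) - log (R - I * u)) atTop (𝓝 (Real.pi * I)) := by
  have h0 : Tendsto (fun u : ℝ => (R / u : ℝ)) atTop (𝓝 0) := tendsto_const_nhds.div_atTop tendsto_id
  have h1 : Tendsto (fun u : ℝ => (((R / u : ℝ) : ℂ) + I)) atTop (𝓝 I) := by
    simpa using ((continuous_ofReal.tendsto 0).comp h0).add_const I
  have h2 : Tendsto (fun u : ℝ => (((R / u : ℝ) : ℂ) - I)) atTop (𝓝 (-I)) := by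
    simpa using ((continuous_ofReal.tendsto 0).comp h0).sub_const I
  have l1 := (continuousAt_clog (x := I) (by simp [slitPlane])).tendsto.comp h1
  have l2 := (continuousAt_clog (x := -I) (by simp [slitPlane])).tendsto.comp h2
  have h3 := l1.sub l2
  rw [log_I, log_neg_I, show (Real.pi : ℂ) / 2 * I - -(Real.pi / 2) * I = Real.pi * I by ring] at h3
  refine h3.congr' ?_
  filter_upwards [eventually_gt_atTop 0] with u hu
  have hu' : (u : ℂ) ≠ 0 := by exact_mod_cast hu.ne'
  have e1 : (R + I * u : ℂ) = u * (((R / u : ℝ) : ℂ) + I) := by push_cast; field_simp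
  have e2 : (R - I * u : ℂ) = u * (((R / u : ℝ) : ℂ) - I) := by push_cast; field_simp
  have n1 : ((R / u : ℝ) : ℂ) + I ≠ 0 := fun h => by
    have := congrArg im h; simp at this
  have n2 : ((R / u : ℝ) : ℂ) - I ≠ 0 := fun h => by
    have := congrArg im h; simp at this
  rw [e1, e2, log_ofReal_mul hu n1, log_ofReal_mul hu n2]
  simp

theorem tendsto_windLog_atTop (R : ℝ) :
    Tendsto (fun u : ℝ => windLog R u) atTop (𝓝 (Real.pi * I)) :=
  tendsto_log_ofReal_add_I_mul R

theorem tendsto_windLog_atBot (R : ℝ) :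
    Tendsto (fun u : ℝ => windLog R u) atBot (𝓝 (-(Real.pi * I))) := by
  have := ((tendsto_log_ofReal_add_I_mul R).comp tendsto_neg_atBot_atTop).neg
  refine this.congr fun u => ?_
  simp [windLog, sub_eq_add_neg]

namespace Contour

variable (C : Contour)

theorem isClosed_range : IsClosed (range C.path) := by
  obtain ⟨R, hR⟩ := C.eq_axis
  have e : range C.path = C.path '' Icc (-R) R ∪ {z : ℂ | z.re = 0 ∧ R ≤ |z.im|} := by
    ext z
    constructor
    · rintro ⟨s, rfl⟩
      rcases le_or_gt R |s| with h | h
      · right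
        rw [hR s h]
        simpa using h
      · left
        exact mem_image_of_mem _ (abs_le.1 h.le)
    · rintro (⟨s, -, rfl⟩ | ⟨h0, h1⟩)
      · exact mem_range_self s
      · refine ⟨z.im, ?_⟩
        rw [hR _ h1]
        apply Complex.ext <;> simp [h0]
  rw [e]
  refine (isCompact_Icc.image C.contDiff.continuous).isClosed.union ?_
  exact (isClosed_eq continuous_re continuous_const).inter
    (isClosed_le continuous_const (continuous_abs.comp continuous_im))

variable {C}

/-- The branch cuts of `windLog R` are the rays of the imaginary axis with |Im p| ≥ R, and these
belong to the contour. Hence `windLog R` is holomorphic on the whole complement of the contour. -/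
theorem slitPlane_of_notMem_range {R : ℝ} (hR0 : 0 < R) (hR : ∀ s : ℝ, R ≤ |s| → C.path s = s * I)
    {p : ℂ} (hp : p ∉ range C.path) :
    (R + I * p : ℂ) ∈ slitPlane ∧ (R - I * p : ℂ) ∈ slitPlane := by
  have key : ∀ z : ℂ, z ∉ slitPlane → z.re ≤ 0 ∧ z.im = 0 := by
    intro z hz
    rw [mem_slitPlane_iff, not_or, not_lt, not_not] at hz
    exact hz
  constructor
  · by_contra h
    obtain ⟨h1, h2⟩ := key _ h
    simp at h1 h2
    refine hp ⟨p.im, ?_⟩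
    rw [hR p.im (by rw [abs_of_nonneg (by linarith)]; linarith)]
    apply Complex.ext <;> simp [h2]
  · by_contra h
    obtain ⟨h1, h2⟩ := key _ h
    simp at h1 h2
    refine hp ⟨p.im, ?_⟩
    rw [hR p.im (by rw [abs_of_nonpos (by linarith)]; linarith)]
    apply Complex.ext <;> simp [h2]

/-- Differentiation gives the integral of 1/(z - p)², which has the primitive -1/(z - p), so only
the endpoints matter. -/
theorem hasDerivAt_pathInt_inv {R : ℝ} (hR0 : 0 < R) {p : ℂ} (hp : p ∉ range C.path) :
    HasDerivAt (fun p => pathInt C.path (-R) R fun z => (z - p)⁻¹)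
      (-(C.path R - p)⁻¹ + (C.path (-R) - p)⁻¹) p := by
  have hab : -R ≤ R := by linarith
  have hcd : Continuous (deriv C.path) := C.contDiff.continuous_deriv le_rfl
  obtain ⟨r, hr, hball⟩ := Metric.isOpen_iff.1 C.isClosed_range.isOpen_compl p hp
  have hdist : ∀ q ∈ Metric.ball p (r / 2), ∀ s, r / 2 ≤ ‖C.path s - q‖ := by
    intro q hq s
    by_contra h
    have : C.path s ∈ Metric.ball p r := by
      rw [Metric.mem_ball] at hq ⊢
      have h2 := dist_triangle (C.path s) q p
      rw [dist_eq_norm (C.path s) q] at h2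
      linarith
    exact hball this (mem_range_self s)
  have hne : ∀ q ∈ Metric.ball p (r / 2), ∀ s, C.path s - q ≠ 0 := by
    intro q hq s h
    have := hdist q hq s
    rw [h, norm_zero] at this
    linarith
  have hp2 : p ∈ Metric.ball p (r / 2) := Metric.mem_ball_self (by positivity)
  have hcont : ∀ q ∈ Metric.ball p (r / 2), Continuous fun s => (C.path s - q)⁻¹ * deriv C.path s :=
    fun q hq => ((C.contDiff.continuous.sub continuous_const).inv₀ (hne q hq)).mul hcd
  have hprim : pathInt C.path (-R) R (fun z => ((z - p) ^ 2)⁻¹) =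
      -(C.path R - p)⁻¹ - -(C.path (-R) - p)⁻¹ := by
    have hK : ∀ z ∈ C.path '' Icc (-R) R, z - p ≠ 0 := by
      rintro _ ⟨s, -, rfl⟩
      exact hne p hp2 s
    refine (IsChain.path C.contDiff hab).prim (fun z => -(z - p)⁻¹) _ ?_ fun z hz => ?_
    · exact ContinuousOn.inv₀ (by fun_prop) fun z hz => pow_ne_zero 2 (hK z hz)
    · refine (((hasDerivAt_id z).sub_const p).inv (hK z hz)).neg.congr_deriv ?_
      simp [div_eq_mul_inv]
  have h := hasDerivAt_integral_of_dominated_holomorphic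
    (μ := volume.restrict (Ioc (-R) R)) (F := fun p s => (C.path s - p)⁻¹ * deriv C.path s)
    (F' := fun p s => ((C.path s - p) ^ 2)⁻¹ * deriv C.path s) (z₀ := p) (r := r / 2)
    (by positivity) (bound := fun s => (r / 2)⁻¹ * ‖deriv C.path s‖) ?_ ?_ ?_ ?_ ?_
  · have h2 := h.2
    rw [← intervalIntegral.integral_of_le hab] at h2
    change HasDerivAt _ (pathInt C.path (-R) R fun z => ((z - p) ^ 2)⁻¹) p at h2
    rw [hprim, sub_neg_eq_add] at h2
    refine h2.congr_of_eventuallyEq (Eventually.of_forall fun q => ?_)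
    exact intervalIntegral.integral_of_le hab
  · exact ((continuous_const.mul hcd.norm).integrableOn_Icc).mono_set Ioc_subset_Icc_self
  · exact fun q hq => (hcont q hq).aestronglyMeasurable
  · exact ((((C.contDiff.continuous.sub continuous_const).pow 2).inv₀
      fun s => pow_ne_zero 2 (hne p hp2 s)).mul hcd).aestronglyMeasurable
  · refine Eventually.of_forall fun s q hq => ?_
    have := (((hasDerivAt_id q).const_sub (C.path s)).inv (hne q hq s)).mul_const (deriv C.path s)
    refine this.congr_deriv ?_
    simp [div_eq_mul_inv]
  · refine Eventually.of_forall fun s q hq => ?_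
    rw [norm_mul, norm_inv]
    gcongr
    exact hdist q hq s

/-- Both terms have the same derivative in p, as it depends only on the endpoints ±Ri. So the
difference is constant on path components of the complement; it plays the role of a winding number.
-/
theorem pathInt_sub_windLog_eq {R : ℝ} (hR0 : 0 < R) (hR : ∀ s : ℝ, R ≤ |s| → C.path s = s * I)
    {p q : ℂ} (hpq : JoinedIn (range C.path)ᶜ p q) :
    pathInt C.path (-R) R (fun z => (z - p)⁻¹) - windLog R p =
      pathInt C.path (-R) R (fun z => (z - q)⁻¹) - windLog R q := by
  have hsub : ∀ z ∈ pathComponentIn (range C.path)ᶜ p, z ∉ range C.path :=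
    fun z hz => pathComponentIn_subset hz
  have hd : ∀ z ∈ pathComponentIn (range C.path)ᶜ p,
      HasDerivAt (fun p => pathInt C.path (-R) R (fun z => (z - p)⁻¹) - windLog R p) 0 z := by
    intro z hz
    obtain ⟨s1, s2⟩ := slitPlane_of_notMem_range hR0 hR (hsub z hz)
    refine ((hasDerivAt_pathInt_inv hR0 (hsub z hz)).sub (hasDerivAt_windLog s1 s2)).congr_deriv ?_
    rw [hR R (le_abs_self R), hR (-R) (by rw [abs_neg]; exact le_abs_self R)]
    have e1 : (R : ℂ) + I * z = -I * (R * I - z) := by linear_combination (R : ℂ) * I_sq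
    have e2 : (R : ℂ) - I * z = I * (((-R : ℝ) : ℂ) * I - z) := by
      push_cast
      linear_combination (R : ℂ) * I_sq
    rw [e1, e2, div_mul_cancel_left₀ I_ne_zero, neg_mul, div_neg, div_mul_cancel_left₀ I_ne_zero]
    ring
  have ho : IsOpen (pathComponentIn (range C.path)ᶜ p) := C.isClosed_range.isOpen_compl.pathComponentIn _
  have hpre : IsPreconnected (pathComponentIn (range C.path)ᶜ p) :=
    (isPathConnected_pathComponentIn hpq.source_mem).isConnected.isPreconnected
  exact ho.is_const_of_deriv_eq_zero hpre
    (fun z hz => (hd z hz).differentiableAt.differentiableWithinAt) (fun z hz => (hd z hz).deriv)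
    (mem_pathComponentIn_self hpq.source_mem) hpq

theorem tendsto_pathInt_inv (C : Contour) {R : ℝ} (hR0 : 0 < R) {l : Filter ℝ}
    (hl : Tendsto (fun u : ℝ => |u|) l atTop) :
    Tendsto (fun u : ℝ => pathInt C.path (-R) R fun z => (z - u)⁻¹) l (𝓝 0) := by
  have hab : -R ≤ R := by linarith
  have hcd : Continuous (deriv C.path) := C.contDiff.continuous_deriv le_rfl
  obtain ⟨B, hB⟩ := (isCompact_Icc (a := -R) (b := R)).exists_bound_of_continuousOn
    C.contDiff.continuous.continuousOn
  obtain ⟨D, hD⟩ := (isCompact_Icc (a := -R) (b := R)).exists_bound_of_continuousOn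
    hcd.continuousOn
  have hlim : Tendsto (fun u : ℝ => D / (|u| - B) * |R - -R|) l (𝓝 0) := by
    have := (tendsto_const_nhds (x := D)).div_atTop (tendsto_atTop_add_const_right l (-B) hl)
    simpa [sub_eq_add_neg] using this.mul_const |R - -R|
  refine squeeze_zero_norm' ?_ hlim
  filter_upwards [hl.eventually_gt_atTop B] with u hu
  refine intervalIntegral.norm_integral_le_of_norm_le_const fun s hs => ?_
  rw [uIoc_of_le hab] at hs
  have hs' := Ioc_subset_Icc_self hs
  have h1 : |u| - B ≤ ‖C.path s - u‖ := by
    have := norm_sub_norm_le (u : ℂ) (C.path s)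
    rw [norm_real, Real.norm_eq_abs, norm_sub_rev] at this
    linarith [hB s hs']
  rw [norm_mul, norm_inv, mul_comm, ← div_eq_mul_inv]
  have h2 := hD s hs'
  have h3 : 0 < |u| - B := by linarith
  have h4 : 0 ≤ D := (norm_nonneg _).trans h2
  gcongr

/-- The constant on the left component is read off at real p → -∞, where the integral tends to 0 and
`windLog` to -πi. -/
theorem pathInt_inv_of_onLeft {R : ℝ} (hR0 : 0 < R) (hR : ∀ s : ℝ, R ≤ |s| → C.path s = s * I)
    {p : ℂ} (hp : C.OnLeft p) :
    pathInt C.path (-R) R (fun z => (z - p)⁻¹) = windLog R p + Real.pi * I := by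
  have h1 := (C.tendsto_pathInt_inv hR0 tendsto_abs_atBot_atTop).sub (tendsto_windLog_atBot R)
  rw [zero_sub, neg_neg] at h1
  have h2 : Tendsto (fun _ : ℝ => pathInt C.path (-R) R (fun z => (z - p)⁻¹) - windLog R p) atBot
      (𝓝 (Real.pi * I)) := by
    refine h1.congr' ?_
    filter_upwards [hp] with u hu
    exact (pathInt_sub_windLog_eq hR0 hR hu).symm
  have := tendsto_nhds_unique tendsto_const_nhds h2
  linear_combination this

theorem pathInt_inv_of_onRight {R : ℝ} (hR0 : 0 < R) (hR : ∀ s : ℝ, R ≤ |s| → C.path s = s * I)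
    {p : ℂ} (hp : C.OnRight p) :
    pathInt C.path (-R) R (fun z => (z - p)⁻¹) = windLog R p - Real.pi * I := by
  have h1 := (C.tendsto_pathInt_inv hR0 tendsto_abs_atTop_atTop).sub (tendsto_windLog_atTop R)
  rw [zero_sub] at h1
  have h2 : Tendsto (fun _ : ℝ => pathInt C.path (-R) R (fun z => (z - p)⁻¹) - windLog R p) atTop
      (𝓝 (-(Real.pi * I))) := by
    refine h1.congr' ?_
    filter_upwards [hp] with u hu
    exact (pathInt_sub_windLog_eq hR0 hR hu).symm
  have := tendsto_nhds_unique tendsto_const_nhds h2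
  linear_combination this

theorem OnLeft.notMem_range {p : ℂ} (hp : C.OnLeft p) : p ∉ range C.path := by
  obtain ⟨u, hu⟩ := hp.exists
  exact hu.source_mem

theorem OnRight.notMem_range {p : ℂ} (hp : C.OnRight p) : p ∉ range C.path := by
  obtain ⟨u, hu⟩ := hp.exists
  exact hu.source_mem

theorem exists_pos_eq_axis (C : Contour) : ∃ R : ℝ, 0 < R ∧ ∀ s : ℝ, R ≤ |s| → C.path s = s * I := by
  obtain ⟨R, hR⟩ := C.eq_axis
  exact ⟨max R 1, by positivity, fun s hs => hR s ((le_max_left _ _).trans hs)⟩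

/-- No point lies on both sides of a contour. -/
theorem not_onLeft_and_onRight (C : Contour) (p : ℂ) : ¬(C.OnLeft p ∧ C.OnRight p) := by
  rintro ⟨h1, h2⟩
  obtain ⟨R, hR0, hR⟩ := C.exists_pos_eq_axis
  have e1 := pathInt_inv_of_onLeft hR0 hR h1
  rw [pathInt_inv_of_onRight hR0 hR h2] at e1
  have : (Real.pi : ℂ) * I = 0 := by linear_combination (-1 / 2 : ℂ) * e1
  exact mul_ne_zero (by exact_mod_cast Real.pi_ne_zero) I_ne_zero this

end Contour

/-! ### Chains with prescribed residues -/

theorem IsChain.eq_of_residues {Λ Λ' : (ℂ → ℂ) → ℂ} {K K' : Set ℂ} {bd bd' : (ℂ → ℂ) → ℂ}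
    (h : IsChain Λ K bd) (h' : IsChain Λ' K' bd') (hbd : ∀ F, bd F = bd' F) {M : ℝ}
    (hK : K ⊆ Metric.ball 0 M) (hK' : K' ⊆ Metric.ball 0 M) (S : Finset ℂ)
    (hS : ∀ p ∈ S, p ∉ K) (hS' : ∀ p ∈ S, p ∉ K')
    (hres : ∀ p ∈ S, Λ (fun z => (z - p)⁻¹) = Λ' (fun z => (z - p)⁻¹)) {f : ℂ → ℂ}
    (hd : DifferentiableOn ℂ f (Metric.ball 0 M \ S)) (hm : ∀ p ∈ S, MeromorphicAt f p) :
    Λ f = Λ' f := by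
  refine sub_eq_zero.1 ((h.sub_chain h').eq_zero (fun F => sub_eq_zero.2 (hbd F))
    (union_subset hK hK') S (fun p hp => ?_) (fun p hp => sub_eq_zero.2 (hres p hp)) f hd hm)
  rintro (hc | hc)
  exacts [hS p hp hc, hS' p hp hc]

theorem pathInt_circleMap (p : ℂ) (ε : ℝ) (f : ℂ → ℂ) :
    pathInt (circleMap p ε) 0 (2 * Real.pi) f = ∮ z in C(p, ε), f z := by
  rw [pathInt, circleIntegral]
  simp_rw [smul_eq_mul, mul_comm]

/-- The curves for different a meet only at heights ±R, so each point of S forbids just one value, a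
= Re p / (R² - (Im p)²). -/
theorem exists_parabola_avoiding {R : ℝ} (S : Finset ℂ) (hS : ∀ p ∈ S, |p.im| < R) :
    ∃ a : ℝ, 0 ≤ a ∧ a ≤ 1 ∧ ∀ s : ℝ, ((a * (R ^ 2 - s ^ 2) : ℝ) : ℂ) + s * I ∉ S := by
  have hinf : (Icc (0 : ℝ) 1).Infinite := Icc_infinite one_pos
  obtain ⟨a, ha, hnot⟩ := hinf.exists_notMem_finset (S.image fun p => p.re / (R ^ 2 - p.im ^ 2))
  refine ⟨a, ha.1, ha.2, fun s hs => hnot (Finset.mem_image.2 ⟨_, hs, ?_⟩)⟩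
  have h1 := hS _ hs
  have him : (((a * (R ^ 2 - s ^ 2) : ℝ) : ℂ) + s * I).im = s := by
    rw [add_im, ofReal_im, im_ofReal_mul, I_im, mul_one, zero_add]
  have hre : (((a * (R ^ 2 - s ^ 2) : ℝ) : ℂ) + s * I).re = a * (R ^ 2 - s ^ 2) := by
    rw [add_re, ofReal_re, re_ofReal_mul, I_re, mul_zero, add_zero]
  rw [him] at h1
  rw [him, hre]
  have : 0 < R ^ 2 - s ^ 2 := by
    have := sq_lt_sq' (by linarith [(abs_lt.1 h1).1]) (abs_lt.1 h1).2
    linarith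
  exact mul_div_cancel_right₀ _ this.ne'

theorem exists_radius_avoiding (S : Finset ℂ) {U : Set ℂ} (hU : IsOpen U) (hSU : ∀ p ∈ S, p ∈ U) :
    ∃ ε : ℝ, 0 < ε ∧ ∀ p ∈ S, Metric.closedBall p ε ⊆ U ∧ ∀ q ∈ S, q ≠ p → ε < dist q p := by
  have h : ∀ᶠ ε : ℝ in 𝓝[>] 0, ∀ p ∈ S, Metric.closedBall p ε ⊆ U ∧
      ∀ q ∈ S, q ≠ p → ε < dist q p := by
    rw [Filter.eventually_all_finset]
    intro p hp
    refine Filter.Eventually.and ?_ ?_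
    · obtain ⟨r, hr, hb⟩ := Metric.isOpen_iff.1 hU p (hSU p hp)
      filter_upwards [mem_nhdsWithin_of_mem_nhds (Iio_mem_nhds hr)] with ε hε
      exact (Metric.closedBall_subset_ball hε).trans hb
    · rw [Filter.eventually_all_finset]
      intro q _
      by_cases hq : q = p
      · exact Eventually.of_forall fun ε h => absurd hq h
      · filter_upwards [mem_nhdsWithin_of_mem_nhds (Iio_mem_nhds (dist_pos.2 hq))] with ε hε _
        exact hε
  obtain ⟨ε, h1, h2⟩ := (h.and self_mem_nhdsWithin).exists
  exact ⟨ε, h2, h1⟩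

/-- A chain from `-R i` to `R i` that avoids a finite set of points and has prescribed integrals of
`1 / (z - p)` for these points. -/
theorem exists_chain_of_residues {R M : ℝ} (hR : 0 < R) (hM : R + R ^ 2 < M) (S : Finset ℂ)
    (hS : ∀ p ∈ S, |p.im| < R) (hSM : ∀ p ∈ S, p ∈ Metric.ball (0 : ℂ) M) (w : ℂ → ℂ) :
    ∃ (Λ : (ℂ → ℂ) → ℂ) (K : Set ℂ),
      IsChain Λ K (fun F => F ((R : ℂ) * I) - F (((-R : ℝ) : ℂ) * I)) ∧ K ⊆ Metric.ball 0 M ∧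
      (∀ p ∈ S, p ∉ K) ∧ ∀ p ∈ S, Λ (fun z => (z - p)⁻¹) = w p := by
  obtain ⟨a, ha0, ha1, ha⟩ := exists_parabola_avoiding S hS
  obtain ⟨ε, hε, hball⟩ := exists_radius_avoiding S (Metric.isOpen_ball (x := (0 : ℂ)) (ε := M)) hSM
  set c : ℝ → ℂ := fun s => ((a * (R ^ 2 - s ^ 2) : ℝ) : ℂ) + s * I with hc
  have hcd : ContDiff ℝ 1 c :=
    (ofRealCLM.contDiff.comp (by fun_prop : ContDiff ℝ 1 fun s : ℝ => a * (R ^ 2 - s ^ 2))).add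
      (ofRealCLM.contDiff.mul contDiff_const)
  have hab : -R ≤ R := by linarith
  -- The weight of a small circle around p that corrects the integral of 1/(z - p) to its prescribed
  -- value. The circle does not affect the other points of S, and since chains are mere functionals
  -- the weight may be any complex number.
  set n : ℂ → ℂ := fun p => (w p - pathInt c (-R) R fun z => (z - p)⁻¹) / (2 * Real.pi * I) with hn
  have h1 := (IsChain.path hcd hab).add_chain (IsChain.sum_chain S fun p _ =>
    (IsChain.path (contDiff_circleMap p ε) Real.two_pi_pos.le).smul_chain (n p))
  have hbd : (fun F : ℂ → ℂ => F (c R) - F (c (-R)) + ∑ p ∈ S, n p *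
      (F (circleMap p ε (2 * Real.pi)) - F (circleMap p ε 0))) =
      fun F => F ((R : ℂ) * I) - F (((-R : ℝ) : ℂ) * I) := by
    funext F
    have e1 : c R = R * I := by simp [hc]
    have e2 : c (-R) = ((-R : ℝ) : ℂ) * I := by simp [hc]
    rw [e1, e2, Finset.sum_eq_zero, add_zero]
    intro p _
    have : circleMap p ε (2 * Real.pi) = circleMap p ε 0 := by
      simpa using periodic_circleMap p ε 0
    rw [this, sub_self, mul_zero]
  rw [hbd] at h1
  have hcirc : ∀ (p : ℂ) (x : ℝ), dist (circleMap p ε x) p = ε := fun p x => by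
    rw [← Metric.mem_sphere]
    exact circleMap_mem_sphere p hε.le x
  refine ⟨_, _, h1, ?_, ?_, ?_⟩
  · refine union_subset ?_ (iUnion₂_subset fun p hp => ?_)
    · rintro _ ⟨s, hs, rfl⟩
      rw [mem_ball_zero_iff]
      refine lt_of_le_of_lt ?_ hM
      have hs2 : s ^ 2 ≤ R ^ 2 := sq_le_sq' hs.1 hs.2
      have hs1 : |s| ≤ R := abs_le.2 hs
      refine (norm_add_le _ _).trans ?_
      rw [norm_mul, norm_I, mul_one, norm_real, norm_real, Real.norm_eq_abs, Real.norm_eq_abs,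
        abs_of_nonneg (mul_nonneg ha0 (sub_nonneg.2 hs2)), add_comm]
      have : a * (R ^ 2 - s ^ 2) ≤ R ^ 2 := by nlinarith [sq_nonneg s]
      linarith
    · rintro _ ⟨x, -, rfl⟩
      exact (hball p hp).1 (Metric.mem_closedBall.2 (hcirc p x).le)
  · rintro q hq (⟨s, -, hs⟩ | h)
    · rw [← hs] at hq
      exact ha s hq
    · obtain ⟨p, hp, x, -, hx⟩ := mem_iUnion₂.1 h
      have hd := hcirc p x
      rw [hx] at hd
      rcases eq_or_ne q p with rfl | hqp
      · rw [dist_self] at hd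
        exact hε.ne hd
      · exact ((hball p hp).2 q hq hqp).ne' hd
  · intro q hq
    have hsum : ∑ p ∈ S, n p * pathInt (circleMap p ε) 0 (2 * Real.pi) (fun z => (z - q)⁻¹) =
        n q * (2 * Real.pi * I) := by
      rw [Finset.sum_eq_single_of_mem q hq]
      · rw [pathInt_circleMap, circleIntegral.integral_sub_inv_of_mem_ball (Metric.mem_ball_self hε)]
      · intro p hp hpq
        rw [pathInt_circleMap, DiffContOnCl.circleIntegral_eq_zero hε.le, mul_zero]
        refine DifferentiableOn.diffContOnCl (fun z hz => ?_)
        rw [closure_ball _ hε.ne'] at hz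
        have hne : z - q ≠ 0 := by
          rw [sub_ne_zero]
          rintro rfl
          exact absurd (Metric.mem_closedBall.1 hz) (not_le.2 ((hball p hp).2 z hq hpq.symm))
        exact (((differentiableAt_id).sub_const q).inv hne).differentiableWithinAt
    change _ + ∑ p ∈ S, n p * pathInt (circleMap p ε) 0 (2 * Real.pi) (fun z => (z - q)⁻¹) = _
    rw [hsum, hn]
    simp only
    rw [div_mul_cancel₀ _ two_pi_I_ne_zero]
    ring

/-! ### Translation of a contour by 1 -/

theorem contDiff_add_const_mul_I (y : ℝ) : ContDiff ℝ 1 fun t : ℝ => (t : ℂ) + y * I :=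
  ofRealCLM.contDiff.add contDiff_const

theorem deriv_add_const_mul_I (y t : ℝ) : deriv (fun t : ℝ => (t : ℂ) + y * I) t = 1 := by
  have := (hasDerivAt_id t).ofReal_comp.add_const ((y : ℂ) * I)
  simpa using this.deriv

theorem pathInt_horizontal (y : ℝ) (f : ℂ → ℂ) :
    pathInt (fun t : ℝ => (t : ℂ) + y * I) 0 1 f = ∫ t in (0 : ℝ)..1, f (t + y * I) := by
  rw [pathInt]
  simp_rw [deriv_add_const_mul_I, mul_one]

/-- For real t the point p - t stays within |Im| < R, away from the cuts, and the derivative of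
-`windLog R (p - t)` in t is the difference of the two integrands. Thus the horizontal segments
exactly compensate the translation of p. -/
theorem windLog_shift {R : ℝ} {p : ℂ} (hp : |p.im| < R) :
    pathInt (fun t : ℝ => (t : ℂ) + ((-R : ℝ) : ℂ) * I) 0 1 (fun z => (z - p)⁻¹)
      - pathInt (fun t : ℝ => (t : ℂ) + (R : ℂ) * I) 0 1 (fun z => (z - p)⁻¹) + windLog R (p - 1) =
      windLog R p := by
  obtain ⟨hp1, hp2⟩ := abs_lt.1 hp
  have hne : ∀ (y : ℝ), y ≠ p.im → ∀ t : ℝ, (t : ℂ) + y * I - p ≠ 0 := by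
    intro y hy t h
    have := congrArg im h
    simp at this
    exact hy (by linarith)
  have hint : ∀ y : ℝ, y ≠ p.im → IntervalIntegrable (fun t : ℝ => ((t : ℂ) + y * I - p)⁻¹)
      volume 0 1 := by
    intro y hy
    refine Continuous.intervalIntegrable ?_ _ _
    exact Continuous.inv₀ (by fun_prop) (hne y hy)
  rw [pathInt_horizontal, pathInt_horizontal,
    ← intervalIntegral.integral_sub (hint (-R) hp1.ne) (hint R hp2.ne')]
  have key : ∀ t : ℝ, HasDerivAt (fun t : ℝ => -windLog R (p - t))
      (((t : ℂ) + ((-R : ℝ) : ℂ) * I - p)⁻¹ - ((t : ℂ) + (R : ℂ) * I - p)⁻¹) t := by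
    intro t
    have h0 : HasDerivAt (fun t : ℝ => p - (t : ℂ)) (-1) t := by
      simpa using (hasDerivAt_id t).ofReal_comp.const_sub p
    have s1 : (R + I * (p - t) : ℂ) ∈ slitPlane := by
      left; simp; linarith
    have s2 : (R - I * (p - t) : ℂ) ∈ slitPlane := by
      left; simp; linarith
    have h2 := ((hasDerivAt_windLog s1 s2).scomp t h0).neg
    refine h2.congr_deriv ?_
    have e1 : (R : ℂ) + I * (p - t) = -I * (t + (R : ℂ) * I - p) := by
      linear_combination (R : ℂ) * I_sq
    have e2 : (R : ℂ) - I * (p - t) = I * (t + ((-R : ℝ) : ℂ) * I - p) := by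
      push_cast
      linear_combination (R : ℂ) * I_sq
    rw [e1, e2, div_mul_cancel_left₀ I_ne_zero, neg_mul, div_neg, div_mul_cancel_left₀ I_ne_zero,
      smul_eq_mul]
    ring
  rw [intervalIntegral.integral_eq_sub_of_hasDerivAt (fun t _ => key t)
    ((hint (-R) hp1.ne).sub (hint R hp2.ne'))]
  simp

/-- `f` is holomorphic outside a set `P` of poles, which lie on the sides of `C` that are encoded by
`σ`. -/
structure Contour.Adapted (C : Contour) (f : ℂ → ℂ) (P : Set ℂ) (σ : ℂ → ℂ) : Prop where
  side : ∀ p ∈ P, (C.OnLeft p ∧ σ p = Real.pi * I) ∨ (C.OnRight p ∧ σ p = -(Real.pi * I))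
  diff : ∀ z, z ∉ P → DifferentiableAt ℂ f z
  mero : ∀ z, MeromorphicAt f z
  finite : ∀ M : ℝ, (P ∩ Metric.ball 0 M).Finite
  im_bdd : ∃ Y : ℝ, ∀ p ∈ P, |p.im| ≤ Y

namespace Contour.Adapted

variable {C : Contour} {f : ℂ → ℂ} {P : Set ℂ} {σ : ℂ → ℂ}

theorem notMem_range (h : C.Adapted f P σ) {p : ℂ} (hp : p ∈ P) : p ∉ range C.path := by
  rcases h.side p hp with ⟨h1, -⟩ | ⟨h1, -⟩
  exacts [h1.notMem_range, h1.notMem_range]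

theorem pathInt_inv (h : C.Adapted f P σ) {R : ℝ} (hR0 : 0 < R)
    (hR : ∀ s : ℝ, R ≤ |s| → C.path s = s * I) {p : ℂ} (hp : p ∈ P) :
    pathInt C.path (-R) R (fun z => (z - p)⁻¹) = windLog R p + σ p := by
  rcases h.side p hp with ⟨h1, h2⟩ | ⟨h1, h2⟩
  · rw [pathInt_inv_of_onLeft hR0 hR h1, h2]
  · rw [pathInt_inv_of_onRight hR0 hR h1, h2, sub_eq_add_neg]

end Contour.Adapted

/-! ### Relations between contour integrals -/

namespace Contour.Adapted

variable {C : Contour} {f : ℂ → ℂ} {P : Set ℂ} {σ : ℂ → ℂ}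

/-- The truncated contour may be replaced by any chain with the same endpoints and the same
integrals of 1/(z - p) at the poles in a large disc. -/
theorem pathInt_eq (h : C.Adapted f P σ) {R M : ℝ} (hR0 : 0 < R)
    (hR : ∀ s : ℝ, R ≤ |s| → C.path s = s * I) (hM : C.path '' Icc (-R) R ⊆ Metric.ball 0 M)
    {Λ : (ℂ → ℂ) → ℂ} {K : Set ℂ}
    (hΛ : IsChain Λ K (fun F => F ((R : ℂ) * I) - F (((-R : ℝ) : ℂ) * I)))
    (hK : K ⊆ Metric.ball 0 M) (hKP : ∀ p ∈ P ∩ Metric.ball 0 M, p ∉ K)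
    (hres : ∀ p ∈ P ∩ Metric.ball 0 M, Λ (fun z => (z - p)⁻¹) = windLog R p + σ p) :
    pathInt C.path (-R) R f = Λ f := by
  have hab : -R ≤ R := by linarith
  have hS : ∀ p, p ∈ (h.finite M).toFinset ↔ p ∈ P ∩ Metric.ball 0 M := fun p =>
    (h.finite M).mem_toFinset
  refine (IsChain.path C.contDiff hab).eq_of_residues hΛ (fun F => ?_) hM hK (h.finite M).toFinset
    (fun p hp => ?_) (fun p hp => hKP p ((hS p).1 hp)) (fun p hp => ?_) (fun z hz => ?_)
    fun p _ => h.mero p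
  · rw [hR R (le_abs_self R), hR (-R) (by rw [abs_neg]; exact le_abs_self R)]
  · rintro ⟨s, -, rfl⟩
    exact h.notMem_range ((hS _).1 hp).1 (mem_range_self s)
  · rw [h.pathInt_inv hR0 hR ((hS p).1 hp).1, hres p ((hS p).1 hp)]
  · refine (h.diff z fun hzP => hz.2 ?_).differentiableWithinAt
    exact (hS z).2 ⟨hzP, hz.1⟩

/-- The chain runs from -Ri to 1 - Ri, along the contour translated by 1, and back from 1 + Ri to
Ri, so it has the endpoints of Λ. A pole p of f(z - 1) lies with respect to the translated contour
as p - 1 does with respect to the original one, hence the argument p + 1 of σ in the hypothesis. -/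
theorem pathInt_shift_eq (h : C.Adapted f P (fun p => σ (p + 1))) {R M : ℝ} (hR0 : 0 < R)
    (hR : ∀ s : ℝ, R ≤ |s| → C.path s = s * I)
    (hM : (fun s => C.path s + 1) '' Icc (-R) R ⊆ Metric.ball 0 M) (hRM : 1 + R < M)
    (hY : ∀ p ∈ P, |p.im| < R) {Λ : (ℂ → ℂ) → ℂ} {K : Set ℂ}
    (hΛ : IsChain Λ K (fun F => F ((R : ℂ) * I) - F (((-R : ℝ) : ℂ) * I)))
    (hK : K ⊆ Metric.ball 0 M) (hKP : ∀ p, p - 1 ∈ P → p ∈ Metric.ball 0 M → p ∉ K)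
    (hres : ∀ p, p - 1 ∈ P → p ∈ Metric.ball 0 M →
      Λ (fun z => (z - p)⁻¹) = windLog R p + σ p) :
    (∫ t in (0 : ℝ)..1, f (t + ((-R : ℝ) : ℂ) * I - 1)) + pathInt C.path (-R) R f
      - (∫ t in (0 : ℝ)..1, f (t + (R : ℂ) * I - 1)) = Λ (fun z => f (z - 1)) := by
  have hab : -R ≤ R := by linarith
  have hshift : ∀ f : ℂ → ℂ, pathInt (fun s => C.path s + 1) (-R) R f =
      pathInt C.path (-R) R fun z => f (z + 1) := by
    intro f
    rw [pathInt, pathInt]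
    simp_rw [deriv_add_const]
  have hc : ContDiff ℝ 1 fun s => C.path s + 1 := C.contDiff.add contDiff_const
  have hchain := ((IsChain.path (contDiff_add_const_mul_I (-R)) zero_le_one).add_chain
    (IsChain.path hc hab)).sub_chain (IsChain.path (contDiff_add_const_mul_I R) zero_le_one)
  have hfin : {p | p - 1 ∈ P ∧ p ∈ Metric.ball (0 : ℂ) M}.Finite := by
    refine ((h.finite (M + 1)).image fun p => p + 1).subset ?_
    rintro p ⟨h1, h2⟩
    refine ⟨p - 1, ⟨h1, ?_⟩, sub_add_cancel p 1⟩
    rw [mem_ball_zero_iff] at h2 ⊢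
    have := norm_sub_le p 1
    rw [norm_one] at this
    linarith
  have hS : ∀ p, p ∈ hfin.toFinset ↔ p - 1 ∈ P ∧ p ∈ Metric.ball (0 : ℂ) M := fun p =>
    hfin.mem_toFinset
  have hline : ∀ y : ℝ, |y| = R →
      (fun t : ℝ => (t : ℂ) + y * I) '' Icc 0 1 ⊆ Metric.ball 0 M := by
    rintro y hy _ ⟨t, ht, rfl⟩
    rw [mem_ball_zero_iff]
    refine lt_of_le_of_lt (norm_add_le _ _) ?_
    rw [norm_mul, norm_I, mul_one, norm_real, norm_real, Real.norm_eq_abs, Real.norm_eq_abs, hy,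
      abs_of_nonneg ht.1]
    linarith [ht.2]
  have hlineP : ∀ y : ℝ, |y| = R → ∀ p, p - 1 ∈ P →
      p ∉ (fun t : ℝ => (t : ℂ) + y * I) '' Icc 0 1 := by
    rintro y hy _ hp ⟨t, -, rfl⟩
    have := hY _ hp
    rw [sub_im, add_im, ofReal_im, im_ofReal_mul, I_im, one_im] at this
    simp only [mul_one, zero_add, sub_zero] at this
    exact this.ne hy
  have aR : |R| = R := abs_of_pos hR0
  have aR' : |-R| = R := by rw [abs_neg, aR]
  have key := hchain.eq_of_residues hΛ (fun F => ?_)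
    (union_subset (union_subset (hline (-R) aR') hM) (hline R aR)) hK hfin.toFinset
    (fun p hp => ?_) (fun p hp => hKP p ((hS p).1 hp).1 ((hS p).1 hp).2) (fun p hp => ?_)
    (f := fun z => f (z - 1)) (fun z hz => ?_) fun p _ => ?_
  · rw [← key, hshift, pathInt_horizontal, pathInt_horizontal]
    simp only [add_sub_cancel_right]
  · rw [hR R (le_abs_self R), hR (-R) (by rw [abs_neg]; exact le_abs_self R)]
    simp only [ofReal_one, ofReal_zero, zero_add]
    rw [add_comm (1 : ℂ), add_comm (1 : ℂ)]
    ring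
  · obtain ⟨h1, -⟩ := (hS p).1 hp
    rintro ((hc | ⟨s, -, hs⟩) | hc)
    · exact hlineP (-R) aR' p h1 hc
    · refine h.notMem_range h1 ⟨s, ?_⟩
      rw [← hs, add_sub_cancel_right]
    · exact hlineP R aR p h1 hc
  · obtain ⟨h1, h2⟩ := (hS p).1 hp
    have hi := h.pathInt_inv hR0 hR h1
    rw [sub_add_cancel] at hi
    have hw := windLog_shift (R := R) (p := p) (by simpa using hY _ h1)
    have e : pathInt (fun s => C.path s + 1) (-R) R (fun z => (z - p)⁻¹) =
        pathInt C.path (-R) R fun z => (z - (p - 1))⁻¹ := by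
      rw [hshift]
      simp_rw [sub_sub_eq_add_sub]
    rw [hres p h1 h2, e, hi]
    linear_combination hw
  · have hz' : z - 1 ∉ P := fun hzP => hz.2 ((hS z).2 ⟨hzP, hz.1⟩)
    have := h.diff _ hz'
    exact (this.comp z (f := fun z => z - 1) (by fun_prop)).differentiableWithinAt
  · exact MeromorphicAt.comp_analyticAt (g := fun z => z - 1) (h.mero _) (by fun_prop)

end Contour.Adapted

/-- `f` decays in vertical strips. -/
def VerticalDecay (f : ℂ → ℂ) : Prop :=
  ∀ M : ℝ, ∃ K Y : ℝ, ∀ z : ℂ, |z.re| ≤ M → Y ≤ |z.im| → ‖f z‖ ≤ K * (1 + z.im ^ 2)⁻¹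

theorem Contour.deriv_path_eq (C : Contour) {R : ℝ} (hR : ∀ s : ℝ, R ≤ |s| → C.path s = s * I)
    {s : ℝ} (hs : R < |s|) : deriv C.path s = I := by
  have h1 : C.path =ᶠ[𝓝 s] fun s => (s : ℂ) * I := by
    filter_upwards [(isOpen_lt continuous_const continuous_abs).mem_nhds hs] with u hu
    exact hR u (le_of_lt hu)
  rw [h1.deriv_eq]
  have := (hasDerivAt_id s).ofReal_comp.mul_const I
  simpa using this.deriv

namespace Contour.Adapted

variable {C : Contour} {f : ℂ → ℂ} {P : Set ℂ} {σ : ℂ → ℂ}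

theorem converges (h : C.Adapted f P σ) (hf : VerticalDecay f) : C.Converges f := by
  obtain ⟨R, hR0, hR⟩ := C.exists_pos_eq_axis
  obtain ⟨K, Y, H⟩ := hf 0
  have hcont : Continuous fun s => f (C.path s) * deriv C.path s := by
    refine Continuous.mul ?_ (C.contDiff.continuous_deriv le_rfl)
    refine continuous_iff_continuousAt.2 fun s => ?_
    have h1 : C.path s ∉ P := fun hp => h.notMem_range hp (mem_range_self s)
    exact ContinuousAt.comp (h.diff _ h1).continuousAt C.contDiff.continuous.continuousAt
  set T := max R Y + 1 with hT
  obtain ⟨B, hB⟩ := (isCompact_Icc (a := -T) (b := T)).exists_bound_of_continuousOn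
    hcont.continuousOn
  refine (integrable_inv_one_add_sq.const_mul (|B| * (1 + T ^ 2) + |K|)).mono'
    hcont.aestronglyMeasurable (Eventually.of_forall fun s => ?_)
  rcases le_or_gt |s| T with hs | hs
  · refine (hB s (abs_le.1 hs)).trans ((le_abs_self B).trans ?_)
    rw [← div_eq_mul_inv, le_div_iff₀ (by positivity)]
    have : s ^ 2 ≤ T ^ 2 := sq_le_sq' (abs_le.1 hs).1 (abs_le.1 hs).2
    nlinarith [abs_nonneg B, abs_nonneg K]
  · have h1 : R < |s| := by linarith [le_max_left R Y]
    have h2 : Y ≤ |s| := by linarith [le_max_right R Y]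
    rw [C.deriv_path_eq hR h1, hR s h1.le, norm_mul, norm_I, mul_one]
    refine (H _ (by simp) (by simpa using h2)).trans ?_
    rw [im_ofReal_mul, I_im, mul_one]
    have : K ≤ |B| * (1 + T ^ 2) + |K| := by
      have : 0 ≤ |B| * (1 + T ^ 2) := by positivity
      linarith [le_abs_self K]
    gcongr

theorem tendsto_pathInt (h : C.Adapted f P σ) (hf : VerticalDecay f) :
    Tendsto (fun R : ℝ => pathInt C.path (-R) R f) atTop (𝓝 (C.integral f)) :=
  intervalIntegral_tendsto_integral (h.converges hf) tendsto_neg_atTop_atBot tendsto_id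

end Contour.Adapted

theorem VerticalDecay.tendsto_integral {f : ℂ → ℂ} (hf : VerticalDecay f) {y : ℝ → ℝ}
    (hy : Tendsto (fun R => |y R|) atTop atTop) :
    Tendsto (fun R : ℝ => ∫ t in (0 : ℝ)..1, f (t + (y R : ℂ) * I - 1)) atTop (𝓝 0) := by
  obtain ⟨K, Y, H⟩ := hf 1
  have hlim : Tendsto (fun R : ℝ => K * (1 + y R ^ 2)⁻¹ * |(1 : ℝ) - 0|) atTop (𝓝 0) := by
    have h1 : Tendsto (fun R => 1 + y R ^ 2) atTop atTop := by
      refine tendsto_atTop_add_const_left _ _ ?_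
      refine ((tendsto_pow_atTop two_ne_zero).comp hy).congr fun R => ?_
      exact sq_abs _
    simpa using (h1.inv_tendsto_atTop.const_mul K).mul_const |(1 : ℝ) - 0|
  refine squeeze_zero_norm' ?_ hlim
  filter_upwards [hy.eventually_ge_atTop Y] with R hR
  refine intervalIntegral.norm_integral_le_of_norm_le_const fun t ht => ?_
  rw [uIoc_of_le zero_le_one] at ht
  have him : ((t : ℂ) + (y R : ℂ) * I - 1).im = y R := by simp
  have hre : ((t : ℂ) + (y R : ℂ) * I - 1).re = t - 1 := by simp
  have := H (t + (y R : ℂ) * I - 1) (by rw [hre, abs_le]; constructor <;> linarith [ht.1, ht.2])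
    (by rwa [him])
  rwa [him] at this

/-- A linear relation between three integrands, the third of which is shifted by `1`, holds for the
integrals along contours that separate the poles in compatible ways. -/
theorem Contour.integral_relation {C₁ C₂ C₃ : Contour} {f₁ f₂ f₃ : ℂ → ℂ} {P₁ P₂ P₃ : Set ℂ}
    {σ : ℂ → ℂ} (h₁ : C₁.Adapted f₁ P₁ σ) (h₂ : C₂.Adapted f₂ P₂ σ)
    (h₃ : C₃.Adapted f₃ P₃ (fun p => σ (p + 1))) (d₁ : VerticalDecay f₁) (d₂ : VerticalDecay f₂)
    (d₃ : VerticalDecay f₃) {E : Set ℂ} (hE : E.Countable) {k₁ k₂ k₃ : ℂ}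
    (hrel : ∀ z, z ∉ E → k₁ * f₁ z + k₂ * f₂ z = k₃ * f₃ (z - 1)) :
    k₁ * C₁.integral f₁ + k₂ * C₂.integral f₂ = k₃ * C₃.integral f₃ := by
  obtain ⟨Y₁, hY₁⟩ := h₁.im_bdd
  obtain ⟨Y₂, hY₂⟩ := h₂.im_bdd
  obtain ⟨Y₃, hY₃⟩ := h₃.im_bdd
  obtain ⟨R₁, -, hR₁⟩ := C₁.exists_pos_eq_axis
  obtain ⟨R₂, -, hR₂⟩ := C₂.exists_pos_eq_axis
  obtain ⟨R₃, -, hR₃⟩ := C₃.exists_pos_eq_axis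
  have hlim : Tendsto (fun R : ℝ => k₁ * pathInt C₁.path (-R) R f₁ + k₂ * pathInt C₂.path (-R) R f₂)
      atTop (𝓝 (k₁ * C₁.integral f₁ + k₂ * C₂.integral f₂)) :=
    ((h₁.tendsto_pathInt d₁).const_mul k₁).add ((h₂.tendsto_pathInt d₂).const_mul k₂)
  have hlim3 : Tendsto (fun R : ℝ => k₃ * ((∫ t in (0 : ℝ)..1, f₃ (t + ((-R : ℝ) : ℂ) * I - 1)) +
      pathInt C₃.path (-R) R f₃ - (∫ t in (0 : ℝ)..1, f₃ (t + (R : ℂ) * I - 1))))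
      atTop (𝓝 (k₃ * C₃.integral f₃)) := by
    have a1 := d₃.tendsto_integral (y := fun R => -R) (by simpa using tendsto_abs_atTop_atTop)
    have a2 := d₃.tendsto_integral (y := fun R => R) tendsto_abs_atTop_atTop
    simpa using ((a1.add (h₃.tendsto_pathInt d₃)).sub a2).const_mul k₃
  -- With the horizontal segments included, the relation is exact for every large R.
  refine tendsto_nhds_unique_of_eventuallyEq hlim hlim3 ?_
  filter_upwards [eventually_gt_atTop 0, eventually_gt_atTop Y₁, eventually_gt_atTop Y₂,
    eventually_gt_atTop Y₃, eventually_ge_atTop R₁, eventually_ge_atTop R₂, eventually_ge_atTop R₃]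
    with R hR0 g₁ g₂ g₃ g₄ g₅ g₆
  have hc₃ : ContDiff ℝ 1 fun s => C₃.path s + 1 := C₃.contDiff.add contDiff_const
  have hcpt : ∀ c : ℝ → ℂ, ContDiff ℝ 1 c → ∃ M : ℝ, c '' Icc (-R) R ⊆ Metric.ball 0 M := by
    intro c hc
    obtain ⟨M, hM⟩ := (isCompact_Icc.image hc.continuous).isBounded.subset_ball (0 : ℂ)
    exact ⟨M, hM⟩
  obtain ⟨M₁, hM₁⟩ := hcpt _ C₁.contDiff
  obtain ⟨M₂, hM₂⟩ := hcpt _ C₂.contDiff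
  obtain ⟨M₃, hM₃⟩ := hcpt _ hc₃
  -- The disc has to contain the three paths, the segments (norm at most 1 + R) and the parabola
  -- (norm at most R + R²).
  obtain ⟨M, hM⟩ := exists_gt (max (max M₁ M₂) (max M₃ (1 + R + R ^ 2)))
  rw [max_lt_iff, max_lt_iff, max_lt_iff] at hM
  obtain ⟨⟨m₁, m₂⟩, m₃, m₄⟩ := hM
  have hsub : ∀ {M'}, M' < M → Metric.ball (0 : ℂ) M' ⊆ Metric.ball 0 M := fun h =>
    Metric.ball_subset_ball h.le
  have hfin : ((P₁ ∪ P₂ ∪ {p | p - 1 ∈ P₃}) ∩ Metric.ball 0 M).Finite := by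
    rw [union_inter_distrib_right, union_inter_distrib_right]
    refine ((h₁.finite M).union (h₂.finite M)).union ?_
    refine ((h₃.finite (M + 1)).image fun p => p + 1).subset ?_
    rintro p ⟨e1, e2⟩
    refine ⟨p - 1, ⟨e1, ?_⟩, sub_add_cancel p 1⟩
    rw [mem_ball_zero_iff] at e2 ⊢
    have := norm_sub_le p 1
    rw [norm_one] at this
    linarith
  have hS : ∀ p, p ∈ hfin.toFinset ↔ p ∈ (P₁ ∪ P₂ ∪ {p | p - 1 ∈ P₃}) ∩ Metric.ball 0 M := fun p =>
    hfin.mem_toFinset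
  have hbd : ∀ R' : ℝ, R' ≤ R → ∀ s : ℝ, R ≤ |s| → R' ≤ |s| := fun R' h s hs => h.trans hs
  have hSR : ∀ p ∈ hfin.toFinset, |p.im| < R := by
    intro p hp
    rcases ((hS p).1 hp).1 with (h | h) | h
    · exact lt_of_le_of_lt (hY₁ p h) g₁
    · exact lt_of_le_of_lt (hY₂ p h) g₂
    · have := hY₃ _ h
      rw [sub_im, one_im, sub_zero] at this
      exact lt_of_le_of_lt this g₃
  -- One chain stands for all three contours at once, because the sides of all the poles are encoded
  -- by the same σ.
  obtain ⟨Λ, K, hΛ, hK, hSK, hres⟩ := exists_chain_of_residues (M := M) hR0 (by linarith)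
    hfin.toFinset hSR (fun p hp => ((hS p).1 hp).2) (fun p => windLog R p + σ p)
  have e₁ := h₁.pathInt_eq hR0 (fun s hs => hR₁ s (hbd R₁ g₄ s hs)) (hM₁.trans (hsub m₁)) hΛ hK
    (fun p hp => hSK p ((hS p).2 ⟨Or.inl (Or.inl hp.1), hp.2⟩))
    (fun p hp => hres p ((hS p).2 ⟨Or.inl (Or.inl hp.1), hp.2⟩))
  have e₂ := h₂.pathInt_eq hR0 (fun s hs => hR₂ s (hbd R₂ g₅ s hs)) (hM₂.trans (hsub m₂)) hΛ hK
    (fun p hp => hSK p ((hS p).2 ⟨Or.inl (Or.inr hp.1), hp.2⟩))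
    (fun p hp => hres p ((hS p).2 ⟨Or.inl (Or.inr hp.1), hp.2⟩))
  have e₃ := h₃.pathInt_shift_eq hR0 (fun s hs => hR₃ s (hbd R₃ g₆ s hs)) (hM₃.trans (hsub m₃))
    (by nlinarith [sq_nonneg R]) (fun p hp => lt_of_le_of_lt (hY₃ p hp) g₃) hΛ hK
    (fun p hp hb => hSK p ((hS p).2 ⟨Or.inr hp, hb⟩))
    (fun p hp hb => hres p ((hS p).2 ⟨Or.inr hp, hb⟩))
  rw [e₁, e₂, e₃, ← hΛ.smul, ← hΛ.smul, ← hΛ.smul]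
  have ho : IsOpen (Metric.ball (0 : ℂ) M \ hfin.toFinset) :=
    Metric.isOpen_ball.sdiff (Finset.finite_toSet _).isClosed
  have hKo : K ⊆ Metric.ball (0 : ℂ) M \ hfin.toFinset := fun z hz =>
    ⟨hK hz, fun hzS => hSK z hzS hz⟩
  have c₁ : ContinuousOn f₁ (Metric.ball (0 : ℂ) M \ hfin.toFinset) := fun z hz =>
    (h₁.diff z fun hp => hz.2 ((hS z).2 ⟨Or.inl (Or.inl hp), hz.1⟩)).continuousAt.continuousWithinAt
  have c₂ : ContinuousOn f₂ (Metric.ball (0 : ℂ) M \ hfin.toFinset) := fun z hz =>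
    (h₂.diff z fun hp => hz.2 ((hS z).2 ⟨Or.inl (Or.inr hp), hz.1⟩)).continuousAt.continuousWithinAt
  have c₃ : ContinuousOn (fun z => f₃ (z - 1)) (Metric.ball (0 : ℂ) M \ hfin.toFinset) := by
    intro z hz
    have := (h₃.diff (z - 1) fun hp => hz.2 ((hS z).2 ⟨Or.inr hp, hz.1⟩)).continuousAt
    exact (ContinuousAt.comp (f := fun z => z - 1) this (by fun_prop)).continuousWithinAt
  have hadd := hΛ.add (fun z => k₁ * f₁ z) (fun z => k₂ * f₂ z)
    (continuousOn_const.mul (c₁.mono hKo)) (continuousOn_const.mul (c₂.mono hKo))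
  rw [← hadd]
  refine hΛ.congr _ _ (EqOn.mono hKo ?_)
  -- The chain sees values at every point of its support, also in E; the identity extends there by
  -- continuity, as the complement of a countable set is dense.
  refine Set.EqOn.of_subset_closure (s := (Metric.ball (0 : ℂ) M \ hfin.toFinset) ∩ Eᶜ)
    (fun z hz => hrel z hz.2) ((continuousOn_const.mul c₁).add (continuousOn_const.mul c₂))
    (continuousOn_const.mul c₃) inter_subset_left ?_
  exact (hE.dense_compl ℝ).open_subset_closure_inter ho

/-! ### Barnes kernels -/

/-- `q^{Xz} ⟨z + c⟩⟨z + d⟩ / (⟨z + a⟩⟨z + b⟩)`. -/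
noncomputable def braKernel (ω : ℝ) (a b c d X z : ℂ) : ℂ :=
  qpow ω (X * z) * (bra ω (z + c) * bra ω (z + d) / (bra ω (z + a) * bra ω (z + b)))

/-- Candidate poles of the kernel that come from its denominator. They belong on the left of the
contour, those of `poleShifts`, from its numerator, on the right. -/
def zeroShifts (ω : ℝ) (a b : ℂ) : Set ℂ := {p | p + a ∈ braZeros ω ∨ p + b ∈ braZeros ω}

def poleShifts (ω : ℝ) (c d : ℂ) : Set ℂ := {p | p + c ∈ braPoles ω ∨ p + d ∈ braPoles ω}

theorem braKernel_eq (ω : ℝ) (a b c d X z : ℂ) : braKernel ω a b c d X z =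
    qpow ω (X * z) * (bra ω (z + c) * bra ω (z + d) * ((bra ω (z + a))⁻¹ * (bra ω (z + b))⁻¹)) := by
  rw [braKernel, div_eq_mul_inv, mul_inv]

theorem differentiable_qpow_mul (ω : ℝ) (X : ℂ) : Differentiable ℂ fun z => qpow ω (X * z) := by
  unfold qpow
  fun_prop

theorem differentiableAt_braKernel {ω : ℝ} (hω : 0 < ω) (a b c d X : ℂ) {z : ℂ}
    (hz : z ∉ zeroShifts ω a b ∪ poleShifts ω c d) :
    DifferentiableAt ℂ (braKernel ω a b c d X) z := by
  simp only [zeroShifts, poleShifts, mem_union, mem_ofPred_eq, not_or] at hz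
  obtain ⟨⟨ha, hb⟩, hc, hd⟩ := hz
  have hp : ∀ {u : ℂ}, z + u ∉ braPoles ω → DifferentiableAt ℂ (fun z => bra ω (z + u)) z :=
    fun {u} h => (differentiableAt_bra hω h).comp z (f := fun z => z + u) (by fun_prop)
  have hi : ∀ {u : ℂ}, z + u ∉ braZeros ω → DifferentiableAt ℂ (fun z => (bra ω (z + u))⁻¹) z :=
    fun {u} h => (differentiableAt_inv_bra hω h).comp z (f := fun z => z + u) (by fun_prop)
  have : braKernel ω a b c d X = _ := funext (braKernel_eq ω a b c d X)
  rw [this]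
  exact (differentiable_qpow_mul ω X z).mul (((hp hc).mul (hp hd)).mul ((hi ha).mul (hi hb)))

theorem meromorphicAt_braKernel {ω : ℝ} (hω : 0 < ω) (a b c d X z : ℂ) :
    MeromorphicAt (braKernel ω a b c d X) z := by
  have h : ∀ u : ℂ, MeromorphicAt (fun z => bra ω (z + u)) z := fun u =>
    MeromorphicAt.comp_analyticAt (g := fun z => z + u) (meromorphicAt_bra hω _) (by fun_prop)
  have hq : MeromorphicAt (fun z => qpow ω (X * z)) z :=
    ((differentiable_qpow_mul ω X).analyticAt z).meromorphicAt
  exact hq.mul (((h c).mul (h d)).div ((h a).mul (h b)))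

/-- Zeros and poles have two indices of equal sign, so the norm bounds both. The full lattice ℤ +
(1/ω)ℤ would not do: it is dense in ℝ for irrational ω. -/
theorem finite_natLattice_inter_ball {ω : ℝ} (hω : 0 < ω) (M : ℝ) :
    {u : ℂ | ∃ m n : ℕ, (u = -(m : ℂ) - n / ω ∨ u = ((m : ℂ) + 1) + ((n : ℂ) + 1) / ω) ∧
      ‖u‖ ≤ M}.Finite := by
  obtain ⟨N, hN⟩ := exists_nat_gt (max M (M * ω))
  rw [max_lt_iff] at hN
  have key : ∀ m n : ℕ, (m : ℝ) + n / ω ≤ M → m < N ∧ n < N := by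
    intro m n h
    have hm : (0 : ℝ) ≤ m := m.cast_nonneg
    have hn : (0 : ℝ) ≤ n / ω := by positivity
    refine ⟨?_, ?_⟩
    · exact_mod_cast (by linarith : (m : ℝ) < N)
    · have : (n : ℝ) ≤ M * ω := (div_le_iff₀ hω).1 (by linarith)
      exact_mod_cast (by linarith : (n : ℝ) < N)
  have hF := ((Finset.range N ×ˢ Finset.range N).finite_toSet)
  refine ((hF.image fun p : ℕ × ℕ => -(p.1 : ℂ) - p.2 / ω).union
    (hF.image fun p : ℕ × ℕ => ((p.1 : ℂ) + 1) + ((p.2 : ℂ) + 1) / ω)).subset ?_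
  rintro u ⟨m, n, h, hM⟩
  have hre := (abs_re_le_norm u).trans hM
  rcases h with rfl | rfl
  · have e : (-(m : ℂ) - n / ω).re = -(m + n / ω : ℝ) := by
      rw [sub_re, neg_re, natCast_re, div_ofReal_re, natCast_re]; ring
    rw [e, abs_neg] at hre
    obtain ⟨h1, h2⟩ := key m n ((le_abs_self _).trans hre)
    exact Or.inl ⟨(m, n), by simp [h1, h2], rfl⟩
  · have e : (((m : ℂ) + 1) + ((n : ℂ) + 1) / ω).re = (m + 1) + (n + 1) / ω := by
      rw [add_re, add_re, natCast_re, one_re, div_ofReal_re, add_re, natCast_re, one_re]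
    rw [e] at hre
    have : (m : ℝ) + n / ω ≤ (m + 1) + (n + 1) / ω := by
      have : (n : ℝ) / ω ≤ (n + 1) / ω := by gcongr; linarith
      linarith
    obtain ⟨h1, h2⟩ := key m n (this.trans ((le_abs_self _).trans hre))
    exact Or.inr ⟨(m, n), by simp [h1, h2], rfl⟩

theorem finite_shifts_inter_ball {ω : ℝ} (hω : 0 < ω) (a b c d : ℂ) (M : ℝ) :
    ((zeroShifts ω a b ∪ poleShifts ω c d) ∩ Metric.ball 0 M).Finite := by
  have hF : ∀ w : ℂ, _ := fun w =>
    (finite_natLattice_inter_ball hω (M + ‖w‖)).image fun u => u - w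
  refine ((((hF a).union (hF b)).union (hF c)).union (hF d)).subset ?_
  rintro p ⟨hp, hM⟩
  rw [mem_ball_zero_iff] at hM
  have hn : ∀ w : ℂ, ‖p + w‖ ≤ M + ‖w‖ := fun w => (norm_add_le _ _).trans (by linarith)
  rcases hp with (⟨m, n, h⟩ | ⟨m, n, h⟩) | (⟨m, n, h⟩ | ⟨m, n, h⟩)
  · exact Or.inl (Or.inl (Or.inl ⟨p + a, ⟨m, n, Or.inl h, hn a⟩, add_sub_cancel_right p a⟩))
  · exact Or.inl (Or.inl (Or.inr ⟨p + b, ⟨m, n, Or.inl h, hn b⟩, add_sub_cancel_right p b⟩))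
  · exact Or.inl (Or.inr ⟨p + c, ⟨m, n, Or.inr h, hn c⟩, add_sub_cancel_right p c⟩)
  · exact Or.inr ⟨p + d, ⟨m, n, Or.inr h, hn d⟩, add_sub_cancel_right p d⟩

theorem im_eq_zero_of_mem_braLattice {ω : ℝ} {u : ℂ} (hu : u ∈ braLattice ω) : u.im = 0 := by
  obtain ⟨m, n, rfl⟩ := hu
  rw [add_im, intCast_im, div_ofReal_im, intCast_im, zero_div, add_zero]

theorem abs_im_le_of_mem_shifts {ω : ℝ} {a b c d p : ℂ}
    (hp : p ∈ zeroShifts ω a b ∪ poleShifts ω c d) : |p.im| ≤ |a.im| + |b.im| + |c.im| + |d.im| := by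
  have key : ∀ {w : ℂ}, p + w ∈ braLattice ω → |p.im| = |w.im| := by
    intro w h
    have := im_eq_zero_of_mem_braLattice h
    rw [add_im] at this
    rw [eq_neg_of_add_eq_zero_left this, abs_neg]
  have n1 := abs_nonneg a.im
  have n2 := abs_nonneg b.im
  have n3 := abs_nonneg c.im
  have n4 := abs_nonneg d.im
  rcases hp with (h | h) | (h | h)
  · linarith [key (braZeros_subset ω h)]
  · linarith [key (braZeros_subset ω h)]
  · linarith [key (braPoles_subset ω h)]
  · linarith [key (braPoles_subset ω h)]

theorem adapted_braKernel {ω : ℝ} (hω : 0 < ω) {a b c d : ℂ} (X : ℂ) {C : Contour} {σ : ℂ → ℂ}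
    (hL : ∀ p ∈ zeroShifts ω a b, C.OnLeft p ∧ σ p = Real.pi * I)
    (hR : ∀ p ∈ poleShifts ω c d, C.OnRight p ∧ σ p = -(Real.pi * I)) :
    C.Adapted (braKernel ω a b c d X) (zeroShifts ω a b ∪ poleShifts ω c d) σ where
  side p hp := hp.imp (hL p) (hR p)
  diff _ hz := differentiableAt_braKernel hω a b c d X hz
  mero z := meromorphicAt_braKernel hω a b c d X z
  finite M := finite_shifts_inter_ball hω a b c d M
  im_bdd := ⟨_, fun _ hp => abs_im_le_of_mem_shifts hp⟩

theorem exists_log_norm_bra_add {ω : ℝ} (hω : 0 < ω) (c : ℂ) (M : ℝ) : ∃ K Y : ℝ, ∀ z : ℂ,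
    |z.re| ≤ M → Y ≤ |z.im| → bra ω (z + c) ≠ 0 ∧
      |Real.log ‖bra ω (z + c)‖ -
        Real.pi * ω * (2 * z.re + 2 * c.re - (1 + 1 / ω)) * min z.im 0| ≤ K := by
  obtain ⟨K, H⟩ := exists_log_norm_bra hω (M + |c.re|)
  refine ⟨K + Real.pi * ω * (2 * M + 2 * |c.re| + (1 + 1 / ω)) * |c.im|, |c.im| + 1,
    fun z hz hy => ?_⟩
  have hp : 0 < 1 / ω := by positivity
  have hre : |(z + c).re| ≤ M + |c.re| := (abs_add_le _ _).trans (by linarith)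
  have him : 1 ≤ |(z + c).im| := by
    have := abs_sub_abs_le_abs_sub z.im (-c.im)
    rw [abs_neg, sub_neg_eq_add] at this
    rw [add_im]
    linarith
  obtain ⟨h0, h1⟩ := H _ hre him
  refine ⟨h0, ?_⟩
  have hmin : |min (z + c).im 0 - min z.im 0| ≤ |c.im| := by
    have := abs_min_sub_min_le_max (z + c).im 0 z.im 0
    simpa using this
  have hfac : |2 * z.re + 2 * c.re - (1 + 1 / ω)| ≤ 2 * M + 2 * |c.re| + (1 + 1 / ω) := by
    rw [abs_le] at hz ⊢
    constructor <;> linarith [neg_abs_le c.re, le_abs_self c.re, hz.1, hz.2]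
  have hdiff : |braGrowth ω (z + c) -
      Real.pi * ω * (2 * z.re + 2 * c.re - (1 + 1 / ω)) * min z.im 0| ≤
      Real.pi * ω * (2 * M + 2 * |c.re| + (1 + 1 / ω)) * |c.im| := by
    have e : braGrowth ω (z + c) -
        Real.pi * ω * (2 * z.re + 2 * c.re - (1 + 1 / ω)) * min z.im 0 =
        Real.pi * ω * (2 * z.re + 2 * c.re - (1 + 1 / ω)) *
          (min (z + c).im 0 - min z.im 0) := by
      rw [braGrowth, add_re]; ring
    have hpo : 0 < Real.pi * ω := by positivity
    rw [e, abs_mul, abs_mul, abs_of_pos hpo]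
    exact mul_le_mul (mul_le_mul_of_nonneg_left hfac hpo.le) hmin (abs_nonneg _)
      (mul_nonneg hpo.le ((abs_nonneg _).trans hfac))
  have := abs_add_le (Real.log ‖bra ω (z + c)‖ - braGrowth ω (z + c)) (braGrowth ω (z + c) -
    Real.pi * ω * (2 * z.re + 2 * c.re - (1 + 1 / ω)) * min z.im 0)
  rw [sub_add_sub_cancel] at this
  linarith

theorem one_add_sq_mul_exp_le {κ : ℝ} (hκ : 0 < κ) (y : ℝ) :
    Real.exp (-(κ * |y|)) ≤ (1 + 2 / κ ^ 2) * (1 + y ^ 2)⁻¹ := by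
  have h0 : 0 ≤ κ * |y| := by positivity
  have h := Real.quadratic_le_exp_of_nonneg h0
  rw [Real.exp_neg, ← div_eq_mul_inv, inv_eq_one_div, div_le_div_iff₀ (Real.exp_pos _) (by positivity)]
  have h2 : y ^ 2 = 2 / κ ^ 2 * ((κ * |y|) ^ 2 / 2) := by
    rw [mul_pow, sq_abs]; field_simp
  have h3 : 0 < 2 / κ ^ 2 := by positivity
  have h4 : 2 / κ ^ 2 * ((κ * |y|) ^ 2 / 2) ≤ 2 / κ ^ 2 * Real.exp (κ * |y|) := by
    gcongr
    linarith
  nlinarith [sq_nonneg (κ * |y|)]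

/-- In the quotient the contributions of Re z to the growth rate cancel. What remains is 2πω(-Re X ·
Im z + Re(c + d - a - b) min(Im z, 0)) up to a bounded error: the lower bound on Re X gives decay
upwards, the upper bound gives decay downwards. -/
theorem verticalDecay_braKernel {ω : ℝ} (hω : 0 < ω) {a b c d X : ℂ} (h0 : 0 < X.re)
    (h1 : X.re < c.re + d.re - a.re - b.re) : VerticalDecay (braKernel ω a b c d X) := by
  intro M
  obtain ⟨Ka, Ya, Ha⟩ := exists_log_norm_bra_add hω a M
  obtain ⟨Kb, Yb, Hb⟩ := exists_log_norm_bra_add hω b M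
  obtain ⟨Kc, Yc, Hc⟩ := exists_log_norm_bra_add hω c M
  obtain ⟨Kd, Yd, Hd⟩ := exists_log_norm_bra_add hω d M
  obtain ⟨δ, hδ, hδ1, hδ2⟩ : ∃ δ : ℝ, 0 < δ ∧ δ ≤ X.re ∧ δ ≤ c.re + d.re - a.re - b.re - X.re :=
    ⟨min X.re (c.re + d.re - a.re - b.re - X.re), lt_min h0 (by linarith), min_le_left _ _,
      min_le_right _ _⟩
  have hpo : 0 < 2 * Real.pi * ω := by positivity
  set κ := 2 * Real.pi * ω * δ with hκ
  have hκ0 : 0 < κ := by positivity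
  set L := 2 * Real.pi * ω * (|X.im| * M) + (Ka + Kb + Kc + Kd) with hL
  refine ⟨Real.exp L * (1 + 2 / κ ^ 2), max (max Ya Yb) (max Yc Yd), fun z hz hy => ?_⟩
  simp only [max_le_iff] at hy
  obtain ⟨na, ka⟩ := Ha z hz hy.1.1
  obtain ⟨nb, kb⟩ := Hb z hz hy.1.2
  obtain ⟨nc, kc⟩ := Hc z hz hy.2.1
  obtain ⟨nd, kd⟩ := Hd z hz hy.2.2
  have na' := norm_ne_zero_iff.2 na
  have nb' := norm_ne_zero_iff.2 nb
  have nc' := norm_ne_zero_iff.2 nc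
  have nd' := norm_ne_zero_iff.2 nd
  have hne : 0 < ‖braKernel ω a b c d X z‖ := by
    rw [norm_pos_iff, braKernel]
    exact mul_ne_zero (qpow_ne_zero _ _) (div_ne_zero (mul_ne_zero nc nd) (mul_ne_zero na nb))
  have hlog : Real.log ‖braKernel ω a b c d X z‖ = -(2 * Real.pi * ω * (X * z).im) +
      (Real.log ‖bra ω (z + c)‖ + Real.log ‖bra ω (z + d)‖
        - (Real.log ‖bra ω (z + a)‖ + Real.log ‖bra ω (z + b)‖)) := by
    rw [braKernel, norm_mul, norm_qpow, norm_div, norm_mul, norm_mul, Real.log_mul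
      (Real.exp_ne_zero _) (div_ne_zero (mul_ne_zero nc' nd') (mul_ne_zero na' nb')), Real.log_exp,
      Real.log_div (mul_ne_zero nc' nd') (mul_ne_zero na' nb'), Real.log_mul nc' nd',
      Real.log_mul na' nb']
  have hle : Real.log ‖braKernel ω a b c d X z‖ ≤ L + -(κ * |z.im|) := by
    have hX : -(X.im * z.re) ≤ |X.im| * M := by
      refine (neg_le_abs _).trans ?_
      rw [abs_mul]
      gcongr
    have hX' := mul_le_mul_of_nonneg_left hX hpo.le
    have hmin : -(X.re * z.im) + (c.re + d.re - a.re - b.re) * min z.im 0 ≤ -(δ * |z.im|) := by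
      rcases le_total 0 z.im with h | h
      · rw [min_eq_right h, abs_of_nonneg h]
        nlinarith
      · rw [min_eq_left h, abs_of_nonpos h]
        nlinarith
    have hmin' := mul_le_mul_of_nonneg_left hmin hpo.le
    rw [hlog, mul_im]
    have e1 := (abs_le.1 ka).1
    have e2 := (abs_le.1 kb).1
    have e3 := (abs_le.1 kc).2
    have e4 := (abs_le.1 kd).2
    rw [hL, hκ]
    ring_nf at e1 e2 e3 e4 hX' hmin' ⊢
    linarith
  calc ‖braKernel ω a b c d X z‖ = Real.exp (Real.log ‖braKernel ω a b c d X z‖) :=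
        (Real.exp_log hne).symm
    _ ≤ Real.exp (L + -(κ * |z.im|)) := Real.exp_le_exp.2 hle
    _ ≤ _ := by
      rw [Real.exp_add]
      exact (mul_le_mul_of_nonneg_left (one_add_sq_mul_exp_le hκ0 z.im) (Real.exp_pos L).le).trans_eq
        (mul_assoc _ _ _).symm

-- One σ has to serve three contours, so a zero of one denominator must not be a pole of another
-- numerator. As the first two kernels share their denominator or their numerator, such a point
-- would belong to both sets for a single kernel and lie on both sides of its contour. After
-- translation by 1 the poles of the third kernel are among those of the first two, on the same
-- sides.
open scoped Classical in
theorem braKernel_integral_relation {ω : ℝ} (hω : 0 < ω) {a b c d a₁ b₁ d₁ X : ℂ}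
    {C₁ C₂ C₃ : Contour}
    (hL₁ : ∀ p ∈ zeroShifts ω a₁ b₁, C₁.OnLeft p) (hR₁ : ∀ p ∈ poleShifts ω c d₁, C₁.OnRight p)
    (hL₂ : ∀ p ∈ zeroShifts ω a b, C₂.OnLeft p) (hR₂ : ∀ p ∈ poleShifts ω c d, C₂.OnRight p)
    {a₃ b₃ : ℂ} (hL₃ : ∀ p ∈ zeroShifts ω a₃ b₃, C₃.OnLeft p)
    (hR₃ : ∀ p ∈ poleShifts ω c (d + 1), C₃.OnRight p)
    (hsame : (a₁ = a ∧ b₁ = b) ∨ d₁ = d)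
    (ha₃ : a₃ = a + 1) (hb₃ : b₃ = b + 1 ∨ b₃ = b₁ + 1)
    (hX₁ : X.re < c.re + d₁.re - a₁.re - b₁.re) (hX₂ : X.re < c.re + d.re - a.re - b.re)
    (hX₃ : X.re < c.re + (d + 1).re - a₃.re - b₃.re) (hX : 0 < X.re)
    {E : Set ℂ} (hE : E.Countable) {k₁ k₂ k₃ : ℂ}
    (hrel : ∀ z, z ∉ E → k₁ * braKernel ω a₁ b₁ c d₁ X z + k₂ * braKernel ω a b c d X z =
      k₃ * braKernel ω a₃ b₃ c (d + 1) X (z - 1)) :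
    k₁ * C₁.integral (braKernel ω a₁ b₁ c d₁ X) + k₂ * C₂.integral (braKernel ω a b c d X) =
      k₃ * C₃.integral (braKernel ω a₃ b₃ c (d + 1) X) := by
  set σ : ℂ → ℂ := fun p => if p ∈ zeroShifts ω a₁ b₁ ∪ zeroShifts ω a b then Real.pi * I
    else -(Real.pi * I) with hσ
  have hin : ∀ p ∈ zeroShifts ω a₁ b₁ ∪ zeroShifts ω a b, σ p = Real.pi * I := fun p hp => if_pos hp
  have hout : ∀ p ∈ poleShifts ω c d₁ ∪ poleShifts ω c d, σ p = -(Real.pi * I) := by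
    intro p hp
    refine if_neg fun hp' => ?_
    have h₁ : ¬(p ∈ zeroShifts ω a₁ b₁ ∧ p ∈ poleShifts ω c d₁) := fun h =>
      C₁.not_onLeft_and_onRight p ⟨hL₁ p h.1, hR₁ p h.2⟩
    have h₂ : ¬(p ∈ zeroShifts ω a b ∧ p ∈ poleShifts ω c d) := fun h =>
      C₂.not_onLeft_and_onRight p ⟨hL₂ p h.1, hR₂ p h.2⟩
    simp only [mem_union] at hp hp'
    rcases hsame with ⟨rfl, rfl⟩ | rfl <;> tauto
  refine Contour.integral_relation
    (adapted_braKernel hω X (σ := σ) (fun p hp => ⟨hL₁ p hp, hin p (Or.inl hp)⟩)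
      fun p hp => ⟨hR₁ p hp, hout p (Or.inl hp)⟩)
    (adapted_braKernel hω X (fun p hp => ⟨hL₂ p hp, hin p (Or.inr hp)⟩)
      fun p hp => ⟨hR₂ p hp, hout p (Or.inr hp)⟩)
    (adapted_braKernel hω X (fun p hp => ⟨hL₃ p hp, hin _ ?_⟩)
      fun p hp => ⟨hR₃ p hp, hout _ ?_⟩)
    (verticalDecay_braKernel hω hX hX₁) (verticalDecay_braKernel hω hX hX₂)
    (verticalDecay_braKernel hω hX hX₃) hE hrel
  · rcases hp with hp | hp
    · rw [ha₃, ← add_assoc, add_right_comm] at hp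
      exact Or.inr (Or.inl hp)
    · rcases hb₃ with h | h
      · rw [h, ← add_assoc, add_right_comm] at hp
        exact Or.inr (Or.inr hp)
      · rw [h, ← add_assoc, add_right_comm] at hp
        exact Or.inl (Or.inr hp)
  · rcases hp with hp | hp
    -- The parameter c is not raised in the third kernel; translation by 1 takes the pole with index
    -- m to the one with index m + 1.
    · obtain ⟨m, n, h⟩ := hp
      refine Or.inr (Or.inl ⟨m + 1, n, ?_⟩)
      push_cast
      linear_combination h
    · rw [← add_assoc, add_right_comm] at hp
      exact Or.inr (Or.inr hp)

/-! ### Difference equations for Barnes kernels -/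

/-- The path may rest at a point of E for a set of parameters of positive measure, but there its
derivative vanishes. Where the derivative is nonzero, the parameters that hit a given point are
isolated. -/
theorem Contour.ae_notMem_of_countable (C : Contour) {E : Set ℂ} (hE : E.Countable) :
    ∀ᵐ s : ℝ, deriv C.path s = 0 ∨ C.path s ∉ E := by
  have h : ∀ e ∈ E, volume {s : ℝ | C.path s = e ∧ deriv C.path s ≠ 0} = 0 := by
    intro e _
    refine measure_null_of_locally_null _ fun s hs => ⟨{s}, ?_, measure_singleton s⟩
    have hd : HasDerivAt C.path (deriv C.path s) s :=
      (C.contDiff.differentiable one_ne_zero s).hasDerivAt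
    have := hd.eventually_ne (c := e) hs.2
    rw [eventually_nhdsWithin_iff] at this
    refine mem_nhdsWithin_iff_eventually.2 (this.mono fun t ht hts => ?_)
    by_contra hne
    exact ht hne hts.1
  rw [ae_iff]
  refine measure_mono_null ?_ ((measure_biUnion_null_iff hE).2 h)
  intro s hs
  rw [mem_ofPred_eq, not_or, not_not] at hs
  exact mem_iUnion₂.2 ⟨C.path s, hs.2, rfl, hs.1⟩

theorem Contour.ae_eq_of_countable (C : Contour) {E : Set ℂ} (hE : E.Countable) {f g : ℂ → ℂ}
    (h : ∀ z, z ∉ E → f z = g z) :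
    (fun s => f (C.path s) * deriv C.path s) =ᵐ[volume]
      fun s => g (C.path s) * deriv C.path s := by
  filter_upwards [C.ae_notMem_of_countable hE] with s hs
  rcases hs with hs | hs
  · rw [hs, mul_zero, mul_zero]
  · rw [h _ hs]

theorem countable_shifts {ω : ℝ} (u : ℂ) : {z : ℂ | z + u ∈ braLattice ω}.Countable :=
  (countable_braLattice ω).preimage (add_left_injective u)

theorem bra_sub_one {ω : ℝ} (hω : 0 < ω) {u : ℂ} (hu : u ∉ braPoles ω) :
    bra ω (u - 1) = (1 - qpow ω (u - 1)) * bra ω u := by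
  have := bra_eq_of_add_one_notMem hω (x := u - 1) (by rwa [sub_add_cancel])
  rwa [sub_add_cancel] at this

theorem qpow_sub_one_ne_one {ω : ℝ} (hω : 0 < ω) {u : ℂ} (hu : u ∉ braLattice ω) :
    qpow ω (u - 1) ≠ 1 := by
  refine qpow_ne_one_of_notMem hω fun h => hu ?_
  have := (add_int_mem_braLattice (ω := ω) (x := u) (-1)).1 (by push_cast; rwa [← sub_eq_add_neg])
  exact this

theorem qpow_add_int_div {ω : ℝ} (hω : 0 < ω) (u : ℂ) (k : ℤ) : qpow ω (u + k / ω) = qpow ω u := by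
  rw [qpow_add, (qpow_eq_one_iff hω).2 ⟨k, rfl⟩, mul_one]

/-- The points at which one of the factors of the kernel may vanish or have a pole. -/
def braKernelExcept (ω : ℝ) (a b c d : ℂ) : Set ℂ :=
  {z | z + a ∈ braLattice ω} ∪ {z | z + b ∈ braLattice ω} ∪ {z | z + c ∈ braLattice ω} ∪
    {z | z + d ∈ braLattice ω}

theorem countable_braKernelExcept (ω : ℝ) (a b c d : ℂ) : (braKernelExcept ω a b c d).Countable :=
  (((countable_shifts a).union (countable_shifts b)).union (countable_shifts c)).union
    (countable_shifts d)

theorem notMem_braKernelExcept {ω : ℝ} {a b c d z : ℂ} (hz : z ∉ braKernelExcept ω a b c d) :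
    z + a ∉ braLattice ω ∧ z + b ∉ braLattice ω ∧ z + c ∉ braLattice ω ∧ z + d ∉ braLattice ω := by
  simp only [braKernelExcept, mem_union, mem_ofPred_eq, not_or] at hz
  tauto

/-- With u = q^z and D = q^{d-1}, division by the second kernel leaves (1 - Du) - (1 - D) = D(1 -
u). The factor 1 - u is 1 - q^{z+c-1} from the shift of ⟨z + c⟩, which is why q^c = q is required.
-/
theorem braKernel_relation_right {ω : ℝ} (hω : 0 < ω) {a b c d : ℂ} (X : ℂ) {z : ℂ}
    (hc : qpow ω c = qpow ω 1) (hz : z ∉ braKernelExcept ω a b c d) :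
    1 * braKernel ω a b c (d - 1) X z + -(1 - qpow ω (d - 1)) * braKernel ω a b c d X z =
      qpow ω X * qpow ω (d - 1) * braKernel ω (a + 1) (b + 1) c (d + 1) X (z - 1) := by
  obtain ⟨-, -, hzc, hzd⟩ := notMem_braKernelExcept hz
  have e₁ : z + (d - 1) = z + d - 1 := by ring
  have e₂ : z - 1 + (a + 1) = z + a := by ring
  have e₃ : z - 1 + (b + 1) = z + b := by ring
  have e₄ : z - 1 + (d + 1) = z + d := by ring
  have e₅ : z - 1 + c = z + c - 1 := by ring
  have hX := qpow_ne_zero ω X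
  have h1 := qpow_ne_zero ω 1
  rw [braKernel, braKernel, braKernel, e₁, e₂, e₃, e₄, e₅,
    bra_sub_one hω fun h => hzd (braPoles_subset ω h),
    bra_sub_one hω fun h => hzc (braPoles_subset ω h), mul_sub, mul_one, qpow_sub ω (X * z),
    qpow_sub, qpow_sub, qpow_sub, qpow_add, qpow_add, hc]
  generalize bra ω (z + a) * bra ω (z + b) = D
  field_simp
  ring

/-- The same identity with A = q^a in place of D: raising a multiplies the kernel by 1 - Au. -/
theorem braKernel_relation_left {ω : ℝ} (hω : 0 < ω) {a b c d : ℂ} (X : ℂ) {z : ℂ}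
    (hc : qpow ω c = qpow ω 1) (hz : z ∉ braKernelExcept ω a b c d) :
    1 * braKernel ω (a + 1) b c d X z + -(1 - qpow ω a) * braKernel ω a b c d X z =
      qpow ω X * qpow ω a * braKernel ω (a + 1) (b + 1) c (d + 1) X (z - 1) := by
  obtain ⟨hza, -, hzc, -⟩ := notMem_braKernelExcept hz
  have e₁ : z + (a + 1) = z + a + 1 := by ring
  have e₂ : z - 1 + (a + 1) = z + a := by ring
  have e₃ : z - 1 + (b + 1) = z + b := by ring
  have e₄ : z - 1 + (d + 1) = z + d := by ring
  have e₅ : z - 1 + c = z + c - 1 := by ring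
  have hX := qpow_ne_zero ω X
  have h1 := qpow_ne_zero ω 1
  have hq := qpow_ne_one_of_notMem hω hza
  have hq' := sub_ne_zero.2 hq.symm
  rw [braKernel, braKernel, braKernel, e₁, e₂, e₃, e₄, e₅, bra_add_one ω hq,
    bra_sub_one hω fun h => hzc (braPoles_subset ω h), mul_sub, mul_one, qpow_sub ω (X * z),
    qpow_sub, qpow_add ω z c, hc, div_mul_eq_mul_div, div_div_eq_mul_div]
  rw [qpow_add]
  generalize bra ω (z + a) * bra ω (z + b) = D
  field_simp
  ring

/-- With A = q^a, B = q^{b-1} and after division by the second kernel and multiplication by 1 - Bu,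
this is (1 - B)(1 - Au) - (1 - A)(1 - Bu) = (A - B)(1 - u). -/
theorem braKernel_relation_opposite {ω : ℝ} (hω : 0 < ω) {a b c d : ℂ} (X : ℂ) {z : ℂ}
    (hc : qpow ω c = qpow ω 1) (hz : z ∉ braKernelExcept ω a b c d) :
    (1 - qpow ω (b - 1)) * braKernel ω (a + 1) (b - 1) c d X z +
        -(1 - qpow ω a) * braKernel ω a b c d X z =
      (qpow ω a - qpow ω (b - 1)) * qpow ω X *
        braKernel ω (a + 1) b c (d + 1) X (z - 1) := by
  obtain ⟨hza, hzb, hzc, -⟩ := notMem_braKernelExcept hz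
  have e₁ : z + (a + 1) = z + a + 1 := by ring
  have e₂ : z - 1 + (a + 1) = z + a := by ring
  have e₃ : z - 1 + b = z + b - 1 := by ring
  have e₄ : z - 1 + (d + 1) = z + d := by ring
  have e₅ : z - 1 + c = z + c - 1 := by ring
  have e₆ : z + (b - 1) = z + b - 1 := by ring
  have hX := qpow_ne_zero ω X
  have h1 := qpow_ne_zero ω 1
  have hq := qpow_ne_one_of_notMem hω hza
  have hq' := sub_ne_zero.2 hq.symm
  have hb' := sub_ne_zero.2 (qpow_sub_one_ne_one hω hzb).symm
  rw [braKernel, braKernel, braKernel, e₁, e₂, e₃, e₄, e₅, e₆, bra_add_one ω hq,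
    bra_sub_one hω fun h => hzc (braPoles_subset ω h),
    bra_sub_one hω fun h => hzb (braPoles_subset ω h), mul_sub, mul_one, qpow_sub ω (X * z),
    qpow_sub ω (z + c), qpow_add ω z c, hc, div_mul_eq_mul_div, div_div_eq_mul_div,
    mul_left_comm (bra ω (z + a))]
  have hB : qpow ω (z + b - 1) = qpow ω z * qpow ω (b - 1) := by rw [← qpow_add, add_sub_assoc]
  have hA := qpow_add ω z a
  rw [hB] at hb' ⊢
  rw [hA] at hq' ⊢
  simp only [div_eq_mul_inv, mul_inv]
  generalize (bra ω (z + a))⁻¹ * (bra ω (z + b))⁻¹ = D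
  have hw := inv_mul_cancel₀ hb'
  generalize (1 - qpow ω z * qpow ω (b - 1))⁻¹ = w at hw ⊢
  field_simp
  linear_combination qpow ω (X * z) * bra ω (z + c) * bra ω (z + d) * D * (1 - qpow ω a) * hw

/-! ### Shifts of ⟨u⟩ by multiples of 1/ω -/

theorem bra_add_nat_div {ω : ℝ} (hω : 0 < ω) {u : ℂ} (hu : u ∉ braLattice ω) (n : ℕ) :
    bra ω (u + n / ω) =
      bra ω u / poch (exp (2 * Real.pi * I * u)) (exp (2 * Real.pi * I / ω)) n := by
  induction n with
  | zero => simp [poch]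
  | succ n ih =>
    have h1 : u + n / ω ∉ braLattice ω := fun h =>
      hu ((add_int_div_mem_braLattice (n : ℤ)).1 (by exact_mod_cast h))
    have h2 : u + ((n + 1 : ℕ) : ℂ) / ω = u + n / ω + 1 / ω := by push_cast; ring
    have h3 : exp (2 * Real.pi * I * (u + n / ω)) =
        exp (2 * Real.pi * I * u) * exp (2 * Real.pi * I / ω) ^ n := by
      rw [← exp_nat_mul, ← exp_add]
      congr 1
      ring
    rw [h2, bra_add_inv hω h1, ih, h3, poch, poch, Finset.prod_range_succ, div_div]

theorem poch_exp_ne_zero {ω : ℝ} {u : ℂ} (hu : u ∉ braLattice ω) (n : ℕ) :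
    poch (exp (2 * Real.pi * I * u)) (exp (2 * Real.pi * I / ω)) n ≠ 0 := by
  refine Finset.prod_ne_zero_iff.2 fun j _ => ?_
  have h1 : u + j / ω ∉ braLattice ω := fun h =>
    hu ((add_int_div_mem_braLattice (j : ℤ)).1 (by exact_mod_cast h))
  have h3 : exp (2 * Real.pi * I * (u + j / ω)) =
      exp (2 * Real.pi * I * u) * exp (2 * Real.pi * I / ω) ^ j := by
    rw [← exp_nat_mul, ← exp_add]
    congr 1
    ring
  rw [← h3]
  exact sub_ne_zero.2 (exp_ne_one_of_notMem h1).symm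

theorem bra_sub_nat_div {ω : ℝ} (hω : 0 < ω) {u : ℂ} (hu : u ∉ braLattice ω) (n : ℕ) :
    bra ω (u - n / ω) = bra ω u *
      poch (exp (2 * Real.pi * I * (u - n / ω))) (exp (2 * Real.pi * I / ω)) n := by
  have h1 : u - n / ω ∉ braLattice ω := fun h => hu (by
    have := (add_int_div_mem_braLattice (n : ℤ)).2 h
    rw [Int.cast_natCast, sub_add_cancel] at this
    exact this)
  have := bra_add_nat_div hω h1 n
  rw [sub_add_cancel] at this
  rw [this, div_mul_cancel₀ _ (poch_exp_ne_zero h1 n)]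

/-! ### Twisted integrals -/

theorem Twist.toFun_congr (φ : Twist) {ω : ℝ} {α β γ α' β' γ' : ℂ}
    (ha : ∃ k : ℤ, α' = α + k) (hb : ∃ k : ℤ, β' = β + k) (hc : ∃ k : ℤ, γ' = γ + k) :
    φ.toFun ω α' β' γ' = φ.toFun ω α β γ := by
  have h : ∀ {u v : ℂ}, (∃ k : ℤ, v = u + k) →
      exp (2 * Real.pi * I * v) = exp (2 * Real.pi * I * u) := by
    rintro u _ ⟨k, rfl⟩
    exact exp_eq_exp_iff_exists_int.2 ⟨k, by ring⟩
  funext T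
  rw [Twist.toFun, Twist.toFun, h ha, h hb, h hc]

/-- The summand of the integrand of `Ψ(α, β, γ; x | φ̃)` that comes from `T ^ m`. -/
noncomputable def Twist.kernel (φ : Twist) (ω : ℝ) (α β γ x : ℂ) (m : ℤ) : ℂ → ℂ :=
  braKernel ω (α - φ.l₁ / ω) (β - φ.l₂ / ω) (1 + 1 / ω + φ.l₁' / ω) (γ + φ.l₂' / ω) (x + m / ω)

/-- T^m = q^{mz/ω} joins the exponential. Each factorial in the denominator of φ̃ is absorbed by one
of the four functions, raising an argument in the numerator or lowering one in the denominator by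
ℓ/ω; QT enters as e^{2πi(z+1+1/ω)}. -/
theorem twistedIntegrand_eq_sum {ω : ℝ} (hω : 0 < ω) (φ : Twist) (α β γ x : ℂ) {z : ℂ}
    (hz : z ∉ braKernelExcept ω α β 1 γ) :
    twistedIntegrand ω α β γ x (φ.toFun ω α β γ) z =
      ∑ m ∈ φ.num.support, φ.num m * φ.kernel ω α β γ x m z := by
  obtain ⟨ha, hb, h1, hc⟩ := notMem_braKernelExcept hz
  have h1' : z + 1 + 1 / ω ∉ braLattice ω := fun h =>
    h1 ((add_int_div_mem_braLattice 1).1 (by exact_mod_cast h))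
  have hT : ∀ m : ℤ, qpow ω ((x + m / ω) * z) =
      qpow ω (x * z) * exp (2 * Real.pi * I * z) ^ m := by
    intro m
    have hω' : (ω : ℂ) ≠ 0 := ofReal_ne_zero.2 hω.ne'
    rw [qpow, qpow, ← exp_int_mul, ← exp_add]
    congr 1
    field_simp
  have e1 : z + (1 + 1 / ω + φ.l₁' / ω) = z + 1 + 1 / ω + φ.l₁' / ω := by ring
  have eA : exp (2 * Real.pi * I * α) * exp (2 * Real.pi * I / ω) ^ (-(φ.l₁ : ℤ)) *
      exp (2 * Real.pi * I * z) = exp (2 * Real.pi * I * (z + α - φ.l₁ / ω)) := by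
    rw [← exp_int_mul, ← exp_add, ← exp_add]
    congr 1
    push_cast
    ring
  have eB : exp (2 * Real.pi * I * β) * exp (2 * Real.pi * I / ω) ^ (-(φ.l₂ : ℤ)) *
      exp (2 * Real.pi * I * z) = exp (2 * Real.pi * I * (z + β - φ.l₂ / ω)) := by
    rw [← exp_int_mul, ← exp_add, ← exp_add]
    congr 1
    push_cast
    ring
  have eQ : exp (2 * Real.pi * I / ω) * exp (2 * Real.pi * I * z) =
      exp (2 * Real.pi * I * (z + 1 + 1 / ω)) := by
    rw [← exp_add]
    exact exp_eq_exp_iff_exists_int.2 ⟨-1, by push_cast; ring⟩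
  have eC : exp (2 * Real.pi * I * γ) * exp (2 * Real.pi * I * z) =
      exp (2 * Real.pi * I * (z + γ)) := by
    rw [← exp_add]
    congr 1
    ring
  have hk : ∀ m, φ.kernel ω α β γ x m z = qpow ω (x * z) * exp (2 * Real.pi * I * z) ^ m *
      (bra ω (z + 1 + 1 / ω) * bra ω (z + γ) / (bra ω (z + α) * bra ω (z + β)) /
        (poch (exp (2 * Real.pi * I * (z + α - φ.l₁ / ω))) (exp (2 * Real.pi * I / ω)) φ.l₁ *
          poch (exp (2 * Real.pi * I * (z + β - φ.l₂ / ω))) (exp (2 * Real.pi * I / ω)) φ.l₂ *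
          poch (exp (2 * Real.pi * I * (z + 1 + 1 / ω))) (exp (2 * Real.pi * I / ω)) φ.l₁' *
          poch (exp (2 * Real.pi * I * (z + γ))) (exp (2 * Real.pi * I / ω)) φ.l₂')) := by
    intro m
    rw [Twist.kernel, braKernel, hT, e1, ← add_assoc, ← add_sub_assoc, ← add_sub_assoc,
      bra_add_nat_div hω h1', bra_add_nat_div hω hc, bra_sub_nat_div hω ha, bra_sub_nat_div hω hb]
    congr 1
    simp only [div_eq_mul_inv, mul_inv]
    ring
  rw [twistedIntegrand, Twist.toFun]
  simp only [eA, eB, eQ, eC, hk]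
  rw [Finset.sum_div, Finset.mul_sum]
  refine Finset.sum_congr rfl fun m _ => ?_
  ring

theorem Separates.zeroShifts {ω : ℝ} {l₁ l₂ l₁' l₂' : ℕ} {α β γ : ℂ} {C : Contour}
    (h : Separates ω l₁ l₂ l₁' l₂' α β γ C) :
    ∀ p ∈ zeroShifts ω (α - l₁ / ω) (β - l₂ / ω), C.OnLeft p := by
  rintro p (hp | hp)
  · have := (h.1 _ hp).1
    rwa [show -α + l₁ / ω + (p + (α - l₁ / ω)) = p by ring] at this
  · have := (h.1 _ hp).2
    rwa [show -β + l₂ / ω + (p + (β - l₂ / ω)) = p by ring] at this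

theorem Separates.poleShifts {ω : ℝ} {l₁ l₂ l₁' l₂' : ℕ} {α β γ : ℂ} {C : Contour}
    (h : Separates ω l₁ l₂ l₁' l₂' α β γ C) :
    ∀ p ∈ poleShifts ω (1 + 1 / ω + l₁' / ω) (γ + l₂' / ω), C.OnRight p := by
  rintro p (hp | hp)
  · have := (h.2 _ hp).1
    rwa [show -(1 + 1 / ω) - l₁' / ω + (p + (1 + 1 / ω + l₁' / ω)) = p by ring] at this
  · have := (h.2 _ hp).2
    rwa [show -γ - l₂' / ω + (p + (γ + l₂' / ω)) = p by ring] at this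

open scoped Classical in
theorem converges_braKernel {ω : ℝ} (hω : 0 < ω) {a b c d X : ℂ} {C : Contour}
    (hL : ∀ p ∈ zeroShifts ω a b, C.OnLeft p) (hR : ∀ p ∈ poleShifts ω c d, C.OnRight p)
    (h0 : 0 < X.re) (h1 : X.re < c.re + d.re - a.re - b.re) :
    C.Converges (braKernel ω a b c d X) :=
  (adapted_braKernel hω X
    (σ := fun p => if p ∈ zeroShifts ω a b then Real.pi * I else -(Real.pi * I))
    (fun p hp => ⟨hL p hp, if_pos hp⟩)
    (fun p hp => ⟨hR p hp, if_neg fun h => C.not_onLeft_and_onRight p ⟨hL p h, hR p hp⟩⟩)).converges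
    (verticalDecay_braKernel hω h0 h1)

theorem TwistedAdmissible.bounds {ω : ℝ} {φ : Twist} {C : Contour} {α β γ x : ℂ}
    (h : TwistedAdmissible ω φ C α β γ x) {m : ℤ} (hm : m ∈ φ.num.support) :
    0 < (x + m / ω).re ∧ (x + m / ω).re < (1 + 1 / ω + φ.l₁' / ω : ℂ).re +
      (γ + φ.l₂' / ω).re - (α - φ.l₁ / ω).re - (β - φ.l₂ / ω).re := by
  obtain ⟨h1, h2⟩ := h.2.2 m hm
  simp only [add_re, sub_re, div_ofReal_re, intCast_re, natCast_re, one_re]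
  refine ⟨h1, h2.trans_eq (by ring)⟩

theorem TwistedAdmissible.converges_kernel {ω : ℝ} (hω : 0 < ω) {φ : Twist} {C : Contour}
    {α β γ x : ℂ} (h : TwistedAdmissible ω φ C α β γ x) {m : ℤ} (hm : m ∈ φ.num.support) :
    C.Converges (φ.kernel ω α β γ x m) :=
  converges_braKernel hω h.2.1.zeroShifts h.2.1.poleShifts (h.bounds hm).1 (h.bounds hm).2

theorem TwistedAdmissible.ae_eq {ω : ℝ} (hω : 0 < ω) (φ : Twist) (C : Contour) (α β γ x : ℂ) :
    (fun s => twistedIntegrand ω α β γ x (φ.toFun ω α β γ) (C.path s) * deriv C.path s) =ᵐ[volume]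
      fun s => ∑ m ∈ φ.num.support,
        φ.num m * (φ.kernel ω α β γ x m (C.path s) * deriv C.path s) := by
  refine (C.ae_eq_of_countable (countable_braKernelExcept ω α β 1 γ)
    fun z hz => twistedIntegrand_eq_sum hω φ α β γ x hz).trans (Eventually.of_forall fun s => ?_)
  simp only [Finset.sum_mul, mul_assoc]

theorem TwistedAdmissible.converges {ω : ℝ} (hω : 0 < ω) {φ : Twist} {C : Contour} {α β γ x : ℂ}
    (h : TwistedAdmissible ω φ C α β γ x) :
    C.Converges (twistedIntegrand ω α β γ x (φ.toFun ω α β γ)) := by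
  refine Integrable.congr ?_ (ae_eq hω φ C α β γ x).symm
  exact integrable_finsetSum _ fun m hm => (h.converges_kernel hω hm).const_mul _

theorem TwistedAdmissible.integral_eq {ω : ℝ} (hω : 0 < ω) {φ : Twist} {C : Contour} {α β γ x : ℂ}
    (h : TwistedAdmissible ω φ C α β γ x) :
    C.integral (twistedIntegrand ω α β γ x (φ.toFun ω α β γ)) =
      ∑ m ∈ φ.num.support, φ.num m * C.integral (φ.kernel ω α β γ x m) := by
  rw [Contour.integral, integral_congr_ae (ae_eq hω φ C α β γ x),
    integral_finsetSum _ fun m hm => (h.converges_kernel hω hm).const_mul _]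
  refine Finset.sum_congr rfl fun m _ => ?_
  rw [integral_const_mul, Contour.integral]

/-- The relation holds for each summand with the same coefficients, so it holds for the sum. The
twist is formally built from different parameters in the three integrals; `hF₁`, `hF₂` and `hF₃` say
that it is one function F. -/
theorem TwistedAdmissible.integral_relation {ω : ℝ} (hω : 0 < ω) {φ : Twist} {C₁ C₂ C₃ : Contour}
    {α β γ α₁ β₁ γ₁ α₃ β₃ x : ℂ} (h₁ : TwistedAdmissible ω φ C₁ α₁ β₁ γ₁ x)
    (h₂ : TwistedAdmissible ω φ C₂ α β γ x) (h₃ : TwistedAdmissible ω φ C₃ α₃ β₃ (γ + 1) x)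
    (hsame : (α₁ = α ∧ β₁ = β) ∨ γ₁ = γ) (hα₃ : α₃ = α + 1) (hβ₃ : β₃ = β + 1 ∨ β₃ = β₁ + 1)
    {F : ℂ → ℂ} (hF₁ : φ.toFun ω α₁ β₁ γ₁ = F) (hF₂ : φ.toFun ω α β γ = F)
    (hF₃ : φ.toFun ω α₃ β₃ (γ + 1) = F) {k₁ k₂ k₃ : ℂ} {E : Set ℂ} (hE : E.Countable)
    (hrel : ∀ m : ℤ, ∀ z, z ∉ E → k₁ * φ.kernel ω α₁ β₁ γ₁ x m z + k₂ * φ.kernel ω α β γ x m z =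
      k₃ * φ.kernel ω α₃ β₃ (γ + 1) x m (z - 1)) :
    k₁ * C₁.integral (twistedIntegrand ω α₁ β₁ γ₁ x F) +
      k₂ * C₂.integral (twistedIntegrand ω α β γ x F) =
      k₃ * C₃.integral (twistedIntegrand ω α₃ β₃ (γ + 1) x F) := by
  have i₁ := h₁.integral_eq hω
  have i₂ := h₂.integral_eq hω
  have i₃ := h₃.integral_eq hω
  rw [hF₁] at i₁
  rw [hF₂] at i₂
  rw [hF₃] at i₃
  rw [i₁, i₂, i₃, Finset.mul_sum, Finset.mul_sum, Finset.mul_sum, ← Finset.sum_add_distrib]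
  refine Finset.sum_congr rfl fun m hm => ?_
  have e : γ + 1 + φ.l₂' / ω = γ + φ.l₂' / ω + 1 := by ring
  have g₃ := h₃.bounds hm
  have r₃ := h₃.2.1.poleShifts
  have hrel' := hrel m
  simp only [Twist.kernel, e] at g₃ r₃ hrel' ⊢
  have key := braKernel_integral_relation hω h₁.2.1.zeroShifts h₁.2.1.poleShifts h₂.2.1.zeroShifts
    h₂.2.1.poleShifts h₃.2.1.zeroShifts r₃
    (hsame.imp (fun h => by rw [h.1, h.2]; exact ⟨rfl, rfl⟩) fun h => by rw [h])
    (by rw [hα₃]; ring) (hβ₃.imp (fun h => by rw [h]; ring) fun h => by rw [h]; ring)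
    (h₁.bounds hm).2 (h₂.bounds hm).2 g₃.2 g₃.1 hE hrel'
  linear_combination φ.num m * key

/-! ### The contiguity relations -/

theorem Twist.qpow_kernel_param (φ : Twist) {ω : ℝ} (hω : 0 < ω) :
    qpow ω (1 + 1 / ω + φ.l₁' / ω) = qpow ω 1 := by
  have h1 := qpow_add_int_div hω (1 + 1 / ω) φ.l₁'
  have h2 := qpow_add_int_div hω 1 1
  rw [Int.cast_natCast] at h1
  rw [Int.cast_one] at h2
  rw [h1, h2]

theorem qpow_add_nat_div {ω : ℝ} (hω : 0 < ω) (u : ℂ) (n : ℕ) : qpow ω (u + n / ω) = qpow ω u := by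
  simpa using qpow_add_int_div hω u n

theorem qpow_sub_nat_div {ω : ℝ} (hω : 0 < ω) (u : ℂ) (n : ℕ) : qpow ω (u - n / ω) = qpow ω u := by
  rw [← qpow_add_nat_div hω (u - n / ω) n, sub_add_cancel]

/-- For the bare integrals, J₁ = (1 - c/q)J₂ + q^x (c/q) J₃. Since ⟨γ - 1⟩ = (1 - c/q)⟨γ⟩, the J₂
terms cancel in the difference of the normalised functions. -/
theorem psiTwisted_sub_one_right {ω : ℝ} (hω : 0 < ω) {φ : Twist} {C₁ C₂ C₃ : Contour}
    {α β γ x : ℂ} (hγ : qpow ω γ ≠ 1) (hγ' : qpow ω γ ≠ qpow ω 1)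
    (h₁ : TwistedAdmissible ω φ C₁ α β (γ - 1) x) (h₂ : TwistedAdmissible ω φ C₂ α β γ x)
    (h₃ : TwistedAdmissible ω φ C₃ (α + 1) (β + 1) (γ + 1) x) :
    PsiTwisted ω C₁ α β (γ - 1) x (φ.toFun ω α β γ)
        - PsiTwisted ω C₂ α β γ x (φ.toFun ω α β γ) =
      qpow ω x * qpow ω γ *
        ((1 - qpow ω α) * (1 - qpow ω β) /
          ((qpow ω 1 - qpow ω γ) * (1 - qpow ω γ))) *
        PsiTwisted ω C₃ (α + 1) (β + 1) (γ + 1) x (φ.toFun ω α β γ) := by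
  have key := TwistedAdmissible.integral_relation hω h₁ h₂ h₃ (Or.inl ⟨rfl, rfl⟩) rfl (Or.inl rfl)
    (φ.toFun_congr ⟨0, by simp⟩ ⟨0, by simp⟩ ⟨-1, by push_cast; ring⟩) rfl
    (φ.toFun_congr ⟨1, by simp⟩ ⟨1, by simp⟩ ⟨1, by simp⟩)
    (k₁ := 1) (k₂ := -(1 - qpow ω (γ - 1))) (k₃ := qpow ω x * qpow ω (γ - 1))
    (countable_braKernelExcept ω (α - φ.l₁ / ω) (β - φ.l₂ / ω) (1 + 1 / ω + φ.l₁' / ω)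
      (γ + φ.l₂' / ω)) fun m z hz => by
      have := braKernel_relation_right hω (x + m / ω) (φ.qpow_kernel_param hω) hz
      have e : γ + φ.l₂' / ω - 1 = γ - 1 + φ.l₂' / ω := by ring
      rw [e, qpow_add_nat_div hω, qpow_add_int_div hω] at this
      simp only [Twist.kernel]
      rwa [add_sub_right_comm α 1, add_sub_right_comm β 1, add_right_comm γ 1]
  -- Only α + 1 must not be a pole, which the third function guarantees; q^α = 1 is allowed.
  have gα := bra_eq_of_add_one_notMem hω h₃.1.1
  have gβ := bra_eq_of_add_one_notMem hω h₃.1.2.1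
  have gγ := bra_add_one ω hγ
  have hq1 := qpow_ne_zero ω 1
  have hne : qpow ω (γ - 1) ≠ 1 := by
    rw [qpow_sub, Ne, div_eq_one_iff_eq hq1]
    exact hγ'
  have gγ' := bra_add_one ω hne
  rw [sub_add_cancel, eq_div_iff (sub_ne_zero.2 hne.symm)] at gγ'
  rw [qpow_sub] at key gγ' hne
  have n1 := sub_ne_zero.2 hγ.symm
  have n2 := sub_ne_zero.2 hγ'.symm
  have n3 := sub_ne_zero.2 hne.symm
  simp only [PsiTwisted]
  rw [gα, gβ, gγ, ← gγ']
  set J₁ := C₁.integral _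
  set J₂ := C₂.integral _
  set J₃ := C₃.integral _
  have hJ : J₁ = (1 - qpow ω γ / qpow ω 1) * J₂ + qpow ω x * (qpow ω γ / qpow ω 1) * J₃ := by
    linear_combination key
  have n3' : 1 - qpow ω γ / qpow ω 1 = (qpow ω 1 - qpow ω γ) / qpow ω 1 := by field_simp
  rw [hJ, n3']
  simp only [div_eq_mul_inv, mul_inv, inv_inv]
  generalize (bra ω γ)⁻¹ = G
  field_simp
  ring

/-- Here J₁ = (1 - a)J₂ + q^x a J₃, and ⟨α⟩ = (1 - a)⟨α + 1⟩ makes the J₂ terms cancel. -/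
theorem psiTwisted_add_one_left {ω : ℝ} (hω : 0 < ω) {φ : Twist} {C₁ C₂ C₃ : Contour}
    {α β γ x : ℂ} (hγ : qpow ω γ ≠ 1)
    (h₁ : TwistedAdmissible ω φ C₁ (α + 1) β γ x) (h₂ : TwistedAdmissible ω φ C₂ α β γ x)
    (h₃ : TwistedAdmissible ω φ C₃ (α + 1) (β + 1) (γ + 1) x) :
    PsiTwisted ω C₁ (α + 1) β γ x (φ.toFun ω α β γ)
        - PsiTwisted ω C₂ α β γ x (φ.toFun ω α β γ) =
      qpow ω x * qpow ω α *
        ((1 - qpow ω β) / (1 - qpow ω γ)) *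
        PsiTwisted ω C₃ (α + 1) (β + 1) (γ + 1) x (φ.toFun ω α β γ) := by
  have key := TwistedAdmissible.integral_relation hω h₁ h₂ h₃ (Or.inr rfl) rfl (Or.inl rfl)
    (φ.toFun_congr ⟨1, by simp⟩ ⟨0, by simp⟩ ⟨0, by simp⟩) rfl
    (φ.toFun_congr ⟨1, by simp⟩ ⟨1, by simp⟩ ⟨1, by simp⟩)
    (k₁ := 1) (k₂ := -(1 - qpow ω α)) (k₃ := qpow ω x * qpow ω α)
    (countable_braKernelExcept ω (α - φ.l₁ / ω) (β - φ.l₂ / ω) (1 + 1 / ω + φ.l₁' / ω)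
      (γ + φ.l₂' / ω)) fun m z hz => by
      have := braKernel_relation_left hω (x + m / ω) (φ.qpow_kernel_param hω) hz
      rw [qpow_sub_nat_div hω, qpow_add_int_div hω] at this
      simp only [Twist.kernel]
      rwa [add_sub_right_comm α 1, add_sub_right_comm β 1, add_right_comm γ 1]
  have gα := bra_eq_of_add_one_notMem hω h₃.1.1
  have gβ := bra_eq_of_add_one_notMem hω h₃.1.2.1
  have gγ := bra_add_one ω hγ
  have n1 := sub_ne_zero.2 hγ.symm
  simp only [PsiTwisted]
  rw [gα, gβ, gγ]
  set J₁ := C₁.integral _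
  set J₂ := C₂.integral _
  set J₃ := C₃.integral _
  have hJ : J₁ = (1 - qpow ω α) * J₂ + qpow ω x * qpow ω α * J₃ := by linear_combination key
  rw [hJ]
  simp only [div_eq_mul_inv, mul_inv, inv_inv]
  generalize (bra ω γ)⁻¹ = G
  field_simp
  ring

/-- The coefficients 1 - b/q and 1 - a of J₁ and J₂ are what ⟨β - 1⟩ and ⟨α⟩ contribute relative to
the common factor ⟨α + 1⟩⟨β⟩. On the right a - b/q = (aq - b)/q turns q^x into q^{x-1}. -/
theorem psiTwisted_add_one_sub_one {ω : ℝ} (hω : 0 < ω) {φ : Twist} {C₁ C₂ C₃ : Contour}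
    {α β γ x : ℂ} (hγ : qpow ω γ ≠ 1)
    (h₁ : TwistedAdmissible ω φ C₁ (α + 1) (β - 1) γ x) (h₂ : TwistedAdmissible ω φ C₂ α β γ x)
    (h₃ : TwistedAdmissible ω φ C₃ (α + 1) β (γ + 1) x) :
    PsiTwisted ω C₁ (α + 1) (β - 1) γ x (φ.toFun ω α β γ)
        - PsiTwisted ω C₂ α β γ x (φ.toFun ω α β γ) =
      qpow ω (x - 1) *
        ((qpow ω α * qpow ω 1 - qpow ω β) / (1 - qpow ω γ)) *
        PsiTwisted ω C₃ (α + 1) β (γ + 1) x (φ.toFun ω α β γ) := by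
  have key := TwistedAdmissible.integral_relation hω h₁ h₂ h₃ (Or.inr rfl) rfl
    (Or.inr (sub_add_cancel β 1).symm)
    (φ.toFun_congr ⟨1, by simp⟩ ⟨-1, by push_cast; ring⟩ ⟨0, by simp⟩) rfl
    (φ.toFun_congr ⟨1, by simp⟩ ⟨0, by simp⟩ ⟨1, by simp⟩)
    (k₁ := 1 - qpow ω (β - 1)) (k₂ := -(1 - qpow ω α)) (k₃ := (qpow ω α - qpow ω (β - 1)) * qpow ω x)
    (countable_braKernelExcept ω (α - φ.l₁ / ω) (β - φ.l₂ / ω) (1 + 1 / ω + φ.l₁' / ω)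
      (γ + φ.l₂' / ω)) fun m z hz => by
      have := braKernel_relation_opposite hω (x + m / ω) (φ.qpow_kernel_param hω) hz
      rw [sub_right_comm β, qpow_sub_nat_div hω, qpow_sub_nat_div hω, qpow_add_int_div hω] at this
      simp only [Twist.kernel]
      rwa [add_sub_right_comm α 1, add_right_comm γ 1]
  have gα := bra_eq_of_add_one_notMem hω h₃.1.1
  have gβ := bra_sub_one hω h₂.1.2.1
  have gγ := bra_add_one ω hγ
  have n1 := sub_ne_zero.2 hγ.symm
  have hq1 := qpow_ne_zero ω 1
  simp only [PsiTwisted]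
  rw [gα, gβ, gγ]
  set J₁ := C₁.integral _
  set J₂ := C₂.integral _
  set J₃ := C₃.integral _
  rw [qpow_sub] at key ⊢
  rw [qpow_sub]
  simp only [div_eq_mul_inv, mul_inv, inv_inv]
  have n1' := mul_inv_cancel₀ n1
  have hq1' := mul_inv_cancel₀ hq1
  simp only [div_eq_mul_inv] at key
  generalize (bra ω γ)⁻¹ = G
  generalize (bra ω 1)⁻¹ = G₁
  generalize bra ω (α + 1) = A
  linear_combination A * bra ω β * G₁ * G * key +
    A * bra ω β * G₁ * G * qpow ω x * J₃ *
      ((qpow ω β * (qpow ω 1)⁻¹ - qpow ω α * qpow ω 1 * (qpow ω 1)⁻¹) * n1' - qpow ω α * hq1')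

/-- The trivial twist `φ̃ = 1`. -/
noncomputable def Twist.one : Twist := ⟨Finsupp.single 0 1, 0, 0, 0, 0⟩

theorem Twist.support_one : Twist.one.num.support = {0} := by
  simp [Twist.one, Finsupp.support_single]

theorem Twist.toFun_one (ω : ℝ) (α β γ : ℂ) : Twist.one.toFun ω α β γ = fun _ => 1 := by
  funext T
  rw [Twist.toFun, Twist.support_one, Finset.sum_singleton]
  simp [Twist.one, poch]

theorem PsiAdmissible.twisted {ω : ℝ} {C : Contour} {α β γ x : ℂ} (h : PsiAdmissible ω C α β γ x) :
    TwistedAdmissible ω Twist.one C α β γ x := by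
  obtain ⟨h1, h2, h3, h4⟩ := h
  refine ⟨h1, h2, fun m hm => ?_⟩
  rw [Twist.support_one, Finset.mem_singleton] at hm
  subst hm
  simpa [Twist.one] using And.intro h3 h4

/-- Writes the sine as e^{-πiz}(1 - T) up to a constant. The e^{-πiz} cancels the sign in (-q^x)^z,
and 1/(1 - T) is what raises ⟨z + 1⟩ to ⟨z + 1 + 1/ω⟩. -/
theorem exp_div_sin_pi_mul (z w : ℂ) (hz : exp (2 * Real.pi * I * z) ≠ 1) :
    -(1 / (2 * Real.pi * I)) * (Real.pi * exp ((w - Real.pi * I) * z) / sin (Real.pi * z)) =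
      exp (w * z) / (1 - exp (2 * Real.pi * I * z)) := by
  have h1 : sin (Real.pi * z) =
      exp (-(Real.pi * I * z)) * (1 - exp (2 * Real.pi * I * z)) * I / 2 := by
    rw [mul_sub, mul_one, ← exp_add, sin]
    congr 3
    · ring_nf
    · ring_nf
  have h2 : exp ((w - Real.pi * I) * z) = exp (w * z) * exp (-(Real.pi * I * z)) := by
    rw [← exp_add]
    congr 1
    ring
  have hE := exp_ne_zero (-(Real.pi * I * z))
  have hz' := sub_ne_zero.2 hz.symm
  have hπ : (Real.pi : ℂ) ≠ 0 := ofReal_ne_zero.2 Real.pi_ne_zero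
  have hI := I_ne_zero
  rw [h1, h2]
  generalize exp (-(Real.pi * I * z)) = e at *
  generalize exp (2 * Real.pi * I * z) = T at *
  field_simp
  linear_combination -I_sq

theorem barnesIntegrand_eq_twisted {ω : ℝ} (hω : 0 < ω) (α β γ x : ℂ) {z : ℂ}
    (hz : z + 0 ∉ braLattice ω) :
    barnesIntegrand ω α β γ x z =
      twistedIntegrand ω α β γ x (Twist.one.toFun ω α β γ) z := by
  rw [add_zero] at hz
  have h1 : z + 1 ∉ braLattice ω := fun h =>
    hz ((add_int_mem_braLattice 1).1 (by exact_mod_cast h))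
  have hexp : exp (2 * Real.pi * I * (z + 1)) = exp (2 * Real.pi * I * z) :=
    exp_eq_exp_iff_exists_int.2 ⟨1, by push_cast; ring⟩
  have h := exp_div_sin_pi_mul z (2 * Real.pi * I * ω * x) (exp_ne_one_of_notMem hz)
  rw [barnesIntegrand, twistedIntegrand, Twist.toFun_one, bra_add_inv hω h1, hexp, mul_right_comm,
    h, qpow, ← mul_assoc]
  ring

theorem barnesIntegrand_ae_eq {ω : ℝ} (hω : 0 < ω) (C : Contour) (α β γ x : ℂ) :
    (fun s => barnesIntegrand ω α β γ x (C.path s) * deriv C.path s) =ᵐ[volume] fun s =>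
      twistedIntegrand ω α β γ x (Twist.one.toFun ω α β γ) (C.path s) * deriv C.path s :=
  C.ae_eq_of_countable (countable_shifts 0) fun _ hz => barnesIntegrand_eq_twisted hω α β γ x hz

/-- The trivial twist is the constant 1 for any parameters, so α', β', γ' are free; this lets the
three functions of a relation carry the twist of one base point. -/
theorem psi_eq_psiTwisted {ω : ℝ} (hω : 0 < ω) (C : Contour) (α β γ α' β' γ' x : ℂ) :
    Psi ω C α β γ x = PsiTwisted ω C α β γ x (Twist.one.toFun ω α' β' γ') := by
  rw [Psi, PsiTwisted, Contour.integral, integral_congr_ae (barnesIntegrand_ae_eq hω C α β γ x),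
    Twist.toFun_one, Twist.toFun_one, Contour.integral]

theorem PsiAdmissible.converges {ω : ℝ} (hω : 0 < ω) {C : Contour} {α β γ x : ℂ}
    (h : PsiAdmissible ω C α β γ x) : C.Converges (barnesIntegrand ω α β γ x) :=
  (h.twisted.converges hω).congr (barnesIntegrand_ae_eq hω C α β γ x).symm

end QUnit

theorem mainTheorem3 (ω : ℝ) (hω : 0 < ω) (hirr : Irrational ω) (α β γ x : ℂ) :
    -- absolute convergence of the integrals
    (∀ C : Contour, PsiAdmissible ω C α β γ x →
      C.Converges (barnesIntegrand ω α β γ x)) ∧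
    (∀ (φ : Twist) (C : Contour), TwistedAdmissible ω φ C α β γ x →
      C.Converges (twistedIntegrand ω α β γ x (φ.toFun ω α β γ))) ∧
    -- the three relations for `Ψ(α, β, γ; x)`
    (∀ C₁ C₂ C₃ : Contour,
      qpow ω γ ≠ 1 → qpow ω γ ≠ qpow ω 1 →
      PsiAdmissible ω C₁ α β (γ - 1) x →
      PsiAdmissible ω C₂ α β γ x →
      PsiAdmissible ω C₃ (α + 1) (β + 1) (γ + 1) x →
      Psi ω C₁ α β (γ - 1) x - Psi ω C₂ α β γ x =
        qpow ω x * qpow ω γ *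
          ((1 - qpow ω α) * (1 - qpow ω β) /
            ((qpow ω 1 - qpow ω γ) * (1 - qpow ω γ))) *
          Psi ω C₃ (α + 1) (β + 1) (γ + 1) x) ∧
    (∀ C₁ C₂ C₃ : Contour,
      qpow ω γ ≠ 1 →
      PsiAdmissible ω C₁ (α + 1) β γ x →
      PsiAdmissible ω C₂ α β γ x →
      PsiAdmissible ω C₃ (α + 1) (β + 1) (γ + 1) x →
      Psi ω C₁ (α + 1) β γ x - Psi ω C₂ α β γ x =
        qpow ω x * qpow ω α *
          ((1 - qpow ω β) / (1 - qpow ω γ)) *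
          Psi ω C₃ (α + 1) (β + 1) (γ + 1) x) ∧
    (∀ C₁ C₂ C₃ : Contour,
      qpow ω γ ≠ 1 →
      PsiAdmissible ω C₁ (α + 1) (β - 1) γ x →
      PsiAdmissible ω C₂ α β γ x →
      PsiAdmissible ω C₃ (α + 1) β (γ + 1) x →
      Psi ω C₁ (α + 1) (β - 1) γ x - Psi ω C₂ α β γ x =
        qpow ω (x - 1) *
          ((qpow ω α * qpow ω 1 - qpow ω β) / (1 - qpow ω γ)) *
          Psi ω C₃ (α + 1) β (γ + 1) x) ∧
    -- the three relations for `Ψ(α, β, γ; x | φ̃)`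
    (∀ (φ : Twist) (C₁ C₂ C₃ : Contour),
      qpow ω γ ≠ 1 → qpow ω γ ≠ qpow ω 1 →
      TwistedAdmissible ω φ C₁ α β (γ - 1) x →
      TwistedAdmissible ω φ C₂ α β γ x →
      TwistedAdmissible ω φ C₃ (α + 1) (β + 1) (γ + 1) x →
      PsiTwisted ω C₁ α β (γ - 1) x (φ.toFun ω α β γ)
          - PsiTwisted ω C₂ α β γ x (φ.toFun ω α β γ) =
        qpow ω x * qpow ω γ *
          ((1 - qpow ω α) * (1 - qpow ω β) /
            ((qpow ω 1 - qpow ω γ) * (1 - qpow ω γ))) *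
          PsiTwisted ω C₃ (α + 1) (β + 1) (γ + 1) x (φ.toFun ω α β γ)) ∧
    (∀ (φ : Twist) (C₁ C₂ C₃ : Contour),
      qpow ω γ ≠ 1 →
      TwistedAdmissible ω φ C₁ (α + 1) β γ x →
      TwistedAdmissible ω φ C₂ α β γ x →
      TwistedAdmissible ω φ C₃ (α + 1) (β + 1) (γ + 1) x →
      PsiTwisted ω C₁ (α + 1) β γ x (φ.toFun ω α β γ)
          - PsiTwisted ω C₂ α β γ x (φ.toFun ω α β γ) =
        qpow ω x * qpow ω α *
          ((1 - qpow ω β) / (1 - qpow ω γ)) *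
          PsiTwisted ω C₃ (α + 1) (β + 1) (γ + 1) x (φ.toFun ω α β γ)) ∧
    (∀ (φ : Twist) (C₁ C₂ C₃ : Contour),
      qpow ω γ ≠ 1 →
      TwistedAdmissible ω φ C₁ (α + 1) (β - 1) γ x →
      TwistedAdmissible ω φ C₂ α β γ x →
      TwistedAdmissible ω φ C₃ (α + 1) β (γ + 1) x →
      PsiTwisted ω C₁ (α + 1) (β - 1) γ x (φ.toFun ω α β γ)
          - PsiTwisted ω C₂ α β γ x (φ.toFun ω α β γ) =
        qpow ω (x - 1) *
          ((qpow ω α * qpow ω 1 - qpow ω β) / (1 - qpow ω γ)) *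
          PsiTwisted ω C₃ (α + 1) β (γ + 1) x (φ.toFun ω α β γ)) := by
  refine ⟨fun C h => h.converges hω, fun φ C h => h.converges hω, ?_, ?_, ?_, ?_, ?_, ?_⟩
  · intro C₁ C₂ C₃ hγ hγ' h₁ h₂ h₃
    rw [psi_eq_psiTwisted hω C₁ _ _ _ α β γ, psi_eq_psiTwisted hω C₂ _ _ _ α β γ,
      psi_eq_psiTwisted hω C₃ _ _ _ α β γ]
    exact psiTwisted_sub_one_right hω hγ hγ' h₁.twisted h₂.twisted h₃.twisted
  · intro C₁ C₂ C₃ hγ h₁ h₂ h₃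
    rw [psi_eq_psiTwisted hω C₁ _ _ _ α β γ, psi_eq_psiTwisted hω C₂ _ _ _ α β γ,
      psi_eq_psiTwisted hω C₃ _ _ _ α β γ]
    exact psiTwisted_add_one_left hω hγ h₁.twisted h₂.twisted h₃.twisted
  · intro C₁ C₂ C₃ hγ h₁ h₂ h₃
    rw [psi_eq_psiTwisted hω C₁ _ _ _ α β γ, psi_eq_psiTwisted hω C₂ _ _ _ α β γ,
      psi_eq_psiTwisted hω C₃ _ _ _ α β γ]
    exact psiTwisted_add_one_sub_one hω hγ h₁.twisted h₂.twisted h₃.twisted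
  · intro φ C₁ C₂ C₃ hγ hγ' h₁ h₂ h₃
    exact psiTwisted_sub_one_right hω hγ hγ' h₁ h₂ h₃
  · intro φ C₁ C₂ C₃ hγ h₁ h₂ h₃
    exact psiTwisted_add_one_left hω hγ h₁ h₂ h₃
  · intro φ C₁ C₂ C₃ hγ h₁ h₂ h₃
    exact psiTwisted_add_one_sub_one hω hγ h₁ h₂ h₃
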